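/- Let $p$ be a prime and let $k$ be an algebraically closed field of characteristic $p$. **The hyperalgebra.** Let $X,Y,H$ be the standard basis of $\mathfrak{sl}_2(\mathbb C)$, put $X^{(m)}=X^m/m!$, $Y^{(m)}=Y^m/m!$ and $\binom{H+c}{m}=\frac{(H+c)(H+c-1)\cdots(H+c-m+1)}{m!}$ for $c\in\mathbb Z$, $m\ge 0$. Let $\mathcal U_{\mathbb Z}$ be the subring of the universal enveloping algebra of $\mathfrak{sl}_2(\mathbb C)$ generated by all $X^{(m)},Y^{(m)}$, and $\mathcal U=\mathcal U_{\mathbb Z}\otimes_{\mathbb Z}k$. The elements $Y^{(m)}\binom{H}{n}X^{(m')}$ $(m,n,m'\ge 0)$ form a $k$-basis of $\mathcal U$; let $\mathrm{Fr}':\mathcal U\to\mathcal U$ be the $k$-linear map with $Y^{(m)}\binom{H}{n}X^{(m')}\mapsto Y^{(mp)}\binom{H}{np}X^{(m'p)}$. For $a\in\mathbb Z$ let $\mu_a=\binom{H-a-1}{p-1}\in\mathcal U$. **The elements $B^{(\varepsilon)}(a,j)$.** Let $\varepsilon\in\{0,1\}$. If $p$ is odd, let $\mathcal P=\{0,\dots,p-1\}\times\{0,\dots,(p-1)/2\}$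 and, in $\mathbb F_p[x]$, let $\psi=\prod_{i\in\mathbb F_p}(x-i^2)$, $\psi^{(1)}_j=\psi/(x-j^2)$, $\psi^{(0)}_0=\prod_{i\ne 0}(x-i^2)$, and $\psi^{(0)}_j=2x(x+j^2)\prod_{i\ne 0,\pm j}(x-i^2)$ for $j\neq 0$; put $$B^{(\varepsilon)}(a,j)=\psi^{(\varepsilon)}_j\Big(\mu_aYX+\big(\tfrac{a+1}{2}\big)^2\Big)\mu_a ,$$ and let $n^{(\varepsilon)}(a,j)$ be the largest $n\ge 0$ such that $\prod_{i=0}^{n-1}(x-i(i+a+1))$ divides $\psi_j^{(\varepsilon)}\big(x+(\frac{a+1}2)^2\big)$. If $p=2$, let $\mathcal P=\{(0,\frac12),(1,0),(1,1)\}$ and $B^{(0)}(0,\frac12)=\mu_0$, $B^{(1)}(0,\frac12)=\mu_0YX$, $B^{(\varepsilon)}(1,0)=\mu_1YX$, $B^{(\varepsilon)}(1,1)=\mu_1YX+\mu_1$, with $n^{(0)}(0,\frac12)=0$, $n^{(1)}(0,\frac12)=1$, $n^{(\varepsilon)}(1,0)=1$, $n^{(\varepsilon)}(1,1)=0$. In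 all cases there are unique $c_m^{(\varepsilon)}\in\mathbb F_p$ (depending on $(a,j)$) with $B^{(\varepsilon)}(a,j)=\mu_a\sum_{m=n^{(\varepsilon)}(a,j)}^{p-1}c^{(\varepsilon)}_mY^mX^m$. **The maps $Z^{(\varepsilon)}$.** Let $(a,j)\in\mathcal P$, $z\in\mathcal U$. If either $a$ is even and $\frac{p-a+1}2\le j\le\frac{p-1}2$, or $a$ is odd and $0\le j\le\frac{a-1}2$, put $$Z^{(\varepsilon)}(z;(a,j))=\mu_a\sum_{m=n^{(\varepsilon)}(a,j)}^{p-1}c_m^{(\varepsilon)}\,Y^mX^{m-s(a,j)}\,\mathrm{Fr}'(z)\,X^{s(a,j)},$$ where $s(a,j)=1$ if $p=2$, and for $p$ odd $s(a,j)=\frac{p-a+1}{2}$ if $a$ is even, $s(a,j)=\frac{p-a}{2}$ if $a$ is odd. For all other $(a,j)\in\mathcal P$ put $Z^{(\varepsilon)}(z;(a,j))=\mathrm{Fr}'(z)B^{(\varepsilon)}(a,j)$. **The elements $B^{(\boldsymbol\varepsilon)}(\mathbf a,\mathbf j)$.** For $r\ge 1$, $\boldsymbol\varepsilon=(\varepsilon_0,\dots,\varepsilon_{r-1})\in\{0,1\}^r$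 and $(\mathbf a,\mathbf j)=((a_i,j_i))_{i=0}^{r-1}\in\mathcal P^r$, define recursively $B^{(\boldsymbol\varepsilon)}(\mathbf a,\mathbf j)=B^{(\varepsilon_0)}(a_0,j_0)$ if $r=1$, and $$B^{(\boldsymbol\varepsilon)}(\mathbf a,\mathbf j)=Z^{(\varepsilon_0)}\Big(B^{(\varepsilon_1,\dots,\varepsilon_{r-1})}\big((a_1,\dots,a_{r-1}),(j_1,\dots,j_{r-1})\big);(a_0,j_0)\Big)$$ if $r\ge 2$. Let $\mathbf e_{s+1}\in\mathbb Z^r$ be the tuple with $1$ in the position of $\varepsilon_s$ and $0$ elsewhere. **Proposition 3.7.** Let $r\ge 1$, $\boldsymbol\varepsilon\in\{0,1\}^r$, $(\mathbf a,\mathbf j)\in\mathcal P^r$ and $0\le s\le r-1$. If $\varepsilon_s=0$, then $$Y^{(p^s)}X^{(p^s)}B^{(\boldsymbol\varepsilon)}(\mathbf a,\mathbf j)=\Big(j_s^2-\big(\tfrac{a_s+1}{2}\big)^2\Big)B^{(\boldsymbol\varepsilon)}(\mathbf a,\mathbf j)+4j_s^2\,B^{(\boldsymbol\varepsilon+\mathbf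 e_{s+1})}(\mathbf a,\mathbf j),$$ and if $\varepsilon_s=1$, then $$Y^{(p^s)}X^{(p^s)}B^{(\boldsymbol\varepsilon)}(\mathbf a,\mathbf j)=\Big(j_s^2-\big(\tfrac{a_s+1}{2}\big)^2\Big)B^{(\boldsymbol\varepsilon)}(\mathbf a,\mathbf j).$$ Here the coefficients are read in $\mathbb F_p\subseteq k$ (for $p=2$ they are integers). -/

import Mathlib

open scoped Nat TensorProduct Polynomial

noncomputable section

namespace Hyperalgebra

/-! ### The divided power form of the enveloping algebra of `sl₂(ℂ)` -/

/-- The universal enveloping algebra of `sl₂(ℂ)`. -/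
abbrev UC : Type := UniversalEnvelopingAlgebra ℂ (LieAlgebra.SpecialLinear.sl (Fin 2) ℂ)

/-- The standard basis element `X` of `sl₂(ℂ)`. -/
def slX : LieAlgebra.SpecialLinear.sl (Fin 2) ℂ :=
  ⟨!![0, 1; 0, 0], by
    simp [LieAlgebra.SpecialLinear.sl, Matrix.trace_fin_two]⟩

/-- The standard basis element `Y` of `sl₂(ℂ)`. -/
def slY : LieAlgebra.SpecialLinear.sl (Fin 2) ℂ :=
  ⟨!![0, 0; 1, 0], by
    simp [LieAlgebra.SpecialLinear.sl, Matrix.trace_fin_two]⟩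

/-- The standard basis element `H` of `sl₂(ℂ)`. -/
def slH : LieAlgebra.SpecialLinear.sl (Fin 2) ℂ :=
  ⟨!![1, 0; 0, -1], by
    simp [LieAlgebra.SpecialLinear.sl, Matrix.trace_fin_two]⟩

/-- `X` in the enveloping algebra. -/
def XC : UC := UniversalEnvelopingAlgebra.ι ℂ slX

/-- `Y` in the enveloping algebra. -/
def YC : UC := UniversalEnvelopingAlgebra.ι ℂ slY

/-- `H` in the enveloping algebra. -/
def HC : UC := UniversalEnvelopingAlgebra.ι ℂ slH

/-- The divided power `x ^ m / m!`. -/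
def dividedPower (x : UC) (m : ℕ) : UC := ((m ! : ℂ)⁻¹) • x ^ m

/-- The element `(H + c)(H + c - 1) ⋯ (H + c - m + 1) / m!`. -/
def hBinom (c : ℤ) (m : ℕ) : UC :=
  ((m ! : ℂ)⁻¹) • Polynomial.aeval (HC + (c : UC)) (descPochhammer ℂ m)

/-- The subring generated by all divided powers of `X` and of `Y`. -/
def UZ : Subring UC :=
  Subring.closure (Set.range (dividedPower XC) ∪ Set.range (dividedPower YC))

/-! Commutation rules. -/

theorem lie_slX_slY : ⁅slX, slY⁆ = slH := by
  apply Subtype.ext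
  rw [LieAlgebra.SpecialLinear.sl_bracket]
  simp [slX, slY, slH]

theorem lie_slH_slX : ⁅slH, slX⁆ = (2 : ℂ) • slX := by
  apply Subtype.ext
  rw [LieAlgebra.SpecialLinear.sl_bracket]
  simp [slX, slH]
  norm_num

theorem lie_slH_slY : ⁅slH, slY⁆ = (-2 : ℂ) • slY := by
  apply Subtype.ext
  rw [LieAlgebra.SpecialLinear.sl_bracket]
  ext i j
  fin_cases i <;> fin_cases j <;> norm_num [slY, slH]

section

attribute [local instance] LieRing.ofAssociativeRing

theorem ι_lie (a b : LieAlgebra.SpecialLinear.sl (Fin 2) ℂ) :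
    UniversalEnvelopingAlgebra.ι ℂ ⁅a, b⁆ =
      UniversalEnvelopingAlgebra.ι ℂ a * UniversalEnvelopingAlgebra.ι ℂ b -
        UniversalEnvelopingAlgebra.ι ℂ b * UniversalEnvelopingAlgebra.ι ℂ a := by
  rw [LieHom.map_lie, LieRing.of_associative_ring_bracket]

end

theorem XC_mul_YC : XC * YC = YC * XC + HC := by
  have h := ι_lie slX slY
  rw [lie_slX_slY] at h
  change HC = XC * YC - YC * XC at h
  rw [h]; abel

theorem XC_mul_HC : XC * HC = (HC - 2) * XC := by
  have h := ι_lie slH slX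
  rw [lie_slH_slX, map_smul] at h
  change (2 : ℂ) • XC = HC * XC - XC * HC at h
  rw [two_smul] at h
  rw [sub_mul, two_mul, h]; abel

theorem HC_mul_YC : HC * YC = YC * (HC - 2) := by
  have h := ι_lie slH slY
  rw [lie_slH_slY, map_smul] at h
  change (-2 : ℂ) • YC = HC * YC - YC * HC at h
  rw [neg_smul, two_smul] at h
  rw [mul_sub, mul_two]
  have : HC * YC = -(YC + YC) + YC * HC := by rw [h]; abel
  rw [this]; abel

/-- Polynomials in `H`. -/
def hp (q : ℂ[X]) : UC := Polynomial.aeval HC q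

theorem hp_mul (q r : ℂ[X]) : hp (q * r) = hp q * hp r := map_mul _ _ _
theorem hp_add (q r : ℂ[X]) : hp (q + r) = hp q + hp r := map_add _ _ _

theorem XC_mul_hp (q : ℂ[X]) : XC * hp q = hp (q.comp (Polynomial.X - 2)) * XC := by
  induction q using Polynomial.induction_on' with
  | add a b ha hb => simp only [hp_add, mul_add, ha, hb, Polynomial.add_comp, add_mul]
  | monomial n c =>
    induction n generalizing c with
    | zero =>
      simp only [hp, Polynomial.monomial_zero_left, Polynomial.aeval_C, Polynomial.C_comp]
      exact (Algebra.commutes c XC).symm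
    | succ n ih =>
      rw [← Polynomial.monomial_mul_X, hp_mul, ← mul_assoc, ih, Polynomial.mul_comp, hp_mul,
        mul_assoc, mul_assoc]
      congr 1
      simp only [hp, Polynomial.aeval_X, Polynomial.X_comp, map_sub, map_ofNat, XC_mul_HC]

theorem hp_mul_YC (q : ℂ[X]) : hp q * YC = YC * hp (q.comp (Polynomial.X - 2)) := by
  induction q using Polynomial.induction_on' with
  | add a b ha hb => simp only [hp_add, mul_add, ha, hb, Polynomial.add_comp, add_mul]
  | monomial n c =>
    induction n generalizing c with
    | zero =>
      simp only [hp, Polynomial.monomial_zero_left, Polynomial.aeval_C, Polynomial.C_comp]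
      exact (Algebra.commutes c YC)
    | succ n ih =>
      rw [← Polynomial.X_mul_monomial, hp_mul, mul_assoc, ih, Polynomial.mul_comp, hp_mul,
        ← mul_assoc, ← mul_assoc]
      congr 1
      simp only [hp, Polynomial.aeval_X, Polynomial.X_comp, map_sub, map_ofNat, HC_mul_YC]

theorem hBinom_eq (c : ℤ) (m : ℕ) :
    hBinom c m = hp (Ring.choose (Polynomial.X + (c : ℂ[X])) m) := by
  have h : Ring.choose (Polynomial.X + (c : ℂ[X])) m =
      ((m ! : ℂ)⁻¹) • (descPochhammer ℂ m).comp (Polynomial.X + (c : ℂ[X])) := by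
    have h2 := Ring.descPochhammer_eq_factorial_smul_choose (Polynomial.X + (c : ℂ[X])) m
    rw [← Polynomial.aeval_eq_smeval, ← Nat.cast_smul_eq_nsmul ℂ] at h2
    rw [eq_inv_smul_iff₀ (Nat.cast_ne_zero.mpr (Nat.factorial_ne_zero m)), ← h2,
      ← descPochhammer_map (Int.castRingHom ℂ), Polynomial.comp, Polynomial.eval₂_map,
      Polynomial.aeval_def]
    congr 1
  rw [h, hp, map_smul, Polynomial.aeval_comp, hBinom]
  simp

/-- Divided powers with integer exponent, zero for negative exponents. -/
def dpz (x : UC) (n : ℤ) : UC := if 0 ≤ n then dividedPower x n.toNat else 0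

theorem dpz_natCast (x : UC) (n : ℕ) : dpz x n = dividedPower x n := by simp [dpz]

theorem dpz_neg (x : UC) {n : ℤ} (h : n < 0) : dpz x n = 0 := by
  simp [dpz, not_le.mpr h]

theorem mul_dividedPower (x : UC) (n : ℕ) :
    x * dividedPower x n = ((n : ℂ) + 1) • dividedPower x (n + 1) := by
  have h : ((n : ℂ) + 1) ≠ 0 := by exact_mod_cast Nat.succ_ne_zero n
  rw [dividedPower, dividedPower, mul_smul_comm, smul_smul, ← pow_succ']
  congr 1
  rw [Nat.factorial_succ]
  push_cast
  field_simp

theorem mul_dpz (x : UC) (n : ℤ) : x * dpz x n = ((n : ℂ) + 1) • dpz x (n + 1) := by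
  rcases lt_trichotomy n (-1) with h | h | h
  · rw [dpz_neg x (by omega), dpz_neg x (by omega)]; simp
  · subst h; simp [dpz]
  · obtain ⟨m, rfl⟩ := Int.eq_ofNat_of_zero_le (show 0 ≤ n by omega)
    have : ((m : ℤ) + 1) = ((m + 1 : ℕ) : ℤ) := by push_cast; rfl
    rw [this, dpz_natCast, dpz_natCast, mul_dividedPower]
    simp

theorem dividedPower_mul (x : UC) (a b : ℕ) :
    dividedPower x a * dividedPower x b = ((a + b).choose a : ℤ) • dividedPower x (a + b) := by
  rw [dividedPower, dividedPower, dividedPower, smul_mul_smul_comm, ← pow_add,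
    ← Int.cast_smul_eq_zsmul ℂ, smul_smul]
  congr 1
  have h1 : ((a + b).choose a : ℂ) * (a ! : ℂ) * (b ! : ℂ) = ((a + b)! : ℂ) := by
    exact_mod_cast (Nat.choose_symm_add (a := a) (b := b)) ▸
      Nat.add_choose_mul_factorial_mul_factorial a b
  have ha : (a ! : ℂ) ≠ 0 := Nat.cast_ne_zero.mpr (Nat.factorial_ne_zero a)
  have hb : (b ! : ℂ) ≠ 0 := Nat.cast_ne_zero.mpr (Nat.factorial_ne_zero b)
  have hab : ((a + b)! : ℂ) ≠ 0 := Nat.cast_ne_zero.mpr (Nat.factorial_ne_zero _)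
  push_cast
  field_simp
  rw [← h1]; ring

theorem XC_mul_dpz_YC (n : ℤ) :
    XC * dpz YC n = dpz YC n * XC + dpz YC (n - 1) * hp (Polynomial.X - (n : ℂ[X]) + 1) := by
  rcases lt_or_ge n 0 with h | h
  · rw [dpz_neg _ h, dpz_neg _ (by omega)]; simp
  obtain ⟨m, rfl⟩ := Int.eq_ofNat_of_zero_le h
  clear h
  induction m with
  | zero => simp [dpz, dividedPower]
  | succ m ih =>
    have e : ((m + 1 : ℕ) : ℤ) = (m : ℤ) + 1 := by push_cast; rfl
    have hm : ((m : ℂ) + 1) ≠ 0 := by exact_mod_cast Nat.succ_ne_zero m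
    have key : YC * dpz YC m = ((m : ℂ) + 1) • dpz YC (m + 1) := by
      have := mul_dpz YC m; simpa using this
    have key2 : YC * dpz YC ((m : ℤ) - 1) = (m : ℂ) • dpz YC m := by
      have := mul_dpz YC ((m : ℤ) - 1); simpa using this
    have comm : HC * dpz YC m = dpz YC m * hp (Polynomial.X - 2 * (m : ℂ[X])) := by
      rw [dpz_natCast, dividedPower, mul_smul_comm, smul_mul_assoc]
      congr 1
      clear ih key key2 hm e
      have : HC = hp Polynomial.X := by simp [hp]
      rw [this]
      induction m with
      | zero => simp
      | succ m ih =>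
        rw [pow_succ, ← mul_assoc, ih, mul_assoc, mul_assoc, hp_mul_YC]
        congr 3
        simp; ring
    rw [e]
    have h1 : ((m : ℂ) + 1) • (XC * dpz YC (m + 1)) =
        ((m : ℂ) + 1) • (dpz YC (m + 1) * XC + dpz YC ((m : ℤ) + 1 - 1) *
          hp (Polynomial.X - (((m : ℤ) + 1 : ℤ) : ℂ[X]) + 1)) := by
      rw [← mul_smul_comm, ← key, ← mul_assoc, XC_mul_YC, add_mul, mul_assoc, ih, mul_add,
        ← mul_assoc, key, ← mul_assoc, key2, comm, add_sub_cancel_right, smul_add,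
        smul_mul_assoc, smul_mul_assoc, add_assoc]
      congr 1
      rw [← mul_smul_comm, ← mul_add, ← mul_smul_comm]
      congr 1
      rw [hp, hp, hp, ← map_smul, ← map_smul, ← map_add]
      congr 1
      simp only [Polynomial.smul_eq_C_mul, map_add, map_natCast, map_one]
      push_cast
      ring
    exact (smul_right_injective UC hm) h1

/-- Integer valued binomial polynomials. -/
def bp (c : ℤ) (m : ℕ) : ℂ[X] := Ring.choose (Polynomial.X + (c : ℂ[X])) m

theorem hp_bp (c : ℤ) (m : ℕ) : hp (bp c m) = hBinom c m := (hBinom_eq c m).symm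

theorem bp_comp (c d : ℤ) (m : ℕ) : (bp c m).comp (Polynomial.X + (d : ℂ[X])) = bp (c + d) m := by
  have := Ring.map_choose (Polynomial.compRingHom (Polynomial.X + (d : ℂ[X])) : ℂ[X] →+* ℂ[X])
    (Polynomial.X + (c : ℂ[X])) m
  rw [Polynomial.coe_compRingHom_apply] at this
  rw [bp, this, bp]
  congr 1
  simp
  ring

theorem choose_rec (q : ℂ[X]) (m : ℕ) :
    (m + 1 : ℂ[X]) * Ring.choose q (m + 1) = (q - m) * Ring.choose q m := by
  have h := Ring.choose_smul_choose q (Nat.le_succ m)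
  simp at h
  rw [mul_comm (q - m)]
  simpa using h

theorem XC_mul_dividedPower_mul (a : ℕ) (b : ℤ) :
    dividedPower XC a * dpz YC b = ∑ i ∈ Finset.range (a + 1),
      dpz YC (b - i) * hp (bp (2 * i - a - b) i) * dpz XC (a - i) := by
  induction a with
  | zero => simp [dpz, dividedPower, bp, hp]
  | succ a ih =>
    have ha : ((a : ℂ) + 1) ≠ 0 := by exact_mod_cast Nat.succ_ne_zero a
    apply smul_right_injective UC ha
    simp only
    rw [← smul_mul_assoc, ← mul_dividedPower, mul_assoc, ih, Finset.mul_sum]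
    have step : ∀ i ∈ Finset.range (a + 1),
        XC * (dpz YC (b - i) * hp (bp (2 * i - a - b) i) * dpz XC (a - i)) =
        dpz YC (b - i) * hp (((a : ℂ[X]) + 1 - i) * bp (2 * i - a - b - 2) i) * dpz XC (a + 1 - i) +
        dpz YC (b - (i + 1 : ℕ)) * hp ((Polynomial.X - (b : ℂ[X]) + (i : ℂ[X]) + 1) *
          bp (2 * i - a - b) i) * dpz XC (((a + 1 : ℕ) : ℤ) - (i + 1 : ℕ)) := by
      intro i _
      rw [← mul_assoc, ← mul_assoc, XC_mul_dpz_YC, add_mul, add_mul]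
      congr 1
      · rw [mul_assoc (dpz YC _) XC, XC_mul_hp, mul_assoc, mul_assoc, mul_dpz, mul_assoc]
        congr 1
        rw [mul_smul_comm, ← smul_mul_assoc]
        have e1 : (a : ℤ) - i + 1 = a + 1 - i := by ring
        rw [e1]
        congr 1
        rw [hp, hp, ← map_smul]
        congr 1
        have := bp_comp (2 * i - a - b) (-2) i
        push_cast at this
        rw [sub_eq_add_neg Polynomial.X, this, Polynomial.smul_eq_C_mul]
        simp only [← sub_eq_add_neg]
        congr 1
        simp
        ring
      · rw [hp_mul, ← mul_assoc]
        have e1 : b - i - 1 = b - (i + 1 : ℕ) := by push_cast; ring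
        have e2 : (a : ℤ) - i = (a + 1 : ℕ) - (i + 1 : ℕ) := by push_cast; ring
        have e3 : (Polynomial.X - ((b - i : ℤ) : ℂ[X]) + 1) =
          (Polynomial.X - (b : ℂ[X]) + (i : ℂ[X]) + 1) := by push_cast; ring
        rw [e1, e2, e3]
    rw [Finset.sum_congr rfl step, Finset.sum_add_distrib]
    have first : ∑ i ∈ Finset.range (a + 1), dpz YC (b - i) *
        hp (((a : ℂ[X]) + 1 - i) * bp (2 * i - a - b - 2) i) * dpz XC (a + 1 - i) =
      ∑ i ∈ Finset.range (a + 1 + 1), dpz YC (b - i) *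
        hp (((a : ℂ[X]) + 1 - i) * bp (2 * i - a - b - 2) i) * dpz XC (a + 1 - i) := by
      rw [Finset.sum_range_succ _ (a + 1)]
      simp [hp]
    rw [first, Finset.sum_range_succ', add_right_comm, ← Finset.sum_add_distrib]
    conv_rhs => rw [Finset.sum_range_succ']
    rw [smul_add, Finset.smul_sum]
    congr 1
    · apply Finset.sum_congr rfl
      intro i _
      have e2 : (a : ℤ) + 1 - (i + 1 : ℕ) = (a + 1 : ℕ) - (i + 1 : ℕ) := by push_cast; ring
      rw [e2, ← add_mul, ← mul_add, ← smul_mul_assoc, ← mul_smul_comm]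
      congr 2
      rw [hp, hp, hp, ← map_add, ← map_smul]
      congr 1
      rw [Polynomial.smul_eq_C_mul]
      set q : ℂ[X] := Polynomial.X + ((2 * i - a - b : ℤ) : ℂ[X]) with hq
      have b1 : bp (2 * (i + 1 : ℕ) - a - b - 2) (i + 1) = Ring.choose q (i + 1) := by
        rw [bp, hq]; congr 2; push_cast; ring
      have b2 : bp (2 * i - a - b) i = Ring.choose q i := rfl
      have b3 : bp (2 * (i + 1 : ℕ) - (a + 1 : ℕ) - b) (i + 1) =
          Ring.choose q i + Ring.choose q (i + 1) := by
        rw [← Ring.choose_succ_succ, bp, hq]; congr 1; push_cast; ring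
      rw [b1, b2, b3]
      have r := choose_rec q i
      have e4 : (Polynomial.X : ℂ[X]) - b + i + 1 = q - i + a + 1 := by
        rw [hq]; push_cast; ring
      rw [e4]
      simp only [map_add, map_natCast, map_one]
      push_cast
      linear_combination -r
    · simp only [Nat.cast_zero, bp, Ring.choose_zero_right, mul_one]
      rw [← smul_mul_assoc, ← mul_smul_comm]
      congr 2
      simp [hp, Algebra.smul_def]

theorem bp_eq_sum (c d : ℤ) (n : ℕ) :
    bp (c + d) n = ∑ ij ∈ Finset.HasAntidiagonal.antidiagonal n, Ring.choose d ij.2 • bp c ij.1 := by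
  have h : Polynomial.X + ((c + d : ℤ) : ℂ[X]) = (Polynomial.X + (c : ℂ[X])) + (d : ℂ[X]) := by
    push_cast; ring
  rw [bp, h, Ring.add_choose_eq n (Commute.all _ _)]
  apply Finset.sum_congr rfl
  intro ij _
  have := Ring.map_choose (Int.castRingHom ℂ[X]) d ij.2
  simp only [eq_intCast] at this
  rw [← this, zsmul_eq_mul, mul_comm, bp]

theorem bp_mul (m n : ℕ) :
    bp 0 m * bp 0 n = ∑ ij ∈ Finset.HasAntidiagonal.antidiagonal n,
      (Ring.choose (m : ℤ) ij.2 * ((m + ij.1).choose m : ℤ)) • bp 0 (m + ij.1) := by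
  have h : bp 0 n = bp (-m + m) n := by simp
  rw [h, bp_eq_sum, Finset.mul_sum]
  apply Finset.sum_congr rfl
  intro ij _
  rw [mul_smul_comm, mul_smul]
  congr 1
  have := Ring.choose_smul_choose (Polynomial.X : ℂ[X]) (Nat.le_add_right m ij.1)
  rw [Nat.add_sub_cancel_left] at this
  simp only [bp, Int.cast_zero, add_zero, Int.cast_neg, Int.cast_natCast, ← sub_eq_add_neg]
  rw [← this, natCast_zsmul]

theorem dividedPower_XC_mem (m : ℕ) : dividedPower XC m ∈ UZ :=
  Subring.subset_closure (Or.inl ⟨m, rfl⟩)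

theorem dividedPower_YC_mem (m : ℕ) : dividedPower YC m ∈ UZ :=
  Subring.subset_closure (Or.inr ⟨m, rfl⟩)

theorem dpz_XC_mem (m : ℤ) : dpz XC m ∈ UZ := by
  unfold dpz; split_ifs
  exacts [dividedPower_XC_mem _, zero_mem _]

theorem dpz_YC_mem (m : ℤ) : dpz YC m ∈ UZ := by
  unfold dpz; split_ifs
  exacts [dividedPower_YC_mem _, zero_mem _]

theorem hp_bp_mem_of_le (n : ℕ) (h : ∀ k ≤ n, hp (bp 0 k) ∈ UZ) (c : ℤ) : hp (bp c n) ∈ UZ := by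
  rw [← zero_add c, bp_eq_sum, hp, map_sum]
  refine sum_mem fun ij hij => ?_
  rw [map_zsmul]
  exact zsmul_mem (h _ (Finset.HasAntidiagonal.antidiagonal.fst_le hij)) _

theorem hp_bp_zero_mem (n : ℕ) : hp (bp 0 n) ∈ UZ := by
  induction n using Nat.strong_induction_on with
  | _ n ih =>
    have h := XC_mul_dividedPower_mul n n
    rw [Finset.sum_range_succ] at h
    have e : (2 * n - n - n : ℤ) = 0 := by ring
    have d0 (x : UC) : dpz x 0 = 1 := by simp [dpz, dividedPower]
    rw [sub_self, d0, d0, e, one_mul, mul_one] at h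
    rw [← sub_eq_iff_eq_add'] at h
    rw [← h]
    refine sub_mem (mul_mem (dividedPower_XC_mem _) (dpz_YC_mem _)) (sum_mem fun i hi => ?_)
    refine mul_mem (mul_mem (dpz_YC_mem _) (hp_bp_mem_of_le i (fun k hk => ih k ?_) _))
      (dpz_XC_mem _)
    exact lt_of_le_of_lt hk (Finset.mem_range.mp hi)

theorem hBinom_mem (c : ℤ) (n : ℕ) : hBinom c n ∈ UZ := by
  rw [hBinom_eq]
  exact hp_bp_mem_of_le n (fun k _ => hp_bp_zero_mem k) c

/-- The element `Y^(m) (H choose n) X^(m')` of the enveloping algebra, for `i = (m, n, m')`. -/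
def pbwC (i : ℕ × ℕ × ℕ) : UC := dividedPower YC i.1 * hBinom 0 i.2.1 * dividedPower XC i.2.2

/-- The integral span of the elements `Y^(m) (H choose n) X^(m')`. -/
def pbwSpan : Submodule ℤ UC := Submodule.span ℤ (Set.range pbwC)

/-- The integral span of the binomial polynomials. -/
def bpSpan : Submodule ℤ ℂ[X] := Submodule.span ℤ (Set.range (bp 0))

theorem bp_mem_bpSpan (c : ℤ) (n : ℕ) : bp c n ∈ bpSpan := by
  rw [← zero_add c, bp_eq_sum]
  exact sum_mem fun ij _ => Submodule.smul_mem _ _ (Submodule.subset_span ⟨_, rfl⟩)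

theorem bpSpan_mul {q r : ℂ[X]} (hq : q ∈ bpSpan) (hr : r ∈ bpSpan) : q * r ∈ bpSpan := by
  induction hq, hr using Submodule.span_induction₂ with
  | mem_mem x y hx hy =>
    obtain ⟨m, rfl⟩ := hx
    obtain ⟨n, rfl⟩ := hy
    rw [bp_mul]
    exact sum_mem fun ij _ => Submodule.smul_mem _ _ (Submodule.subset_span ⟨_, rfl⟩)
  | zero_left y _ => simp
  | zero_right y _ => simp
  | add_left x y z _ _ _ h1 h2 => rw [add_mul]; exact add_mem h1 h2
  | add_right x y z _ _ _ h1 h2 => rw [mul_add]; exact add_mem h1 h2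
  | smul_left r x y _ _ h => rw [smul_mul_assoc]; exact Submodule.smul_mem _ _ h
  | smul_right r x y _ _ h => rw [mul_smul_comm]; exact Submodule.smul_mem _ _ h

theorem mem_pbwSpan_of_bpSpan {q : ℂ[X]} (hq : q ∈ bpSpan) (m l : ℕ) :
    dividedPower YC m * hp q * dividedPower XC l ∈ pbwSpan := by
  induction hq using Submodule.span_induction with
  | mem x hx =>
    obtain ⟨n, rfl⟩ := hx
    rw [hp_bp]
    exact Submodule.subset_span ⟨(m, n, l), rfl⟩
  | zero => simp [hp]
  | add x y _ _ h1 h2 => rw [hp_add, mul_add, add_mul]; exact add_mem h1 h2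
  | smul a x _ h =>
    rw [hp, map_zsmul, mul_smul_comm, smul_mul_assoc]; exact Submodule.smul_mem _ _ h

theorem XC_pow_mul_hp (a : ℕ) (q : ℂ[X]) :
    XC ^ a * hp q = hp (q.comp (Polynomial.X + ((-2 * a : ℤ) : ℂ[X]))) * XC ^ a := by
  induction a with
  | zero => simp
  | succ a ih =>
    rw [pow_succ', mul_assoc, ih, ← mul_assoc, XC_mul_hp, mul_assoc, Polynomial.comp_assoc]
    congr 3
    simp
    ring

theorem dividedPower_XC_mul_hp (a : ℕ) (q : ℂ[X]) :
    dividedPower XC a * hp q =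
      hp (q.comp (Polynomial.X + ((-2 * a : ℤ) : ℂ[X]))) * dividedPower XC a := by
  rw [dividedPower, smul_mul_assoc, XC_pow_mul_hp, mul_smul_comm]

theorem dividedPower_XC_mul_mem (a : ℕ) (i : ℕ × ℕ × ℕ) :
    dividedPower XC a * pbwC i ∈ pbwSpan := by
  obtain ⟨m, n, l⟩ := i
  simp only [pbwC]
  rw [← mul_assoc, ← mul_assoc, ← dpz_natCast YC, XC_mul_dividedPower_mul, Finset.sum_mul,
    Finset.sum_mul]
  refine sum_mem fun i hi => ?_
  have hi' : i ≤ a := Nat.lt_succ_iff.mp (Finset.mem_range.mp hi)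
  by_cases him : (m : ℤ) - i < 0
  · simp [dpz_neg _ him]
  have e1 : (m : ℤ) - i = (m - i : ℕ) := by omega
  have e2 : (a : ℤ) - i = (a - i : ℕ) := by omega
  rw [e1, e2, dpz_natCast, dpz_natCast, mul_assoc (dividedPower YC _ * _), ← hp_bp,
    dividedPower_XC_mul_hp, bp_comp, mul_assoc, mul_assoc, mul_assoc (hp _), dividedPower_mul,
    mul_smul_comm, mul_smul_comm, mul_smul_comm, ← mul_assoc (hp _), ← hp_mul, ← mul_assoc]
  exact Submodule.smul_mem _ _
    (mem_pbwSpan_of_bpSpan (bpSpan_mul (bp_mem_bpSpan _ _) (bp_mem_bpSpan _ _)) _ _)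

theorem dividedPower_YC_mul_mem (a : ℕ) (i : ℕ × ℕ × ℕ) :
    dividedPower YC a * pbwC i ∈ pbwSpan := by
  obtain ⟨m, n, l⟩ := i
  simp only [pbwC]
  rw [← mul_assoc, ← mul_assoc, dividedPower_mul, smul_mul_assoc, smul_mul_assoc]
  exact Submodule.smul_mem _ _ (Submodule.subset_span ⟨(a + m, n, l), rfl⟩)

theorem mul_mem_pbwSpan {x : UC} (hx : x ∈ UZ) : ∀ y ∈ pbwSpan, x * y ∈ pbwSpan := by
  induction hx using Subring.closure_induction with
  | mem x hx =>
    intro y hy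
    induction hy using Submodule.span_induction with
    | mem y hy =>
      obtain ⟨i, rfl⟩ := hy
      rcases hx with ⟨a, rfl⟩ | ⟨a, rfl⟩
      · exact dividedPower_XC_mul_mem a i
      · exact dividedPower_YC_mul_mem a i
    | zero => simp
    | add y z _ _ h1 h2 => rw [mul_add]; exact add_mem h1 h2
    | smul c y _ h => rw [mul_smul_comm]; exact Submodule.smul_mem _ _ h
  | zero => intro y _; simp
  | one => intro y hy; simpa using hy
  | add x z _ _ h1 h2 => intro y hy; rw [add_mul]; exact add_mem (h1 y hy) (h2 y hy)
  | neg x _ h => intro y hy; rw [neg_mul]; exact neg_mem (h y hy)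
  | mul x z _ _ h1 h2 => intro y hy; rw [mul_assoc]; exact h1 _ (h2 y hy)

theorem UZ_le_pbwSpan {x : UC} (hx : x ∈ UZ) : x ∈ pbwSpan := by
  have h1 : (1 : UC) ∈ pbwSpan := by
    refine Submodule.subset_span ⟨(0, 0, 0), ?_⟩
    simp [pbwC, dividedPower, hBinom]
  simpa using mul_mem_pbwSpan hx 1 h1

/-! ### Linear independence of the elements `Y^(m) (H choose n) X^(m')`

They are separated by the action on the universal Verma module `ℂ[t][y]`. -/

/-- `Y` acts by multiplication by `y`. -/
def vermaY : Module.End ℂ ℂ[X][X] := LinearMap.mulLeft ℂ Polynomial.X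

/-- The derivative with respect to `y`. -/
def vermaD : Module.End ℂ ℂ[X][X] := (Polynomial.derivative (R := ℂ[X])).restrictScalars ℂ

/-- `H` acts by `t - 2 y ∂`. -/
def vermaH : Module.End ℂ ℂ[X][X] :=
  LinearMap.mulLeft ℂ (Polynomial.C Polynomial.X) - (2 : ℂ) • (vermaY * vermaD)

/-- `X` acts by `t ∂ - y ∂ ^ 2`. -/
def vermaX : Module.End ℂ ℂ[X][X] :=
  LinearMap.mulLeft ℂ (Polynomial.C Polynomial.X) * vermaD - vermaY * vermaD * vermaD

theorem vermaY_apply (f : ℂ[X][X]) : vermaY f = Polynomial.X * f := rfl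
theorem vermaH_apply (f : ℂ[X][X]) : vermaH f =
    Polynomial.C Polynomial.X * f - 2 * (Polynomial.X * Polynomial.derivative f) := by
  change Polynomial.C Polynomial.X * f - (2 : ℂ) • (Polynomial.X * Polynomial.derivative f) = _
  rw [two_smul, two_mul]
theorem vermaX_apply (f : ℂ[X][X]) : vermaX f =
    Polynomial.C Polynomial.X * Polynomial.derivative f -
      Polynomial.X * Polynomial.derivative (Polynomial.derivative f) := rfl

theorem verma_XY : vermaX * vermaY - vermaY * vermaX = vermaH := by
  ext1 f
  simp only [LinearMap.sub_apply, Module.End.mul_apply, vermaX_apply, vermaY_apply, vermaH_apply,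
    Polynomial.derivative_mul, Polynomial.derivative_X, Polynomial.derivative_add, one_mul]
  ring

theorem verma_HX : vermaH * vermaX - vermaX * vermaH = (2 : ℂ) • vermaX := by
  rw [two_smul]
  ext1 f
  simp only [LinearMap.sub_apply, LinearMap.add_apply, Module.End.mul_apply, vermaX_apply,
    vermaH_apply, Polynomial.derivative_mul, Polynomial.derivative_X, Polynomial.derivative_add,
    Polynomial.derivative_sub, Polynomial.derivative_C, Polynomial.derivative_ofNat,
    one_mul, zero_mul, zero_add]
  ring

theorem verma_HY : vermaH * vermaY - vermaY * vermaH = (-2 : ℂ) • vermaY := by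
  ext1 f
  simp only [LinearMap.sub_apply, LinearMap.smul_apply, Module.End.mul_apply, vermaY_apply,
    vermaH_apply, Polynomial.derivative_mul, Polynomial.derivative_X, neg_smul, two_smul, one_mul]
  ring

section

attribute [local instance] LieRing.ofAssociativeRing

/-- The representation of `sl₂(ℂ)` on the universal Verma module. -/
def vermaLie : LieAlgebra.SpecialLinear.sl (Fin 2) ℂ →ₗ⁅ℂ⁆ Module.End ℂ ℂ[X][X] where
  toFun A := A.1 0 1 • vermaX + A.1 1 0 • vermaY + A.1 0 0 • vermaH
  map_add' A B := by simp [add_smul]; abel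
  map_smul' c A := by simp [mul_smul]
  map_lie' := by
    intro A B
    have hA : A.1 1 1 = - A.1 0 0 := by
      have h : Matrix.trace A.1 = 0 := A.2
      rw [Matrix.trace_fin_two] at h
      linear_combination h
    have hB : B.1 1 1 = - B.1 0 0 := by
      have h : Matrix.trace B.1 = 0 := B.2
      rw [Matrix.trace_fin_two] at h
      linear_combination h
    have h1 : vermaX * vermaY = vermaY * vermaX + vermaH := by rw [← verma_XY]; abel
    have h2 : vermaH * vermaX = vermaX * vermaH + (2 : ℂ) • vermaX := by rw [← verma_HX]; abel
    have h3 : vermaH * vermaY = vermaY * vermaH + (-2 : ℂ) • vermaY := by rw [← verma_HY]; abel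
    simp only [LieAlgebra.SpecialLinear.sl_bracket, LieRing.of_associative_ring_bracket,
      Matrix.sub_apply, Matrix.mul_apply, Fin.sum_univ_two, hA, hB, add_mul, mul_add,
      smul_mul_smul_comm, h1, h2, h3, smul_add, smul_smul]
    module

/-- The action of the enveloping algebra on the universal Verma module. -/
def verma : UC →ₐ[ℂ] Module.End ℂ ℂ[X][X] := UniversalEnvelopingAlgebra.lift ℂ vermaLie

theorem verma_XC : verma XC = vermaX := by
  rw [verma, XC, UniversalEnvelopingAlgebra.lift_ι_apply]
  change slX.1 0 1 • vermaX + slX.1 1 0 • vermaY + slX.1 0 0 • vermaH = _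
  simp [slX]

theorem verma_YC : verma YC = vermaY := by
  rw [verma, YC, UniversalEnvelopingAlgebra.lift_ι_apply]
  change slY.1 0 1 • vermaX + slY.1 1 0 • vermaY + slY.1 0 0 • vermaH = _
  simp [slY]

theorem verma_HC : verma HC = vermaH := by
  rw [verma, HC, UniversalEnvelopingAlgebra.lift_ι_apply]
  change slH.1 0 1 • vermaX + slH.1 1 0 • vermaY + slH.1 0 0 • vermaH = _
  simp [slH]

end

theorem vermaX_C_mul_X_pow (g : ℂ[X]) (l : ℕ) :
    vermaX (Polynomial.C g * Polynomial.X ^ (l + 1)) =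
      Polynomial.C ((l + 1 : ℂ[X]) * (Polynomial.X - (l : ℂ[X])) * g) * Polynomial.X ^ l := by
  rw [vermaX_apply]
  cases l with
  | zero => simp [Polynomial.derivative_mul]
  | succ l =>
    simp only [Polynomial.derivative_mul, Polynomial.derivative_X_pow, Polynomial.derivative_C,
      zero_mul, zero_add, Polynomial.C_mul, Polynomial.C_sub, Polynomial.C_add,
      Polynomial.derivative_natCast, map_natCast, map_one, Nat.add_sub_cancel, Nat.cast_add,
      Nat.cast_one, Polynomial.derivative_add, Polynomial.derivative_one, add_zero]
    ring

theorem vermaX_pow_of_lt (g : ℂ[X]) {i l : ℕ} (h : i < l) :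
    (vermaX ^ l) (Polynomial.C g * Polynomial.X ^ i) = 0 := by
  induction i generalizing l g with
  | zero =>
    obtain ⟨l, rfl⟩ := Nat.exists_eq_succ_of_ne_zero h.ne'
    rw [pow_succ, Module.End.mul_apply, vermaX_apply]
    simp
  | succ i ih =>
    obtain ⟨l, rfl⟩ := Nat.exists_eq_succ_of_ne_zero (Nat.ne_zero_of_lt h)
    rw [pow_succ, Module.End.mul_apply, vermaX_C_mul_X_pow]
    exact ih _ (by omega)

theorem vermaX_pow_self (l : ℕ) : ∃ κ : ℂ[X], κ ≠ 0 ∧ ∀ g : ℂ[X],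
    (vermaX ^ l) (Polynomial.C g * Polynomial.X ^ l) = Polynomial.C (κ * g) := by
  induction l with
  | zero => exact ⟨1, one_ne_zero, fun g => by simp⟩
  | succ l ih =>
    obtain ⟨κ, hκ, h⟩ := ih
    refine ⟨κ * ((l + 1 : ℂ[X]) * (Polynomial.X - (l : ℂ[X]))), ?_, fun g => ?_⟩
    · refine mul_ne_zero hκ (mul_ne_zero ?_ ?_)
      · exact_mod_cast Nat.succ_ne_zero l
      · rw [← Polynomial.C_eq_natCast]; exact Polynomial.X_sub_C_ne_zero _
    · rw [pow_succ, Module.End.mul_apply, vermaX_C_mul_X_pow, h]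
      congr 1
      ring

theorem verma_hp (q g : ℂ[X]) : verma (hp q) (Polynomial.C g) = Polynomial.C (q * g) := by
  rw [hp, ← Polynomial.aeval_algHom_apply, verma_HC]
  induction q using Polynomial.induction_on' generalizing g with
  | add a b ha hb => rw [map_add, LinearMap.add_apply, ha, hb, ← Polynomial.C_add, add_mul]
  | monomial n c =>
    induction n generalizing g with
    | zero =>
      rw [Polynomial.monomial_zero_left, Polynomial.aeval_C, Module.algebraMap_end_apply,
        Polynomial.smul_C, Polynomial.smul_eq_C_mul]
    | succ n ih =>
      rw [← Polynomial.monomial_mul_X, map_mul, Polynomial.aeval_X, Module.End.mul_apply,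
        vermaH_apply]
      simp only [Polynomial.derivative_C, mul_zero, sub_zero]
      rw [← Polynomial.C_mul, ih, mul_assoc]

theorem verma_pbwC (m n l i : ℕ) : verma (pbwC (m, n, l)) (Polynomial.X ^ i) =
    ((l ! : ℂ)⁻¹ * (m ! : ℂ)⁻¹) • (Polynomial.X ^ m *
      verma (hp (bp 0 n)) ((vermaX ^ l) (Polynomial.X ^ i))) := by
  have hY : ∀ f, (vermaY ^ m) f = Polynomial.X ^ m * f := by
    induction m with
    | zero => simp
    | succ m ih =>
      intro f
      rw [pow_succ', Module.End.mul_apply, ih, vermaY_apply, pow_succ', mul_assoc]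
  rw [pbwC, ← hp_bp]
  simp only [map_mul, dividedPower, map_smul, map_pow, verma_XC, verma_YC, Module.End.mul_apply,
    LinearMap.smul_apply, hY, mul_smul_comm, smul_smul]

theorem linearIndependent_pbwC : LinearIndependent ℤ pbwC := by
  rw [linearIndependent_iff]
  intro f hf
  have main : ∀ l m n, f (m, n, l) = 0 := by
    intro l
    induction l using Nat.strong_induction_on with
    | _ l ih =>
      intro m
      obtain ⟨κ, hκ, hκl⟩ := vermaX_pow_self l
      -- the identity of polynomials obtained from the action on `y ^ l`
      have h1 : ∑ i ∈ f.support, (if i.1 = m ∧ i.2.2 = l then (f i : ℂ[X]) * bp 0 i.2.1 else 0)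
          = 0 := by
        have h0 := congrArg (fun u => (verma u (Polynomial.X ^ l)).coeff m) hf
        simp only [Finsupp.linearCombination_apply, Finsupp.sum, map_sum, map_zsmul,
          LinearMap.sum_apply, LinearMap.smul_apply, Polynomial.finsetSum_coeff, map_zero,
          LinearMap.zero_apply, Polynomial.coeff_zero] at h0
        have hc : Polynomial.C (((l ! : ℂ)⁻¹ * (m ! : ℂ)⁻¹)) * κ ≠ 0 := by
          refine mul_ne_zero (Polynomial.C_ne_zero.mpr (mul_ne_zero ?_ ?_)) hκ <;>
            exact inv_ne_zero (Nat.cast_ne_zero.mpr (Nat.factorial_ne_zero _))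
        refine (mul_eq_zero.mp ?_).resolve_left hc
        rw [Finset.mul_sum]
        refine Eq.trans (Finset.sum_congr rfl ?_) h0
        rintro ⟨m', n', l'⟩ _
        rw [verma_pbwC]
        rcases lt_trichotomy l' l with hl | hl | hl
        · rw [ih l' hl]; simp
        · subst hl
          have := hκl 1
          rw [Polynomial.C_1, one_mul, mul_one] at this
          rw [this, verma_hp, Polynomial.coeff_smul, Polynomial.coeff_smul,
            Polynomial.coeff_X_pow_mul', Polynomial.coeff_C]
          by_cases hm : m' = m
          · subst hm
            simp only [and_self, if_true, le_refl, Nat.sub_self]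
            rw [Polynomial.smul_eq_C_mul, zsmul_eq_mul]
            ring
          · rw [if_neg (by simp [hm])]
            split_ifs with h2 h3
            · omega
            · simp
            · simp
        · have := vermaX_pow_of_lt 1 hl
          rw [Polynomial.C_1, one_mul] at this
          rw [this, if_neg (by simp; omega)]
          simp
      intro n
      induction n using Nat.strong_induction_on with
      | _ n ihn =>
        have h2 := congrArg (Polynomial.eval (n : ℂ)) h1
        have hev : ∀ k, Polynomial.eval (n : ℂ) (bp 0 k) = (n.choose k : ℂ) := by
          intro k
          have := Ring.map_choose (Polynomial.evalRingHom (n : ℂ)) (Polynomial.X : ℂ[X]) k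
          simp only [Polynomial.coe_evalRingHom, Polynomial.eval_X] at this
          rw [bp, Int.cast_zero, add_zero, this, Ring.choose_natCast]
        rw [Polynomial.eval_finsetSum, Finset.sum_eq_single (m, n, l)] at h2
        · simpa [hev] using h2
        · rintro ⟨m', n', l'⟩ _ hne
          split_ifs with h
          · obtain ⟨h3, h4⟩ := h
            simp only at h3 h4
            subst h3 h4
            rw [Polynomial.eval_mul, hev]
            rcases lt_trichotomy n' n with h5 | h5 | h5
            · rw [ihn n' h5]; simp
            · subst h5; exact absurd rfl hne
            · rw [Nat.choose_eq_zero_of_lt h5]; simp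
          · simp
        · intro h
          rw [Finsupp.notMem_support_iff.mp h]
          simp
  ext ⟨m, n, l⟩
  exact main l m n

/-! ### The hyperalgebra -/

/-- The divided power `X^(m)` in the integral form. -/
def XZ (m : ℕ) : UZ := ⟨dividedPower XC m, dividedPower_XC_mem m⟩

/-- The divided power `Y^(m)` in the integral form. -/
def YZ (m : ℕ) : UZ := ⟨dividedPower YC m, dividedPower_YC_mem m⟩

/-- The binomial coefficient `(H + c choose m)` in the integral form. -/
def HZ (c : ℤ) (m : ℕ) : UZ := ⟨hBinom c m, hBinom_mem c m⟩

/-- The basis of the integral form, indexed by triples `(m, n, m')`. -/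
def basisUZ : Module.Basis (ℕ × ℕ × ℕ) ℤ UZ :=
  Module.Basis.mk (v := fun i => YZ i.1 * HZ 0 i.2.1 * XZ i.2.2)
    (LinearIndependent.of_comp UZ.subtype.toIntAlgHom.toLinearMap linearIndependent_pbwC) (by
      rintro ⟨x, hx⟩ -
      have h := UZ_le_pbwSpan hx
      have e : Set.range pbwC = UZ.subtype.toIntAlgHom.toLinearMap ''
          Set.range (fun i : ℕ × ℕ × ℕ => YZ i.1 * HZ 0 i.2.1 * XZ i.2.2) := by
        rw [← Set.range_comp]; rfl
      rw [pbwSpan, e, Submodule.span_image] at h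
      obtain ⟨y, hy, hxy⟩ := h
      have : y = ⟨x, hx⟩ := Subtype.ext hxy
      rwa [← this])

theorem basisUZ_apply (m n m' : ℕ) : basisUZ (m, n, m') = YZ m * HZ 0 n * XZ m' := by
  simp [basisUZ]

/-- The hyperalgebra of `SL₂` over `k`: base change to `k` of the divided power form. -/
abbrev U (k : Type*) [Field k] : Type _ := k ⊗[ℤ] UZ

/-- The element `X^(m)` of the hyperalgebra. -/
def Xd (k : Type*) [Field k] (m : ℕ) : U k := 1 ⊗ₜ[ℤ] XZ m

/-- The element `Y^(m)` of the hyperalgebra. -/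
def Yd (k : Type*) [Field k] (m : ℕ) : U k := 1 ⊗ₜ[ℤ] YZ m

/-- The element `(H + c choose m)` of the hyperalgebra. -/
def Hd (k : Type*) [Field k] (c : ℤ) (m : ℕ) : U k := 1 ⊗ₜ[ℤ] HZ c m

/-- The basis of the hyperalgebra formed by the elements `Y^(m) (H choose n) X^(m')`. -/
def basisU (k : Type*) [Field k] : Module.Basis (ℕ × ℕ × ℕ) k (U k) :=
  Algebra.TensorProduct.basis k basisUZ

theorem basisU_apply (k : Type*) [Field k] (m n m' : ℕ) :
    basisU k (m, n, m') = Yd k m * Hd k 0 n * Xd k m' := by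
  rw [basisU, Algebra.TensorProduct.basis_apply, basisUZ_apply, Yd, Hd, Xd,
    Algebra.TensorProduct.tmul_mul_tmul, Algebra.TensorProduct.tmul_mul_tmul, one_mul, one_mul]

/-- The `k`-linear map `Fr'` sending `Y^(m) (H choose n) X^(m')` to
`Y^(mp) (H choose np) X^(m'p)`. -/
def frPrime (p : ℕ) (k : Type*) [Field k] : U k →ₗ[k] U k :=
  (basisU k).constr k fun i => Yd k (i.1 * p) * Hd k 0 (i.2.1 * p) * Xd k (i.2.2 * p)

theorem frPrime_apply (p : ℕ) (k : Type*) [Field k] (m n m' : ℕ) :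
    frPrime p k (Yd k m * Hd k 0 n * Xd k m') =
      Yd k (m * p) * Hd k 0 (n * p) * Xd k (m' * p) := by
  rw [← basisU_apply, frPrime, Module.Basis.constr_basis]

/-- The idempotent `μ_a = (H - a - 1 choose p - 1)`. -/
def mu (p : ℕ) (k : Type*) [Field k] (a : ℤ) : U k := Hd k (-a - 1) (p - 1)

/-! ### The elements `B^(ε)(a, j)` -/

/-- The set `𝒫`. For odd `p` it is `{0, …, p - 1} × {0, …, (p - 1) / 2}`. -/
def pairs (p : ℕ) : Set (ℤ × ℚ) :=
  if p = 2 then {(0, 1 / 2), (1, 0), (1, 1)}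
  else {x | (0 ≤ x.1 ∧ x.1 < p) ∧ ∃ n : ℕ, n ≤ (p - 1) / 2 ∧ x.2 = n}

/-- The polynomial `φ_{a,m}(x) = ∏_{i < m} (x - i (i + a + 1))`. -/
def phi (p : ℕ) (a : ℤ) (m : ℕ) : (ZMod p)[X] :=
  ∏ i ∈ Finset.range m, (Polynomial.X - Polynomial.C ((i : ZMod p) * (i + a + 1)))

/-- The polynomial `ψ(x) = ∏_{i ∈ 𝔽_p} (x - i²)`. -/
def psi (p : ℕ) [Fact p.Prime] : (ZMod p)[X] :=
  ∏ i : ZMod p, (Polynomial.X - Polynomial.C (i ^ 2))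

/-- The polynomial `ψ_j^(ε)(x)` (used for odd `p`):
`ψ_j^(1) = ψ / (x - j²)`, `ψ_0^(0) = ∏_{i ≠ 0} (x - i²)`, and
`ψ_j^(0) = 2 x (x + j²) ∏_{i ≠ 0, j, -j} (x - i²)` for `j ≠ 0`. -/
def psiEps (p : ℕ) [Fact p.Prime] (ε : Fin 2) (j : ZMod p) : (ZMod p)[X] :=
  if ε = 1 then psi p /ₘ (Polynomial.X - Polynomial.C (j ^ 2))
  else if j = 0 then
    ∏ i : ZMod p with i ≠ 0, (Polynomial.X - Polynomial.C (i ^ 2))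
  else
    2 * Polynomial.X * (Polynomial.X + Polynomial.C (j ^ 2)) *
      ∏ i : ZMod p with i ≠ 0 ∧ i ≠ j ∧ i ≠ -j, (Polynomial.X - Polynomial.C (i ^ 2))

/-- The element `B^(ε)(a, j)` attached to a single pair `(a, j) ∈ 𝒫`. -/
def B₁ (p : ℕ) [Fact p.Prime] (k : Type*) [Field k] [CharP k p] (ε : Fin 2) (a : ℤ) (j : ℚ) :
    U k :=
  if p = 2 then
    if a = 0 ∧ j = 1 / 2 then (if ε = 0 then mu p k 0 else mu p k 0 * Yd k 1 * Xd k 1)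
    else if a = 1 ∧ j = 0 then mu p k 1 * Yd k 1 * Xd k 1
    else if a = 1 ∧ j = 1 then mu p k 1 * Yd k 1 * Xd k 1 + mu p k 1
    else 0
  else
    Polynomial.aeval (mu p k a * Yd k 1 * Xd k 1 + algebraMap k (U k) ((((a : k) + 1) / 2) ^ 2))
      ((psiEps p ε (j : ZMod p)).map (ZMod.castHom (dvd_refl p) k)) * mu p k a

/-- The integer `n^(ε)(a, j)`. For odd `p` it is the largest `n` such that `φ_{a,n}(x)` divides
`ψ_j^(ε)(x + ((a + 1) / 2)²)`. -/
def nIdx (p : ℕ) [Fact p.Prime] (ε : Fin 2) (a : ℤ) (j : ℚ) : ℕ :=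
  if p = 2 then
    if a = 0 ∧ j = 1 / 2 then (if ε = 0 then 0 else 1)
    else if a = 1 ∧ j = 0 then 1
    else 0
  else
    sSup {n : ℕ | phi p a n ∣ (psiEps p ε (j : ZMod p)).comp
      (Polynomial.X + Polynomial.C ((((a : ZMod p) + 1) / 2) ^ 2))}

/-- The coefficients `c_m^(ε) ∈ 𝔽_p`, `n^(ε)(a, j) ≤ m ≤ p - 1`, in the (unique) expansion
`B^(ε)(a, j) = μ_a ∑_m c_m^(ε) Y^m X^m`. -/
def coeffB (p : ℕ) [Fact p.Prime] (k : Type*) [Field k] [CharP k p] (ε : Fin 2) (a : ℤ) (j : ℚ) :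
    ℕ → ZMod p :=
  Classical.epsilon fun c : ℕ → ZMod p =>
    B₁ p k ε a j = mu p k a * ∑ m ∈ Finset.Icc (nIdx p ε a j) (p - 1),
      ZMod.castHom (dvd_refl p) k (c m) • (Yd k 1 ^ m * Xd k 1 ^ m)

/-- The conditions (A): `a` is even and `(p - a + 1) / 2 ≤ j ≤ (p - 1) / 2`, or
(C): `a` is odd and `0 ≤ j ≤ (a - 1) / 2`. The other elements of `𝒫` are those of
types (B) and (D). -/
def IsAC (p : ℕ) (a : ℤ) (j : ℚ) : Prop :=
  (Even a ∧ ((p : ℚ) - a + 1) / 2 ≤ j ∧ j ≤ ((p : ℚ) - 1) / 2) ∨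
    (Odd a ∧ 0 ≤ j ∧ j ≤ ((a : ℚ) - 1) / 2)

/-- The integer `s(a, j)` (used for the pairs of types (A) and (C)). -/
def sShift (p : ℕ) (a : ℤ) : ℕ :=
  if p = 2 then 1
  else if Even a then (((p : ℤ) - a + 1) / 2).toNat
  else (((p : ℤ) - a) / 2).toNat

open Classical in
/-- The element `Z^(ε)(z; (a, j))`. -/
def Z (p : ℕ) [Fact p.Prime] (k : Type*) [Field k] [CharP k p] (ε : Fin 2) (z : U k) (a : ℤ)
    (j : ℚ) : U k :=
  if IsAC p a j then
    mu p k a * ∑ m ∈ Finset.Icc (nIdx p ε a j) (p - 1),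
      ZMod.castHom (dvd_refl p) k (coeffB p k ε a j m) •
        (Yd k 1 ^ m * Xd k 1 ^ (m - sShift p a) * frPrime p k z * Xd k 1 ^ sShift p a)
  else frPrime p k z * B₁ p k ε a j

/-- The element `B^(ε)(𝐚, 𝐣)` for `r`-tuples, `r ≥ 1` (the value for `r = 0` is irrelevant). -/
def B (p : ℕ) [Fact p.Prime] (k : Type*) [Field k] [CharP k p] :
    (r : ℕ) → (Fin r → Fin 2) → (Fin r → ℤ) → (Fin r → ℚ) → U k
  | 0, _, _, _ => 1
  | 1, ε, a, j => B₁ p k (ε 0) (a 0) (j 0)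
  | r + 2, ε, a, j =>
    Z p k (ε 0) (B p k (r + 1) (fun i => ε i.succ) (fun i => a i.succ) (fun i => j i.succ))
      (a 0) (j 0)

end Hyperalgebra

end

noncomputable section

namespace Hyperalgebra

/-! ### Integer-valued polynomials -/

/-! The heart of the matter is that `Z` is multiplication by a twisted Frobenius image. For a pair
`(a, j)` put `δ = 1` if `IsAC p a j` and `δ = 0` otherwise. Then `Z^(ε)(z; (a, j)) = F_δ(z) B^(ε)(a,
j)`, where `F_δ` is `frShift`: it multiplies exponents by `p` like `Fr'` and also shifts the weight
by `pδ` (`Z_eq`). Two facts follow. First, `YX` commutes with the image of `F_δ`, so the case `s =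
0` reduces to the action of `YX` on `B^(ε)(a, j)`. Secondly, `Y^(pq) X^(pq) Z(z) = Z(Y^(q) X^(q) z)`
(`YX_frob_mul_Z`), so the case `s + 1` reduces to the case `s` for the tail of the tuple. Induction
on `r` finishes the proof.

The action of `YX` is polynomial algebra. On the idempotent `μ_a` one has `Y^m X^m = φ_{a,m}(YX)`
(`pol_phi_mul_mu`), and `X^p = p! X^(p) = 0`, so a polynomial in `YX` matters there only modulo
`φ_{a,p}`. Completing the square turns `φ_{a,p}` into `ψ`, and the required relation becomes `(x -
j²) ψ_j^(0) = 4j² ψ_j^(1)` modulo `ψ` (`mul_psiEps_zero`).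

The second fact needs `X^(pb) F_δ(z) B = F_δ(X^(b) z) B`. In the commutation formula for `X^(pb)
Y^(pc)` the terms with index divisible by `p` are the Frobenius image of the formula for `X^(b)
Y^(c)`. On weight `a`, Lucas' congruence collects the others into the single weight zero element
`corr`. If `corr` acts on `B` by `0` nothing is left over; if it acts by `1`, Pascal's rule absorbs
it into a shift of the weight by `p` (`X_frob_mul_Y_frob_of_corr`). This is the reason for `δ`.

That `corr` acts by `δ` is a question of which roots of `ψ` occur. The value `0` is a direct
divisibility. For the value `1` the roles of `X` and `Y` are exchanged: the two correction elements
add up to `1` (`corr_add_corr_swap`), and the exchanged one acts by `0`. To have both versions at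
once, the calculus is done for an abstract `DividedTriple`.

Polynomials in `H` are handled through values: in characteristic `p` an integer-valued polynomial in
`H` depends only on its values modulo `p` (`h_congr`), so identities in `H` become congruences of
binomial coefficients. -/

/-- The ring of polynomials taking integer values at all integers. -/
def intValued : Subring ℂ[X] where
  carrier := {q | ∀ n : ℤ, ∃ z : ℤ, q.eval (n : ℂ) = z}
  mul_mem' := by
    intro a b ha hb n
    obtain ⟨x, hx⟩ := ha n
    obtain ⟨y, hy⟩ := hb n
    exact ⟨x * y, by simp [hx, hy]⟩
  one_mem' := fun n => ⟨1, by simp⟩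
  add_mem' := by
    intro a b ha hb n
    obtain ⟨x, hx⟩ := ha n
    obtain ⟨y, hy⟩ := hb n
    exact ⟨x + y, by simp [hx, hy]⟩
  zero_mem' := fun n => ⟨0, by simp⟩
  neg_mem' := by
    intro a ha n
    obtain ⟨x, hx⟩ := ha n
    exact ⟨-x, by simp [hx]⟩

/-- The value of an integer-valued polynomial at an integer. -/
def ev (n : ℤ) : intValued →+* ℤ where
  toFun q := (q.2 n).choose
  map_one' := by
    apply Int.cast_injective (α := ℂ)
    rw [← ((1 : intValued).2 n).choose_spec]; simp
  map_zero' := by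
    apply Int.cast_injective (α := ℂ)
    rw [← ((0 : intValued).2 n).choose_spec]; simp
  map_mul' a b := by
    apply Int.cast_injective (α := ℂ)
    rw [← ((a * b).2 n).choose_spec, Int.cast_mul, ← (a.2 n).choose_spec, ← (b.2 n).choose_spec]
    simp
  map_add' a b := by
    apply Int.cast_injective (α := ℂ)
    rw [← ((a + b).2 n).choose_spec, Int.cast_add, ← (a.2 n).choose_spec, ← (b.2 n).choose_spec]
    simp

theorem ev_spec (n : ℤ) (q : intValued) : ((ev n q : ℤ) : ℂ) = q.1.eval (n : ℂ) :=
  ((q.2 n).choose_spec).symm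

theorem eval_bp (c n : ℤ) (m : ℕ) :
    (bp c m).eval (n : ℂ) = ((Ring.choose (n + c) m : ℤ) : ℂ) := by
  have h1 := Ring.map_choose (Polynomial.evalRingHom (n : ℂ)) (Polynomial.X + (c : ℂ[X])) m
  have h2 := Ring.map_choose (Int.castRingHom ℂ) (n + c) m
  simp only [Polynomial.coe_evalRingHom, Polynomial.eval_add, Polynomial.eval_X,
    Polynomial.eval_intCast, eq_intCast, Int.cast_add] at h1 h2
  rw [bp, h1, ← h2]

/-- The polynomial `(t + c choose m)` as an integer-valued polynomial. -/
def bpI (c : ℤ) (m : ℕ) : intValued := ⟨bp c m, fun n => ⟨_, eval_bp c n m⟩⟩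

theorem ev_bpI (n c : ℤ) (m : ℕ) : ev n (bpI c m) = Ring.choose (n + c) m := by
  apply Int.cast_injective (α := ℂ)
  rw [ev_spec, ← eval_bp]; rfl

/-- Substitution of `u t + v` for `t` in integer-valued polynomials. -/
def affI (u v : ℤ) : intValued →+* intValued :=
  ((Polynomial.compRingHom ((u : ℂ[X]) * Polynomial.X + (v : ℂ[X]))).comp
    intValued.subtype).codRestrict intValued (by
      intro q n
      refine ⟨ev (u * n + v) q, ?_⟩
      rw [ev_spec]
      simp [Polynomial.eval_comp])

theorem coe_affI (u v : ℤ) (q : intValued) :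
    (affI u v q : ℂ[X]) = q.1.comp ((u : ℂ[X]) * Polynomial.X + (v : ℂ[X])) := rfl

theorem ev_affI (n u v : ℤ) (q : intValued) : ev n (affI u v q) = ev (u * n + v) q := by
  apply Int.cast_injective (α := ℂ)
  rw [ev_spec, ev_spec, coe_affI]
  simp [Polynomial.eval_comp]

theorem exists_int_eval_of_mem_bpSpan {q : ℂ[X]} (hq : q ∈ bpSpan) (n : ℤ) :
    ∃ z : ℤ, q.eval (n : ℂ) = z := by
  induction hq using Submodule.span_induction with
  | mem x hx =>
    obtain ⟨m, rfl⟩ := hx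
    exact ⟨_, eval_bp 0 n m⟩
  | zero => exact ⟨0, by simp⟩
  | add x y _ _ h1 h2 =>
    obtain ⟨z, hz⟩ := h1
    obtain ⟨w, hw⟩ := h2
    exact ⟨z + w, by simp [hz, hw]⟩
  | smul a x _ h =>
    obtain ⟨z, hz⟩ := h
    exact ⟨a * z, by simp [hz]⟩

theorem natDegree_bp_le (m : ℕ) : (bp 0 m).natDegree ≤ m := by
  have h2 := Ring.descPochhammer_eq_factorial_smul_choose (Polynomial.X : ℂ[X]) m
  rw [← Polynomial.aeval_eq_smeval, ← Nat.cast_smul_eq_nsmul ℂ] at h2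
  have h3 : bp 0 m = ((m ! : ℂ)⁻¹) • descPochhammer ℂ m := by
    rw [eq_inv_smul_iff₀ (Nat.cast_ne_zero.mpr (Nat.factorial_ne_zero m)), bp, Int.cast_zero,
      add_zero, ← h2, ← descPochhammer_map (Int.castRingHom ℂ)]
    rw [Polynomial.aeval_def, ← Polynomial.eval_map]
    conv_rhs => rw [← Polynomial.comp_X (p := (descPochhammer ℤ m).map _)]
    rw [Polynomial.comp, Polynomial.eval₂_map, Polynomial.eval_map]
    congr 1
  rw [h3]
  refine (Polynomial.natDegree_smul_le _ _).trans ?_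
  rw [descPochhammer_natDegree]

/-- Newton interpolation: `bp 0 N` vanishes at `0, …, N - 1` and is `1` at `N`, so the value at `N`
is corrected by an integer multiple without disturbing earlier values. Agreement at more points than
the degree is equality. -/
theorem mem_bpSpan_of_eval_nat {q : ℂ[X]} (hq : ∀ n : ℕ, ∃ z : ℤ, q.eval (n : ℂ) = z) :
    q ∈ bpSpan := by
  have key : ∀ N : ℕ, ∃ f ∈ bpSpan, f.natDegree ≤ N - 1 ∧
      ∀ i < N, f.eval (i : ℂ) = q.eval (i : ℂ) := by
    intro N
    induction N with
    | zero => exact ⟨0, zero_mem _, by simp, by simp⟩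
    | succ N ih =>
      obtain ⟨f, hf, hd, he⟩ := ih
      obtain ⟨z, hz⟩ := hq N
      obtain ⟨w, hw⟩ := exists_int_eval_of_mem_bpSpan hf N
      have hev : ∀ i : ℕ, (bp 0 N).eval (i : ℂ) = (i.choose N : ℂ) := by
        intro i
        have := eval_bp 0 i N
        rw [add_zero, Ring.choose_natCast] at this
        exact_mod_cast this
      refine ⟨f + (z - w) • bp 0 N, add_mem hf (Submodule.smul_mem _ _
        (Submodule.subset_span ⟨_, rfl⟩)), ?_, ?_⟩
      · refine (Polynomial.natDegree_add_le _ _).trans (max_le (hd.trans (by omega)) ?_)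
        exact (Polynomial.natDegree_smul_le _ _).trans ((natDegree_bp_le N).trans (by omega))
      · intro i hi
        rcases Nat.lt_succ_iff_lt_or_eq.mp hi with h | rfl
        · simp [he i h, hev, Nat.choose_eq_zero_of_lt h]
        · push_cast at hw
          simp [hz, hev, hw]
  obtain ⟨f, hf, hd, he⟩ := key (q.natDegree + 1)
  have : f - q = 0 := by
    refine Polynomial.eq_zero_of_natDegree_lt_card_of_eval_eq_zero (f - q)
      (f := fun i : Fin (q.natDegree + 1) => ((i : ℕ) : ℂ))
      (fun i j h => Fin.ext (Nat.cast_injective h)) (fun i => ?_) ?_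
    · rw [Polynomial.eval_sub, he _ i.2, sub_self]
    · rw [Fintype.card_fin]
      have := Polynomial.natDegree_sub_le f q
      omega
  rw [← sub_eq_zero.mp this]
  exact hf

/-- The quotient `q / p` still has integer values at the naturals, hence is an integral combination
of binomial polynomials. -/
theorem exists_eq_smul_of_dvd_ev {p : ℕ} (hp : p ≠ 0) {q : intValued}
    (h : ∀ n : ℕ, (p : ℤ) ∣ ev n q) : ∃ r : intValued, q = p • r := by
  have hp' : (p : ℂ) ≠ 0 := Nat.cast_ne_zero.mpr hp
  have hmem : ((p : ℂ)⁻¹) • q.1 ∈ bpSpan := by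
    apply mem_bpSpan_of_eval_nat
    intro n
    obtain ⟨z, hz⟩ := h n
    refine ⟨z, ?_⟩
    have := ev_spec n q
    rw [hz] at this
    push_cast at this
    rw [Polynomial.eval_smul, ← this, smul_eq_mul, inv_mul_cancel_left₀ hp']
  refine ⟨⟨_, exists_int_eval_of_mem_bpSpan hmem⟩, Subtype.ext ?_⟩
  change q.1 = p • (((p : ℂ)⁻¹) • q.1)
  rw [← Nat.cast_smul_eq_nsmul ℂ, smul_inv_smul₀ hp']

theorem dvd_ev_of_dvd_ev_nat {p : ℕ} (hp : p ≠ 0) {q : intValued}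
    (h : ∀ n : ℕ, (p : ℤ) ∣ ev n q) (n : ℤ) : (p : ℤ) ∣ ev n q := by
  obtain ⟨r, rfl⟩ := exists_eq_smul_of_dvd_ev hp h
  rw [map_nsmul, nsmul_eq_mul]
  exact dvd_mul_right _ _

/-- Lucas' congruence for an integer upper entry. -/
theorem choose_lucas (p : ℕ) [hp : Fact p.Prime] (N : ℤ) {a b : ℕ} (ha : a < p) (hb : b < p)
    (i : ℕ) : Ring.choose ((p : ℤ) * N + a) (p * i + b) ≡ Ring.choose N i * (a.choose b : ℤ)
      [ZMOD p] := by
  -- Both sides are values at `N` of integer-valued polynomials, so natural `N` suffices, where this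
  -- is the usual Lucas theorem.
  have h := dvd_ev_of_dvd_ev_nat hp.out.ne_zero
    (q := affI p a (bpI 0 (p * i + b)) - bpI 0 i * (a.choose b : ℤ)) (fun n => by
      simp only [map_sub, map_mul, ev_affI, ev_bpI, map_intCast, add_zero]
      have h1 := Choose.choose_modEq_choose_mod_mul_choose_div (p := p) (n := p * n + a)
        (k := p * i + b)
      rw [Nat.mul_add_mod, Nat.mul_add_mod, Nat.mod_eq_of_lt ha, Nat.mod_eq_of_lt hb,
        Nat.mul_add_div hp.out.pos, Nat.mul_add_div hp.out.pos, Nat.div_eq_of_lt ha,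
        Nat.div_eq_of_lt hb, add_zero, add_zero] at h1
      have e : (p : ℤ) * n + a = ((p * n + a : ℕ) : ℤ) := by push_cast; ring
      rw [e, Ring.choose_natCast, Ring.choose_natCast, mul_comm ((n.choose i : ℕ) : ℤ)]
      exact (Int.modEq_iff_dvd.mp h1.symm)) N
  simp only [map_sub, map_mul, ev_affI, ev_bpI, map_intCast, add_zero] at h
  exact (Int.modEq_iff_dvd.mpr h).symm

end Hyperalgebra
end

/-! ### Commutation rules in the hyperalgebra, and the involution exchanging `X` and `Y`. -/

noncomputable section

namespace Hyperalgebra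

theorem hp_mem_of_intValued (q : intValued) : hp q.1 ∈ UZ := by
  have h : q.1 ∈ bpSpan := mem_bpSpan_of_eval_nat fun n => by simpa using q.2 n
  generalize q.1 = f at h
  induction h using Submodule.span_induction with
  | mem x hx =>
    obtain ⟨m, rfl⟩ := hx
    exact hp_bp_zero_mem m
  | zero => simp [hp]
  | add x y _ _ h1 h2 => rw [hp_add]; exact add_mem h1 h2
  | smul a x _ h => rw [hp, map_zsmul]; exact zsmul_mem h a

/-- Integer-valued polynomials in `H`, in the integral form. -/
def hhZ : intValued →+* UZ :=
  ((Polynomial.aeval HC : ℂ[X] →ₐ[ℂ] UC).toRingHom.comp intValued.subtype).codRestrict UZ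
    hp_mem_of_intValued

theorem coe_hhZ (q : intValued) : (hhZ q : UC) = hp q.1 := rfl

/-- The map from the integral form to the hyperalgebra. -/
def incl (k : Type*) [Field k] : UZ →+* U k :=
  (Algebra.TensorProduct.includeRight : UZ →ₐ[ℤ] U k).toRingHom

/-- Integer-valued polynomials in `H`, in the hyperalgebra. -/
def hh (k : Type*) [Field k] : intValued →+* U k := (incl k).comp hhZ

variable (k : Type*) [Field k]

/-- Divided powers of `X` with integer exponent. -/
def Xz (n : ℤ) : U k := incl k ⟨dpz XC n, dpz_XC_mem n⟩

/-- Divided powers of `Y` with integer exponent. -/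
def Yz (n : ℤ) : U k := incl k ⟨dpz YC n, dpz_YC_mem n⟩

theorem Xd_eq_incl (n : ℕ) : Xd k n = incl k (XZ n) := rfl
theorem Yd_eq_incl (n : ℕ) : Yd k n = incl k (YZ n) := rfl

theorem Xz_natCast (n : ℕ) : Xz k n = Xd k n := by
  exact congrArg (incl k) (Subtype.ext (dpz_natCast XC n))

theorem Yz_natCast (n : ℕ) : Yz k n = Yd k n := by
  exact congrArg (incl k) (Subtype.ext (dpz_natCast YC n))

theorem Xz_neg {n : ℤ} (h : n < 0) : Xz k n = 0 := by
  rw [Xz, ← map_zero (incl k)]; congr 1; exact Subtype.ext (dpz_neg XC h)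

theorem Yz_neg {n : ℤ} (h : n < 0) : Yz k n = 0 := by
  rw [Yz, ← map_zero (incl k)]; congr 1; exact Subtype.ext (dpz_neg YC h)

theorem Hd_eq_hh (c : ℤ) (m : ℕ) : Hd k c m = hh k (bpI c m) := by
  change incl k (HZ c m) = incl k (hhZ (bpI c m))
  congr 1
  exact Subtype.ext (hp_bp c m).symm

theorem Xd_mul_Xd (a b : ℕ) : Xd k a * Xd k b = ((a + b).choose a : k) • Xd k (a + b) := by
  have h : XZ a * XZ b = ((a + b).choose a : ℤ) • XZ (a + b) :=
    Subtype.ext (dividedPower_mul XC a b)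
  rw [Xd_eq_incl, Xd_eq_incl, ← map_mul, h, map_zsmul, ← Int.cast_smul_eq_zsmul k,
    Int.cast_natCast, Xd_eq_incl]

theorem Yd_mul_Yd (a b : ℕ) : Yd k a * Yd k b = ((a + b).choose a : k) • Yd k (a + b) := by
  have h : YZ a * YZ b = ((a + b).choose a : ℤ) • YZ (a + b) :=
    Subtype.ext (dividedPower_mul YC a b)
  rw [Yd_eq_incl, Yd_eq_incl, ← map_mul, h, map_zsmul, ← Int.cast_smul_eq_zsmul k,
    Int.cast_natCast, Yd_eq_incl]

theorem Xd_zero : Xd k 0 = 1 := by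
  rw [Xd_eq_incl, ← map_one (incl k)]; congr 1
  exact Subtype.ext (by simp [XZ, dividedPower])

theorem Yd_zero : Yd k 0 = 1 := by
  rw [Yd_eq_incl, ← map_one (incl k)]; congr 1
  exact Subtype.ext (by simp [YZ, dividedPower])

theorem Xd_mul_hh (a : ℕ) (q : intValued) :
    Xd k a * hh k q = hh k (affI 1 (-2 * a) q) * Xd k a := by
  have h : XZ a * hhZ q = hhZ (affI 1 (-2 * a) q) * XZ a := by
    apply Subtype.ext
    have := dividedPower_XC_mul_hp a q.1
    rw [Subring.coe_mul, Subring.coe_mul, coe_hhZ, coe_hhZ, coe_affI, Int.cast_one, one_mul]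
    exact this
  rw [Xd_eq_incl, hh, RingHom.comp_apply, ← map_mul, h, map_mul, RingHom.comp_apply]

theorem affI_affI (u v v' : ℤ) (q : intValued) : affI 1 v (affI u v' q) = affI u (u * v + v') q := by
  apply Subtype.ext
  rw [coe_affI, coe_affI, coe_affI, Polynomial.comp_assoc]
  congr 1
  simp only [Polynomial.add_comp, Polynomial.mul_comp, Polynomial.X_comp, Polynomial.intCast_comp]
  push_cast
  ring

theorem affI_one_zero (q : intValued) : affI 1 0 q = q := by
  apply Subtype.ext
  rw [coe_affI]; simp

theorem hp_mul_YC_pow (a : ℕ) (q : ℂ[X]) :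
    hp q * YC ^ a = YC ^ a * hp (q.comp (Polynomial.X + ((-2 * a : ℤ) : ℂ[X]))) := by
  induction a with
  | zero => simp
  | succ a ih =>
    rw [pow_succ, ← mul_assoc, ih, mul_assoc, hp_mul_YC, mul_assoc, Polynomial.comp_assoc]
    congr 3
    simp only [Polynomial.add_comp, Polynomial.X_comp,
      Polynomial.intCast_comp]
    push_cast
    congr 1
    ring

theorem hh_mul_Yd (a : ℕ) (q : intValued) :
    hh k q * Yd k a = Yd k a * hh k (affI 1 (-2 * a) q) := by
  have h : hhZ q * YZ a = YZ a * hhZ (affI 1 (-2 * a) q) := by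
    apply Subtype.ext
    rw [Subring.coe_mul, Subring.coe_mul, coe_hhZ, coe_hhZ, coe_affI, Int.cast_one, one_mul]
    change hp q.1 * dividedPower YC a = dividedPower YC a * _
    rw [dividedPower, mul_smul_comm, hp_mul_YC_pow, smul_mul_assoc]
  rw [Yd_eq_incl, hh, RingHom.comp_apply, ← map_mul, h, map_mul, RingHom.comp_apply]

theorem Yd_mul_hh (a : ℕ) (q : intValued) :
    Yd k a * hh k q = hh k (affI 1 (2 * a) q) * Yd k a := by
  rw [hh_mul_Yd, affI_affI]
  rw [show (1 * (-2 * a) + 2 * a : ℤ) = 0 by ring, affI_one_zero]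

theorem Xd_mul_Yz (a : ℕ) (b : ℤ) : Xd k a * Yz k b = ∑ i ∈ Finset.range (a + 1),
    Yz k (b - i) * hh k (bpI (2 * i - a - b) i) * Xz k (a - i) := by
  have h : XZ a * ⟨dpz YC b, dpz_YC_mem b⟩ = ∑ i ∈ Finset.range (a + 1),
      (⟨dpz YC (b - i), dpz_YC_mem _⟩ : UZ) * hhZ (bpI (2 * i - a - b) i) *
        ⟨dpz XC (a - i), dpz_XC_mem _⟩ := by
    apply Subtype.ext
    rw [AddSubmonoidClass.coe_finsetSum]
    exact XC_mul_dividedPower_mul a b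
  rw [Xd_eq_incl, Yz, ← map_mul, h, map_sum]
  simp only [map_mul]
  rfl

/-! ### Abstract divided power triples -/

/-- Extension by zero to negative indices. -/
def zext {A : Type*} [Zero A] (f : ℕ → A) (n : ℤ) : A := if 0 ≤ n then f n.toNat else 0

theorem zext_natCast {A : Type*} [Zero A] (f : ℕ → A) (n : ℕ) : zext f n = f n := by simp [zext]

theorem zext_neg {A : Type*} [Zero A] (f : ℕ → A) {n : ℤ} (h : n < 0) : zext f n = 0 := by
  simp [zext, not_le.mpr h]

/-- Elements `X^(m)`, `Y^(m)` and integer-valued polynomials in `H` of a `k`-algebra which satisfy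
the commutation rules of the hyperalgebra of `SL₂`. -/
structure DividedTriple (k A : Type*) [Field k] [Ring A] [Algebra k A] where
  /-- The divided powers of `X`. -/
  X : ℕ → A
  /-- The divided powers of `Y`. -/
  Y : ℕ → A
  /-- The integer-valued polynomials in `H`. -/
  h : intValued →+* A
  X_zero : X 0 = 1
  Y_zero : Y 0 = 1
  X_mul_X : ∀ a b, X a * X b = ((a + b).choose a : k) • X (a + b)
  Y_mul_Y : ∀ a b, Y a * Y b = ((a + b).choose a : k) • Y (a + b)
  X_mul_h : ∀ a q, X a * h q = h (affI 1 (-2 * a) q) * X a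
  Y_mul_h : ∀ a q, Y a * h q = h (affI 1 (2 * a) q) * Y a
  X_mul_Y : ∀ a b : ℕ, X a * Y b = ∑ i ∈ Finset.range (a + 1),
    zext Y (b - i) * h (bpI (2 * i - a - b) i) * zext X (a - i)

theorem Xz_eq_zext (n : ℤ) : Xz k n = zext (Xd k) n := by
  rcases lt_or_ge n 0 with h | h
  · rw [Xz_neg k h, zext_neg _ h]
  · obtain ⟨m, rfl⟩ := Int.eq_ofNat_of_zero_le h
    rw [Xz_natCast, zext_natCast]

theorem Yz_eq_zext (n : ℤ) : Yz k n = zext (Yd k) n := by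
  rcases lt_or_ge n 0 with h | h
  · rw [Yz_neg k h, zext_neg _ h]
  · obtain ⟨m, rfl⟩ := Int.eq_ofNat_of_zero_le h
    rw [Yz_natCast, zext_natCast]

/-- The standard triple of the hyperalgebra. -/
def tripleU : DividedTriple k (U k) where
  X := Xd k
  Y := Yd k
  h := hh k
  X_zero := Xd_zero k
  Y_zero := Yd_zero k
  X_mul_X := Xd_mul_Xd k
  Y_mul_Y := Yd_mul_Yd k
  X_mul_h := Xd_mul_hh k
  Y_mul_h := Yd_mul_hh k
  X_mul_Y a b := by
    rw [← Yz_natCast, Xd_mul_Yz]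
    simp only [Xz_eq_zext, Yz_eq_zext]

section

attribute [local instance] LieRing.ofAssociativeRing

/-- The Lie algebra homomorphism inducing the involution of the enveloping algebra. -/
def swapLie : LieAlgebra.SpecialLinear.sl (Fin 2) ℂ →ₗ⁅ℂ⁆ UC where
  toFun A := A.1 0 1 • YC + A.1 1 0 • XC - A.1 0 0 • HC
  map_add' A B := by simp [add_smul]; abel
  map_smul' c A := by simp [mul_smul, smul_sub]
  map_lie' := by
    intro A B
    have hA : A.1 1 1 = - A.1 0 0 := by
      have h : Matrix.trace A.1 = 0 := A.2
      rw [Matrix.trace_fin_two] at h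
      linear_combination h
    have hB : B.1 1 1 = - B.1 0 0 := by
      have h : Matrix.trace B.1 = 0 := B.2
      rw [Matrix.trace_fin_two] at h
      linear_combination h
    have h1 : XC * YC = YC * XC + HC := XC_mul_YC
    have h2 : HC * XC = XC * HC + (2 : ℂ) • XC := by
      rw [XC_mul_HC, sub_mul, two_smul, two_mul]; abel
    have h3 : HC * YC = YC * HC + (-2 : ℂ) • YC := by
      rw [HC_mul_YC, mul_sub, neg_smul, two_smul, mul_two]; abel
    simp only [LieAlgebra.SpecialLinear.sl_bracket, LieRing.of_associative_ring_bracket,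
      Matrix.sub_apply, Matrix.mul_apply, Fin.sum_univ_two, hA, hB, add_mul, mul_add, sub_mul,
      mul_sub, smul_mul_smul_comm, h1, h2, h3, smul_add, smul_smul]
    module

/-- The involution `X ↔ Y`, `H ↦ -H` of the enveloping algebra. -/
def swapC : UC →ₐ[ℂ] UC := UniversalEnvelopingAlgebra.lift ℂ swapLie

theorem swapC_XC : swapC XC = YC := by
  rw [swapC, XC, UniversalEnvelopingAlgebra.lift_ι_apply]
  change slX.1 0 1 • YC + slX.1 1 0 • XC - slX.1 0 0 • HC = _
  simp [slX]

theorem swapC_YC : swapC YC = XC := by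
  rw [swapC, YC, UniversalEnvelopingAlgebra.lift_ι_apply]
  change slY.1 0 1 • YC + slY.1 1 0 • XC - slY.1 0 0 • HC = _
  simp [slY]

theorem swapC_HC : swapC HC = -HC := by
  rw [swapC, HC, UniversalEnvelopingAlgebra.lift_ι_apply]
  change slH.1 0 1 • YC + slH.1 1 0 • XC - slH.1 0 0 • HC = -HC
  have h1 : slH.1 0 1 = 0 := by simp [slH]
  have h2 : slH.1 1 0 = 0 := by simp [slH]
  have h3 : slH.1 0 0 = 1 := by simp [slH]
  rw [h1, h2, h3, zero_smul, zero_smul, one_smul, zero_add, zero_sub]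

end

theorem swapC_dpz_XC (n : ℤ) : swapC (dpz XC n) = dpz YC n := by
  unfold dpz; split_ifs <;> simp [dividedPower, swapC_XC]

theorem swapC_dpz_YC (n : ℤ) : swapC (dpz YC n) = dpz XC n := by
  unfold dpz; split_ifs <;> simp [dividedPower, swapC_YC]

theorem swapC_hp (q : intValued) : swapC (hp q.1) = hp (affI (-1) 0 q).1 := by
  rw [hp, hp, ← Polynomial.aeval_algHom_apply, swapC_HC, coe_affI, Polynomial.aeval_comp]
  simp

/-- The image of the formula for `X^(a) Y^(b)` under the involution, which is applied over `ℂ` and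
read back in the integral form. -/
theorem Yd_mul_Xz (a : ℕ) (b : ℤ) : Yd k a * Xz k b = ∑ i ∈ Finset.range (a + 1),
    Xz k (b - i) * hh k (affI (-1) 0 (bpI (2 * i - a - b) i)) * Yz k (a - i) := by
  have h : YZ a * ⟨dpz XC b, dpz_XC_mem b⟩ = ∑ i ∈ Finset.range (a + 1),
      (⟨dpz XC (b - i), dpz_XC_mem _⟩ : UZ) * hhZ (affI (-1) 0 (bpI (2 * i - a - b) i)) *
        ⟨dpz YC (a - i), dpz_YC_mem _⟩ := by
    apply Subtype.ext
    rw [AddSubmonoidClass.coe_finsetSum]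
    have h2 := congrArg swapC (XC_mul_dividedPower_mul a b)
    rw [← dpz_natCast, map_mul, map_sum, swapC_dpz_XC, swapC_dpz_YC, dpz_natCast] at h2
    refine h2.trans (Finset.sum_congr rfl fun i _ => ?_)
    rw [map_mul, map_mul, swapC_dpz_XC, swapC_dpz_YC]
    exact congrArg (fun z => _ * z * _) (swapC_hp (bpI (2 * i - a - b) i))
  rw [Yd_eq_incl, Xz, ← map_mul, h, map_sum]
  simp only [map_mul]
  rfl

theorem affI_neg_affI (v : ℤ) (q : intValued) :
    affI 1 v (affI (-1) 0 q) = affI (-1) 0 (affI 1 (-v) q) := by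
  apply Subtype.ext
  rw [coe_affI, coe_affI, coe_affI, coe_affI, Polynomial.comp_assoc, Polynomial.comp_assoc]
  congr 1
  simp only [Polynomial.add_comp, Polynomial.mul_comp, Polynomial.X_comp, Polynomial.intCast_comp]
  push_cast
  ring

/-- The triple of the hyperalgebra with the roles of `X` and `Y` exchanged. -/
def swapU : DividedTriple k (U k) where
  X := Yd k
  Y := Xd k
  h := (hh k).comp (affI (-1) 0)
  X_zero := Yd_zero k
  Y_zero := Xd_zero k
  X_mul_X := Yd_mul_Yd k
  Y_mul_Y := Xd_mul_Xd k
  X_mul_h a q := by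
    rw [RingHom.comp_apply, Yd_mul_hh, affI_neg_affI, RingHom.comp_apply, neg_mul]
  Y_mul_h a q := by
    rw [RingHom.comp_apply, Xd_mul_hh, affI_neg_affI, RingHom.comp_apply, neg_mul, neg_neg]
  X_mul_Y a b := by
    rw [← Xz_natCast, Yd_mul_Xz]
    simp only [Xz_eq_zext, Yz_eq_zext]
    rfl

end Hyperalgebra
end

/-! ### Calculus in a divided power triple: weights modulo `p`, powers of `YX`, Frobenius
commutation. -/

noncomputable section

namespace Hyperalgebra

set_option linter.unusedSectionVars false

/-- The integer-valued polynomial giving the idempotent of weight `a` modulo `p`. -/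
def muI (p : ℕ) (a : ℤ) : intValued := bpI (-a - 1) (p - 1)

theorem affI_bpI (c d : ℤ) (m : ℕ) : affI 1 d (bpI c m) = bpI (c + d) m := by
  apply Subtype.ext
  rw [coe_affI, Int.cast_one, one_mul]
  exact bp_comp c d m

theorem choose_lucas_zero (p : ℕ) [hp : Fact p.Prime] (N : ℤ) {a : ℕ} (ha : a < p) (i : ℕ) :
    Ring.choose ((p : ℤ) * N + a) (p * i) ≡ Ring.choose N i [ZMOD p] := by
  simpa using choose_lucas p N ha hp.out.pos i

theorem choose_lucas_small (p : ℕ) [hp : Fact p.Prime] (N : ℤ) {a b : ℕ} (ha : a < p)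
    (hb : b < p) : Ring.choose ((p : ℤ) * N + a) b ≡ a.choose b [ZMOD p] := by
  simpa using choose_lucas p N ha hb 0

/-- For `n ≡ a` the number `n - a - 1` has residue `p - 1`, and `(p - 1 choose p - 1) = 1`; all
other residues `r` give `(r choose p - 1) = 0`. Hence `muI` is the indicator function of the class
of `a`. -/
theorem ev_muI_of_dvd (p : ℕ) [hp : Fact p.Prime] {a n : ℤ} (h : (p : ℤ) ∣ n - a) :
    ev n (muI p a) ≡ 1 [ZMOD p] := by
  obtain ⟨N, hN⟩ := h
  have hp1 := hp.out.one_lt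
  rw [muI, ev_bpI]
  have e : n + (-a - 1) = p * (N - 1) + ((p - 1 : ℕ) : ℤ) := by
    push_cast [hp1.le]
    linear_combination hN
  rw [e]
  refine (choose_lucas_small p _ (by omega) (by omega)).trans ?_
  simp

theorem ev_muI_of_not_dvd (p : ℕ) [hp : Fact p.Prime] {a n : ℤ} (h : ¬ (p : ℤ) ∣ n - a) :
    ev n (muI p a) ≡ 0 [ZMOD p] := by
  have hp1 := hp.out.one_lt
  have hp0 : (0 : ℤ) < p := by exact_mod_cast hp.out.pos
  rw [muI, ev_bpI]
  obtain ⟨r, hr⟩ := Int.eq_ofNat_of_zero_le (Int.emod_nonneg (n + (-a - 1)) hp0.ne')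
  have hlt := Int.emod_lt_of_pos (n + (-a - 1)) hp0
  have e := Int.mul_ediv_add_emod (n + (-a - 1)) p
  rw [hr] at hlt e
  have hr1 : r < p := by exact_mod_cast hlt
  have hne : r ≠ p - 1 := by
    rintro rfl
    apply h
    refine ⟨(n + (-a - 1)) / p + 1, ?_⟩
    push_cast [hp1.le] at e
    linear_combination -e
  rw [← e]
  refine (choose_lucas_small p _ hr1 (by omega)).trans ?_
  rw [Nat.choose_eq_zero_of_lt (by omega)]
  rfl

theorem sum_range_mul {M : Type*} [AddCommMonoid M] (f : ℕ → M) (p b : ℕ) :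
    ∑ i ∈ Finset.range (p * b), f i =
      ∑ i ∈ Finset.range b, ∑ j ∈ Finset.range p, f (p * i + j) := by
  induction b with
  | zero => simp
  | succ b ih => rw [Nat.mul_succ, Finset.sum_range_add, ih, Finset.sum_range_succ]

theorem natCast_choose_mul_add {k : Type*} [Field k] {p : ℕ} [hp : Fact p.Prime] [CharP k p]
    (N i : ℕ) {a b : ℕ} (ha : a < p) (hb : b < p) :
    ((p * N + a).choose (p * i + b) : k) = (N.choose i : k) * (a.choose b : k) := by
  have h := choose_lucas p N ha hb i
  have e : (p : ℤ) * N + a = ((p * N + a : ℕ) : ℤ) := by push_cast; ring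
  rw [e, Ring.choose_natCast, Ring.choose_natCast] at h
  have h2 := (CharP.intCast_eq_intCast k p).mpr h
  push_cast at h2
  exact h2

namespace DividedTriple

variable {k A : Type*} [Field k] [Ring A] [Algebra k A] (T : DividedTriple k A)

theorem X_comm (a b : ℕ) : Commute (T.X a) (T.X b) := by
  rw [commute_iff_eq, T.X_mul_X, T.X_mul_X, add_comm b a, Nat.choose_symm_add]

theorem Y_comm (a b : ℕ) : Commute (T.Y a) (T.Y b) := by
  rw [commute_iff_eq, T.Y_mul_Y, T.Y_mul_Y, add_comm b a, Nat.choose_symm_add]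

theorem h_comm (q r : intValued) : Commute (T.h q) (T.h r) := by
  rw [commute_iff_eq, ← map_mul, mul_comm, map_mul]

theorem X_one_pow (m : ℕ) : T.X 1 ^ m = (m ! : k) • T.X m := by
  induction m with
  | zero => simp [T.X_zero]
  | succ m ih =>
    rw [pow_succ, ih, smul_mul_assoc, T.X_mul_X, smul_smul, Nat.factorial_succ,
      Nat.choose_succ_self_right]
    push_cast
    rw [mul_comm]

theorem Y_one_pow (m : ℕ) : T.Y 1 ^ m = (m ! : k) • T.Y m := by
  induction m with
  | zero => simp [T.Y_zero]
  | succ m ih =>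
    rw [pow_succ, ih, smul_mul_assoc, T.Y_mul_Y, smul_smul, Nat.factorial_succ,
      Nat.choose_succ_self_right]
    push_cast
    rw [mul_comm]

theorem YX_comm_h (m : ℕ) (q : intValued) : Commute (T.Y m * T.X m) (T.h q) := by
  rw [commute_iff_eq, mul_assoc, T.X_mul_h, ← mul_assoc, T.Y_mul_h, affI_affI,
    show (1 * (2 * m) + -2 * m : ℤ) = 0 by ring, affI_one_zero, mul_assoc]

variable {p : ℕ} [hp : Fact p.Prime] [CharP k p]

-- If all values of `r - q` are divisible by `p`, then `r - q` is `p` times an integer-valued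
-- polynomial and dies in characteristic `p`. Every later identity between polynomials in `H` is
-- proved through this.
variable (p) in
theorem h_congr {q r : intValued} (h : ∀ n : ℤ, ev n q ≡ ev n r [ZMOD p]) : T.h q = T.h r := by
  obtain ⟨s, hs⟩ := exists_eq_smul_of_dvd_ev hp.out.ne_zero (q := r - q) (fun n => by
    rw [map_sub]; exact Int.modEq_iff_dvd.mp (h n))
  have h2 : T.h (r - q) = 0 := by
    rw [hs, map_nsmul, ← Nat.cast_smul_eq_nsmul k, CharP.cast_eq_zero, zero_smul]
  rw [map_sub, sub_eq_zero] at h2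
  exact h2.symm

variable (p) in
/-- The idempotent of weight `a` modulo `p`. -/
def mu (a : ℤ) : A := T.h (muI p a)

theorem mu_congr {a b : ℤ} (h : (p : ℤ) ∣ a - b) : T.mu p a = T.mu p b := by
  apply T.h_congr p
  intro n
  by_cases hn : (p : ℤ) ∣ n - a
  · have hn' : (p : ℤ) ∣ n - b := by
      rw [← sub_add_sub_cancel n a b]; exact dvd_add hn h
    exact (ev_muI_of_dvd p hn).trans (ev_muI_of_dvd p hn').symm
  · have hn' : ¬ (p : ℤ) ∣ n - b := by
      intro h2
      apply hn
      have := dvd_sub h2 h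
      rwa [show n - b - (a - b) = n - a by ring] at this
    exact (ev_muI_of_not_dvd p hn).trans (ev_muI_of_not_dvd p hn').symm

/-- The values of the idempotent vanish modulo `p` outside the class of `a`, so only integers in
that class have to be compared. -/
theorem h_mul_mu_congr {a : ℤ} {q r : intValued}
    (h : ∀ n : ℤ, (p : ℤ) ∣ n - a → ev n q ≡ ev n r [ZMOD p]) :
    T.h q * T.mu p a = T.h r * T.mu p a := by
  rw [mu, ← map_mul, ← map_mul]
  apply T.h_congr p
  intro n
  rw [map_mul, map_mul]
  by_cases hn : (p : ℤ) ∣ n - a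
  · exact (h n hn).mul_right _
  · have := ev_muI_of_not_dvd p hn
    exact (this.mul_left _).trans (by simpa using (this.mul_left (ev n r)).symm)

theorem mu_mul_mu (a : ℤ) : T.mu p a * T.mu p a = T.mu p a := by
  have := T.h_mul_mu_congr (p := p) (a := a) (q := muI p a) (r := 1) (fun n hn => by
    rw [map_one]; exact ev_muI_of_dvd p hn)
  rwa [map_one, one_mul] at this

theorem h_mul_congr {a : ℤ} {q r : intValued} {B : A} (hB : T.mu p a * B = B)
    (h : ∀ n : ℤ, (p : ℤ) ∣ n - a → ev n q ≡ ev n r [ZMOD p]) : T.h q * B = T.h r * B := by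
  rw [← hB, ← mul_assoc, T.h_mul_mu_congr h, mul_assoc]

theorem X_mul_mu (m : ℕ) (a : ℤ) : T.X m * T.mu p a = T.mu p (a + 2 * m) * T.X m := by
  rw [mu, T.X_mul_h, muI, affI_bpI, mu, muI]
  congr 3
  ring

theorem Y_mul_mu (m : ℕ) (a : ℤ) : T.Y m * T.mu p a = T.mu p (a - 2 * m) * T.Y m := by
  rw [mu, T.Y_mul_h, muI, affI_bpI, mu, muI]
  congr 3
  ring

theorem mu_comm_X (m : ℕ) (a : ℤ) : Commute (T.mu p a) (T.X (p * m)) := by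
  rw [commute_iff_eq, T.X_mul_mu]
  congr 1
  exact T.mu_congr ⟨-(2 * m), by push_cast; ring⟩

theorem mu_comm_Y (m : ℕ) (a : ℤ) : Commute (T.mu p a) (T.Y (p * m)) := by
  rw [commute_iff_eq, T.Y_mul_mu]
  congr 1
  exact T.mu_congr ⟨(2 * m), by push_cast; ring⟩

theorem mu_comm_h (a : ℤ) (q : intValued) : Commute (T.mu p a) (T.h q) := T.h_comm _ _

theorem mu_comm_YX (a : ℤ) (m : ℕ) : Commute (T.mu p a) (T.Y m * T.X m) :=
  (T.YX_comm_h m _).symm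

-- By Lucas, `(pb + m choose m) ≡ 1`.
variable (p) in
theorem X_mul_add (b : ℕ) {m : ℕ} (hm : m < p) : T.X (p * b + m) = T.X m * T.X (p * b) := by
  rw [T.X_mul_X, add_comm m]
  have := natCast_choose_mul_add (k := k) (p := p) b 0 hm hm
  rw [mul_zero, zero_add] at this
  rw [this]; simp

variable (p) in
theorem Y_mul_add (b : ℕ) {m : ℕ} (hm : m < p) : T.Y (p * b + m) = T.Y (p * b) * T.Y m := by
  rw [T.Y_mul_Y]
  have := natCast_choose_mul_add (k := k) (p := p) b b hm hp.out.pos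
  rw [add_zero] at this
  rw [this]; simp

theorem X_mul_X_frob (a b : ℕ) :
    T.X (p * a) * T.X (p * b) = ((a + b).choose a : k) • T.X (p * (a + b)) := by
  rw [T.X_mul_X, ← mul_add]
  have := natCast_choose_mul_add (k := k) (p := p) (a + b) a hp.out.pos hp.out.pos
  rw [add_zero, add_zero] at this
  rw [this]; simp

theorem Y_mul_Y_frob (a b : ℕ) :
    T.Y (p * a) * T.Y (p * b) = ((a + b).choose a : k) • T.Y (p * (a + b)) := by
  rw [T.Y_mul_Y, ← mul_add]
  have := natCast_choose_mul_add (k := k) (p := p) (a + b) a hp.out.pos hp.out.pos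
  rw [add_zero, add_zero] at this
  rw [this]; simp

theorem X_mul_Y_one (m : ℕ) :
    T.X m * T.Y 1 = T.Y 1 * T.X m + T.h (bpI (1 - m) 1) * zext T.X (m - 1) := by
  rw [T.X_mul_Y]
  have hz : ∀ i : ℕ, 2 ≤ i → zext T.Y (((1 : ℕ) : ℤ) - i) *
      T.h (bpI (2 * i - m - (1 : ℕ)) i) * zext T.X (m - i) = 0 := by
    intro i hi
    rw [zext_neg _ (by omega)]; simp
  have h0 : bpI (2 * ((0 : ℕ) : ℤ) - m - (1 : ℕ)) 0 = 1 := by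
    apply Subtype.ext; simp [bpI, bp]
  have hs : ∑ i ∈ Finset.range (m + 1), zext T.Y (((1 : ℕ) : ℤ) - i) *
      T.h (bpI (2 * i - m - (1 : ℕ)) i) * zext T.X (m - i) =
      ∑ i ∈ Finset.range 2, zext T.Y (((1 : ℕ) : ℤ) - i) *
      T.h (bpI (2 * i - m - (1 : ℕ)) i) * zext T.X (m - i) := by
    rcases Nat.eq_zero_or_pos m with rfl | hm
    -- Here the two-term sum is the longer one; its extra term contains `X^(-1) = 0`.
    · rw [Finset.sum_range_succ _ 1]
      rw [zext_neg T.X (n := ((0 : ℕ) : ℤ) - (1 : ℕ)) (by omega)]; simp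
    · symm
      apply Finset.sum_subset
      · intro i hi
        rw [Finset.mem_range] at *
        omega
      · intro i _ hi
        rw [Finset.mem_range] at hi
        exact hz i (by omega)
  rw [hs, Finset.sum_range_succ, Finset.sum_range_one, h0]
  have e1 : ((1 : ℕ) : ℤ) - (0 : ℕ) = (1 : ℕ) := by simp
  have e2 : (m : ℤ) - (0 : ℕ) = m := by simp
  have e3 : ((1 : ℕ) : ℤ) - (1 : ℕ) = (0 : ℕ) := by simp
  have e4 : 2 * ((1 : ℕ) : ℤ) - m - (1 : ℕ) = 1 - m := by push_cast; ring
  rw [e1, e2, e3, e4, zext_natCast, zext_natCast, zext_natCast, T.Y_zero, map_one, mul_one,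
    one_mul, Nat.cast_one]

theorem X_one_mul_Y (m : ℕ) :
    T.X 1 * T.Y m = T.Y m * T.X 1 + zext T.Y (m - 1) * T.h (bpI (1 - m) 1) := by
  rw [T.X_mul_Y, Finset.sum_range_succ, Finset.sum_range_one]
  have h0 : bpI (2 * ((0 : ℕ) : ℤ) - (1 : ℕ) - m) 0 = 1 := by
    apply Subtype.ext; simp [bpI, bp]
  have e1 : ((1 : ℕ) : ℤ) - (0 : ℕ) = (1 : ℕ) := by simp
  have e2 : (m : ℤ) - (0 : ℕ) = m := by simp
  have e3 : ((1 : ℕ) : ℤ) - (1 : ℕ) = (0 : ℕ) := by simp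
  have e4 : 2 * ((1 : ℕ) : ℤ) - (1 : ℕ) - m = 1 - m := by push_cast; ring
  rw [h0, e1, e2, e3, e4, zext_natCast, zext_natCast, zext_natCast, T.X_zero, map_one, mul_one,
    mul_one, Nat.cast_one]

theorem zext_X_mul_X_one (m : ℕ) : zext T.X (m - 1) * T.X 1 = (m : k) • T.X m := by
  cases m with
  | zero => rw [zext_neg _ (by omega)]; simp
  | succ m =>
    rw [show ((m + 1 : ℕ) : ℤ) - 1 = m by push_cast; ring, zext_natCast, T.X_mul_X,
      Nat.choose_succ_self_right]

theorem Y_one_mul_zext_Y (m : ℕ) : T.Y 1 * zext T.Y (m - 1) = (m : k) • T.Y m := by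
  cases m with
  | zero => rw [zext_neg _ (by omega)]; simp
  | succ m =>
    rw [show ((m + 1 : ℕ) : ℤ) - 1 = m by push_cast; ring, zext_natCast, T.Y_mul_Y, add_comm 1 m,
      Nat.choose_one_right]

theorem Y_mul_X_mul_YX (m : ℕ) : T.Y m * T.X m * (T.Y 1 * T.X 1) =
    (((m + 1 : ℕ) : k) ^ 2) • (T.Y (m + 1) * T.X (m + 1)) +
      (m : k) • (T.h (bpI (m + 1) 1) * (T.Y m * T.X m)) := by
  calc T.Y m * T.X m * (T.Y 1 * T.X 1) = T.Y m * (T.X m * T.Y 1) * T.X 1 := by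
        simp only [mul_assoc]
    _ = (T.Y m * T.Y 1) * (T.X m * T.X 1) +
        (T.Y m * T.h (bpI (1 - m) 1)) * (zext T.X (m - 1) * T.X 1) := by
      rw [T.X_mul_Y_one]
      simp only [mul_add, add_mul, mul_assoc]
    _ = _ := by
      rw [T.Y_mul_Y, T.X_mul_X, T.zext_X_mul_X_one, T.Y_mul_h, affI_bpI,
        Nat.choose_succ_self_right, smul_mul_smul_comm, mul_smul_comm, mul_assoc, sq,
        show (1 - m + 2 * m : ℤ) = m + 1 by ring]

/-- On weight `a` the last factor is `YX - m(m + a + 1)`, which is the linear factor defining `phi`.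
The formula concerns ordinary powers, so no factorial has to be inverted. -/
theorem Y_pow_mul_X_pow_succ (m : ℕ) : T.Y 1 ^ (m + 1) * T.X 1 ^ (m + 1) =
    T.Y 1 ^ m * T.X 1 ^ m * (T.Y 1 * T.X 1 - (m : k) • T.h (bpI (m + 1) 1)) := by
  rw [T.Y_one_pow, T.X_one_pow, T.Y_one_pow, T.X_one_pow, smul_mul_smul_comm, smul_mul_smul_comm,
    smul_mul_assoc, mul_sub, mul_smul_comm, T.Y_mul_X_mul_YX, (T.YX_comm_h m _).eq,
    add_sub_cancel_right, smul_smul, Nat.factorial_succ]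
  congr 1
  push_cast
  ring

/-- The commutator contains `X^(pb - 1) X = pb X^(pb) = 0`. -/
theorem YX_one_comm_X_frob (b : ℕ) : Commute (T.Y 1 * T.X 1) (T.X (p * b)) := by
  rw [commute_iff_eq]
  calc T.Y 1 * T.X 1 * T.X (p * b) = T.Y 1 * T.X (p * b) * T.X 1 := by
        rw [mul_assoc, (T.X_comm _ _).eq, mul_assoc]
    _ = T.X (p * b) * T.Y 1 * T.X 1 := by
      rw [T.X_mul_Y_one, add_mul, mul_assoc (T.h _), T.zext_X_mul_X_one]
      simp
    _ = _ := mul_assoc _ _ _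

theorem YX_one_comm_Y_frob (b : ℕ) : Commute (T.Y 1 * T.X 1) (T.Y (p * b)) := by
  rw [commute_iff_eq]
  calc T.Y 1 * T.X 1 * T.Y (p * b) = T.Y 1 * T.Y (p * b) * T.X 1 := by
        rw [mul_assoc, T.X_one_mul_Y, mul_add, ← mul_assoc, ← mul_assoc, T.Y_one_mul_zext_Y]
        simp
    _ = _ := by rw [(T.Y_comm _ _).eq, mul_assoc]

theorem h_comm_X_frob (c : ℤ) (b : ℕ) : Commute (T.h (bpI c 1)) (T.X (p * b)) := by
  rw [commute_iff_eq, T.X_mul_h]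
  congr 1
  apply T.h_congr p
  intro n
  rw [affI_bpI, ev_bpI, ev_bpI, Ring.choose_one_right, Ring.choose_one_right]
  apply Int.modEq_iff_dvd.mpr
  exact ⟨-2 * b, by push_cast; ring⟩

theorem h_comm_Y_frob (c : ℤ) (b : ℕ) : Commute (T.h (bpI c 1)) (T.Y (p * b)) := by
  rw [commute_iff_eq, T.Y_mul_h]
  congr 1
  apply T.h_congr p
  intro n
  rw [affI_bpI, ev_bpI, ev_bpI, Ring.choose_one_right, Ring.choose_one_right]
  apply Int.modEq_iff_dvd.mpr
  exact ⟨2 * b, by push_cast; ring⟩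

/-- By the recursion above, `Y^m X^m` is a polynomial in `YX` and `H`. -/
theorem pow_comm_of_comm {z : A} (h1 : Commute (T.Y 1 * T.X 1) z)
    (h2 : ∀ c, Commute (T.h (bpI c 1)) z) (m : ℕ) : Commute (T.Y 1 ^ m * T.X 1 ^ m) z := by
  induction m with
  | zero => simp
  | succ m ih =>
    rw [T.Y_pow_mul_X_pow_succ]
    exact ih.mul_left (h1.sub_left ((h2 _).smul_left _))

theorem Y_mul_X_eq_pow {m : ℕ} (hm : m < p) :
    T.Y m * T.X m = ((m ! : k)⁻¹ * (m ! : k)⁻¹) • (T.Y 1 ^ m * T.X 1 ^ m) := by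
  have h : (m ! : k) ≠ 0 := by
    rw [Ne, CharP.cast_eq_zero_iff k p, hp.out.dvd_factorial]
    omega
  rw [T.Y_one_pow, T.X_one_pow, smul_mul_smul_comm, smul_smul]
  rw [show (m ! : k)⁻¹ * (m ! : k)⁻¹ * ((m ! : k) * (m ! : k)) = 1 by field_simp, one_smul]

theorem YX_comm_X_frob {m : ℕ} (hm : m < p) (b : ℕ) : Commute (T.Y m * T.X m) (T.X (p * b)) := by
  rw [T.Y_mul_X_eq_pow hm]
  exact (T.pow_comm_of_comm (T.YX_one_comm_X_frob b) (fun c => T.h_comm_X_frob c b) m).smul_left _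

variable (p) in
/-- The weight zero element `∑_{0 < i < p} (a choose i) Y^(p - i) X^(p - i)`. -/
def corr (a : ℕ) : A :=
  ∑ i ∈ Finset.range (p - 1), (a.choose (i + 1) : k) • (T.Y (p - (i + 1)) * T.X (p - (i + 1)))

/-- Moving the binomial past `Y^(p - j)` raises its upper entry by `2(p - j)`, which turns `pD + 2j`
into `p(D + 2)`. On weight `a` the upper entry is then `a` modulo `p`, and Lucas splits off `(a
choose j)`. -/
theorem YhX_mul_of_weight {a : ℕ} (ha : a < p) {B : A} (hB : T.mu p a * B = B) (D : ℤ) (i : ℕ)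
    {j : ℕ} (hj : j < p) :
    T.Y (p - j) * T.h (bpI (p * D + 2 * j) (p * i + j)) * (T.X (p - j) * B) =
      (a.choose j : k) • (T.h (bpI (p * (D + 2)) (p * i)) * (T.Y (p - j) * T.X (p - j) * B)) := by
  have hw : T.mu p a * (T.Y (p - j) * T.X (p - j) * B) = T.Y (p - j) * T.X (p - j) * B := by
    rw [← mul_assoc, (T.mu_comm_YX _ _).eq, mul_assoc, hB]
  rw [T.Y_mul_h, mul_assoc, ← mul_assoc (T.Y _), affI_bpI]
  have := T.h_mul_congr hw (q := bpI (p * D + 2 * j + 2 * (p - j : ℕ)) (p * i + j))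
    (r := bpI (p * (D + 2)) (p * i) * (a.choose j : ℤ)) (fun n hn => by
      obtain ⟨N, hN⟩ := hn
      rw [map_mul, ev_bpI, ev_bpI, map_intCast]
      have e1 : n + (p * D + 2 * j + 2 * (p - j : ℕ)) = p * (N + D + 2) + (a : ℤ) := by
        push_cast [hj.le]; linear_combination hN
      have e2 : n + (p * (D + 2)) = p * (N + D + 2) + (a : ℤ) := by linear_combination hN
      rw [e1, e2]
      exact (choose_lucas p _ ha hj i).trans ((choose_lucas_zero p _ ha i).symm.mul_right _))
  have e : ((a.choose j : ℤ) : A) = algebraMap k A (a.choose j : k) := by simp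
  rw [this, map_mul, map_intCast, e, mul_assoc, ← Algebra.smul_def, mul_smul_comm]

/-- The terms with lower index prime to `p` in the commutation formula. -/
theorem commutation_term {a : ℕ} (ha : a < p) {B : A} (hB : T.mu p a * B = B) (b c i : ℕ)
    {j : ℕ} (hj0 : 0 < j) (hj : j < p) :
    zext T.Y (((p * c : ℕ) : ℤ) - (p * i + j : ℕ)) *
        T.h (bpI (2 * (p * i + j : ℕ) - (p * b : ℕ) - (p * c : ℕ)) (p * i + j)) *
        zext T.X (((p * b : ℕ) : ℤ) - (p * i + j : ℕ)) * B =
      zext T.Y (p * (c - i - 1)) * T.h (bpI (p * (2 * i + 2 - b - c)) (p * i)) *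
        zext T.X (p * (b - i - 1)) *
          ((a.choose j : k) • (T.Y (p - j) * T.X (p - j)) * B) := by
  have hp0 : (0 : ℤ) < p := by exact_mod_cast hp.out.pos
  -- In these two boundary cases an exponent is negative on either side, on the left because `j >
  -- 0`.
  by_cases hc : c < i + 1
  · have h1 : (p : ℤ) * (c - i - 1) < 0 := mul_neg_of_pos_of_neg hp0 (by omega)
    have h2 : (((p * c : ℕ) : ℤ) - (p * i + j : ℕ)) < 0 := by
      have : p * c ≤ p * i := Nat.mul_le_mul_left p (by omega)
      omega
    rw [zext_neg _ h1, zext_neg _ h2]; simp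
  by_cases hb : b < i + 1
  · have h1 : (p : ℤ) * (b - i - 1) < 0 := mul_neg_of_pos_of_neg hp0 (by omega)
    have h2 : (((p * b : ℕ) : ℤ) - (p * i + j : ℕ)) < 0 := by
      have : p * b ≤ p * i := Nat.mul_le_mul_left p (by omega)
      omega
    rw [zext_neg _ h1, zext_neg _ h2]; simp
  obtain ⟨c', rfl⟩ := Nat.exists_eq_add_of_le (not_lt.mp hc)
  obtain ⟨b', rfl⟩ := Nat.exists_eq_add_of_le (not_lt.mp hb)
  -- The exponents become `p c' + (p - j)` and `p b' + (p - j)`, so both divided powers split. The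
  -- factor `X^(p b')` joins `B`, and afterwards commutes back past `Y^(p - j) X^(p - j)`.
  have e1 : (((p * (i + 1 + c') : ℕ) : ℤ) - (p * i + j : ℕ)) = (p * c' + (p - j) : ℕ) := by
    push_cast [hj.le]; ring
  have e2 : (((p * (i + 1 + b') : ℕ) : ℤ) - (p * i + j : ℕ)) = (p * b' + (p - j) : ℕ) := by
    push_cast [hj.le]; ring
  have e3 : (p : ℤ) * (((i + 1 + c' : ℕ) : ℤ) - i - 1) = (p * c' : ℕ) := by push_cast; ring
  have e4 : (p : ℤ) * (((i + 1 + b' : ℕ) : ℤ) - i - 1) = (p * b' : ℕ) := by push_cast; ring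
  have e5 : (2 * (p * i + j : ℕ) - (p * (i + 1 + b') : ℕ) - (p * (i + 1 + c') : ℕ) : ℤ) =
      p * (-2 - b' - c') + 2 * j := by push_cast; ring
  have e6 : (p * (2 * i + 2 - (i + 1 + b' : ℕ) - (i + 1 + c' : ℕ)) : ℤ) =
      p * ((-2 - b' - c') + 2) := by push_cast; ring
  have hB' : T.mu p a * (T.X (p * b') * B) = T.X (p * b') * B := by
    rw [← mul_assoc, (T.mu_comm_X _ _).eq, mul_assoc, hB]
  have hYX : Commute (T.Y (p - j) * T.X (p - j)) (T.X (p * b')) := T.YX_comm_X_frob (by omega) _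
  rw [e1, e2, e3, e4, e5, e6, zext_natCast, zext_natCast, zext_natCast, zext_natCast,
    T.Y_mul_add p _ (by omega), T.X_mul_add p _ (by omega)]
  have := T.YhX_mul_of_weight ha hB' (-2 - b' - c') i hj
  calc _ = T.Y (p * c') * (T.Y (p - j) * T.h (bpI (p * (-2 - b' - c') + 2 * j) (p * i + j)) *
        (T.X (p - j) * (T.X (p * b') * B))) := by simp only [mul_assoc]
    _ = _ := by
      rw [this, ← mul_assoc (T.Y (p - j) * T.X (p - j)), hYX.eq]
      simp only [mul_assoc, smul_mul_assoc, mul_smul_comm]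

/-- The summation index is written as `p i + j`. The terms with `j = 0` have Frobenius shape, and
for fixed `i` the terms with `0 < j < p` assemble into `corr`. -/
theorem X_frob_mul_Y_frob {a : ℕ} (ha : a < p) {B : A} (hB : T.mu p a * B = B) (b c : ℕ) :
    T.X (p * b) * T.Y (p * c) * B = ∑ i ∈ Finset.range (b + 1),
      (zext T.Y (p * (c - i)) * T.h (bpI (p * (2 * i - b - c)) (p * i)) *
          zext T.X (p * (b - i)) * B +
        zext T.Y (p * (c - i - 1)) * T.h (bpI (p * (2 * i + 2 - b - c)) (p * i)) *
          zext T.X (p * (b - i - 1)) * (T.corr p a * B)) := by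
  have hp1 := hp.out.one_lt
  set f : ℕ → A := fun i => zext T.Y (((p * c : ℕ) : ℤ) - i) *
    T.h (bpI (2 * i - (p * b : ℕ) - (p * c : ℕ)) i) * zext T.X (((p * b : ℕ) : ℤ) - i) with hf
  -- The range is padded to full blocks of length `p`; the added terms contain a negative power of
  -- `X`.
  have h1 : T.X (p * b) * T.Y (p * c) = ∑ i ∈ Finset.range (p * (b + 1)), f i := by
    rw [T.X_mul_Y]
    apply Finset.sum_subset
    · intro i hi
      rw [Finset.mem_range] at *
      rw [mul_add]
      omega
    · intro i _ hi
      rw [Finset.mem_range] at hi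
      rw [zext_neg T.X (by omega), mul_zero]
  rw [h1, sum_range_mul, Finset.sum_mul]
  refine Finset.sum_congr rfl fun i _ => ?_
  obtain ⟨p', rfl⟩ : ∃ p', p = p' + 1 := ⟨p - 1, by omega⟩
  rw [Finset.sum_range_succ', add_mul, add_comm]
  congr 1
  · have e1 : (((p' + 1) * c : ℕ) : ℤ) - ((p' + 1) * i + 0 : ℕ) = (p' + 1 : ℕ) * (c - i) := by
      push_cast; ring
    have e2 : (((p' + 1) * b : ℕ) : ℤ) - ((p' + 1) * i + 0 : ℕ) = (p' + 1 : ℕ) * (b - i) := by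
      push_cast; ring
    have e3 : 2 * (((p' + 1) * i + 0 : ℕ) : ℤ) - ((p' + 1) * b : ℕ) - ((p' + 1) * c : ℕ) =
        (p' + 1 : ℕ) * (2 * i - b - c) := by push_cast; ring
    simp only [hf]
    rw [e1, e2, e3, add_zero]
  · rw [corr, Nat.add_sub_cancel, Finset.sum_mul, Finset.sum_mul, Finset.mul_sum]
    refine Finset.sum_congr rfl fun j hj => ?_
    rw [Finset.mem_range] at hj
    exact T.commutation_term ha hB b c i (Nat.succ_pos j) (by omega)

/-- For `δ = 1` the correction term at `i` has the same divided powers of `Y` and `X` as the main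
term at `i + 1`. Modulo `p` the two binomials are `(M choose i)` and `(M choose i + 1)`; their sum
`(M + 1 choose i + 1)` is the binomial of a weight shifted by `p`. -/
theorem X_frob_mul_Y_frob_of_corr {a : ℕ} (ha : a < p) {B : A} (hB : T.mu p a * B = B) {δ : ℕ}
    (hδ : δ ≤ 1) (hcorr : T.corr p a * B = (δ : k) • B) (b c : ℕ) :
    T.X (p * b) * T.Y (p * c) * B = ∑ i ∈ Finset.range (b + 1),
      zext T.Y (p * (c - i)) * T.h (bpI (p * (2 * i - b - c + δ)) (p * i)) *
          zext T.X (p * (b - i)) * B := by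
  rw [T.X_frob_mul_Y_frob ha hB, hcorr]
  obtain rfl | rfl : δ = 0 ∨ δ = 1 := by omega
  · simp
  have hp0 : (0 : ℤ) < p := by exact_mod_cast hp.out.pos
  rw [Finset.sum_add_distrib]
  have h2 : ∑ i ∈ Finset.range (b + 1),
      zext T.Y (p * (c - i - 1)) * T.h (bpI (p * (2 * i + 2 - b - c)) (p * i)) *
          zext T.X (p * (b - i - 1)) * (((1 : ℕ) : k) • B) =
      ∑ i ∈ Finset.range b,
        zext T.Y (p * (c - (i + 1 : ℕ))) * T.h (bpI (p * (2 * (i + 1 : ℕ) - b - c)) (p * i)) *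
          zext T.X (p * (b - (i + 1 : ℕ))) * B := by
    -- The last correction term, `i = b`, contains `X^(-p) = 0`.
    rw [Finset.sum_range_succ, zext_neg T.X (mul_neg_of_pos_of_neg hp0 (by omega)), mul_zero,
      zero_mul, add_zero]
    refine Finset.sum_congr rfl fun i _ => ?_
    have e1 : (p : ℤ) * (c - i - 1) = p * (c - (i + 1 : ℕ)) := by push_cast; ring
    have e2 : (p : ℤ) * (b - i - 1) = p * (b - (i + 1 : ℕ)) := by push_cast; ring
    have e3 : (p : ℤ) * (2 * i + 2 - b - c) = p * (2 * (i + 1 : ℕ) - b - c) := by push_cast; ring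
    rw [Nat.cast_one, one_smul, e1, e2, e3]
  rw [h2, Finset.sum_range_succ', Finset.sum_range_succ', add_right_comm, ← Finset.sum_add_distrib]
  congr 1
  · refine Finset.sum_congr rfl fun i _ => ?_
    rw [← add_mul, ← add_mul, ← mul_add, ← map_add]
    congr 3
    apply T.h_congr p
    intro n
    rw [map_add, ev_bpI, ev_bpI, ev_bpI]
    obtain ⟨r, hr⟩ := Int.eq_ofNat_of_zero_le (Int.emod_nonneg n hp0.ne')
    have hlt := Int.emod_lt_of_pos n hp0
    have e := Int.mul_ediv_add_emod n p
    rw [hr] at hlt e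
    have hr1 : r < p := by exact_mod_cast hlt
    set N := n / p
    set D : ℤ := 2 * (i + 1 : ℕ) - b - c with hD
    have e1 : n + p * D = p * (N + D) + r := by linear_combination -e
    have e2 : n + p * (D + (1 : ℕ)) = p * (N + D + 1) + r := by push_cast; linear_combination -e
    rw [e1, e2]
    refine ((choose_lucas_zero p _ hr1 _).add (choose_lucas_zero p _ hr1 _)).trans
      (Int.ModEq.trans ?_ (choose_lucas_zero p _ hr1 _).symm)
    rw [Ring.choose_succ_succ, add_comm]
  · have h0 : ∀ c : ℤ, bpI c (p * 0) = 1 := fun c => Subtype.ext (by simp [bpI, bp])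
    rw [h0, h0]

end DividedTriple

end Hyperalgebra
end

/-! ### Polynomials in `YX` on a weight idempotent, and the eigenvalues of the correction element.
-/

noncomputable section

namespace Hyperalgebra

set_option linter.unusedSectionVars false

namespace DividedTriple

variable {k A : Type*} [Field k] [Ring A] [Algebra k A] (T : DividedTriple k A)
  {p : ℕ} [hp : Fact p.Prime] [CharP k p]

variable (p) in
/-- Evaluation of polynomials over `𝔽_p` at `Y X`. -/
def pol : (ZMod p)[X] →+* A :=
  (Polynomial.aeval (R := k) (T.Y 1 * T.X 1)).toRingHom.comp
    (Polynomial.mapRingHom (ZMod.castHom (dvd_refl p) k))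

theorem pol_apply (f : (ZMod p)[X]) : T.pol p f =
    Polynomial.aeval (T.Y 1 * T.X 1) (f.map (ZMod.castHom (dvd_refl p) k)) := rfl

theorem pol_X : T.pol p Polynomial.X = T.Y 1 * T.X 1 := by
  simp [pol_apply]

theorem pol_C (c : ZMod p) :
    T.pol p (Polynomial.C c) = algebraMap k A (ZMod.castHom (dvd_refl p) k c) := by
  simp [pol_apply]

theorem pol_comm {z : A} (hz : Commute (T.Y 1 * T.X 1) z) (f : (ZMod p)[X]) :
    Commute (T.pol p f) z := by
  induction f using Polynomial.induction_on' with
  | add f g hf hg => rw [map_add]; exact hf.add_left hg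
  | monomial n c =>
    rw [← Polynomial.C_mul_X_pow_eq_monomial, map_mul, map_pow, pol_X, pol_C]
    have hc : Commute (algebraMap k A (ZMod.castHom (dvd_refl p) k c)) z := Algebra.commutes _ _
    exact hc.mul_left (hz.pow_left n)

theorem pol_comm_mu (f : (ZMod p)[X]) (a : ℤ) : Commute (T.pol p f) (T.mu p a) :=
  T.pol_comm (T.mu_comm_YX a 1).symm f

theorem h_one_mul_mu (a c : ℤ) :
    T.h (bpI c 1) * T.mu p a = ((a + c : ℤ) : A) * T.mu p a := by
  rw [← map_intCast T.h]
  apply T.h_mul_mu_congr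
  intro n hn
  rw [ev_bpI, map_intCast, Ring.choose_one_right]
  apply Int.modEq_iff_dvd.mpr
  simpa [add_sub_add_right_eq_sub] using (dvd_sub_comm.mp hn)

/-- Next to the idempotent, `H + m + 1` is the scalar `a + m + 1`, so the recursion for `Y^m X^m`
becomes the product defining `phi`. -/
theorem pol_phi_mul_mu (a : ℤ) (m : ℕ) :
    T.pol p (phi p a m) * T.mu p a = T.Y 1 ^ m * T.X 1 ^ m * T.mu p a := by
  induction m with
  | zero => simp [phi]
  | succ m ih =>
    have e : ZMod.castHom (dvd_refl p) k ((m : ZMod p) * (m + a + 1)) =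
        ((m * (a + (m + 1)) : ℤ) : k) := by
      simp only [map_mul, map_add, map_natCast, map_intCast, map_one]
      push_cast
      ring
    have key : T.pol p (Polynomial.X - Polynomial.C ((m : ZMod p) * (m + a + 1))) * T.mu p a =
        (T.Y 1 * T.X 1 - (m : k) • T.h (bpI (m + 1) 1)) * T.mu p a := by
      rw [map_sub, pol_X, pol_C, e, map_intCast, sub_mul, sub_mul, smul_mul_assoc,
        T.h_one_mul_mu, Int.cast_mul, Algebra.smul_def, map_natCast, Int.cast_natCast,
        mul_assoc (m : A)]
    rw [phi, Finset.prod_range_succ, ← phi, map_mul, mul_assoc, (T.pol_comm_mu _ _).eq,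
      ← mul_assoc, ih, mul_assoc, ← (T.pol_comm_mu _ _).eq, key, ← mul_assoc,
      ← T.Y_pow_mul_X_pow_succ]

/-- `φ_{a,p}(YX)` acts as `Y^p X^p`, and `X^p = p! X^(p) = 0`. -/
theorem pol_mul_mu_eq_zero {a : ℤ} {f : (ZMod p)[X]} (hf : phi p a p ∣ f) :
    T.pol p f * T.mu p a = 0 := by
  obtain ⟨g, rfl⟩ := hf
  rw [mul_comm, map_mul, mul_assoc, T.pol_phi_mul_mu, T.X_one_pow,
    (CharP.cast_eq_zero_iff k p _).mpr (hp.out.dvd_factorial.mpr le_rfl)]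
  simp

theorem pol_mul_mu_congr {a : ℤ} {f g : (ZMod p)[X]} (h : phi p a p ∣ f - g) :
    T.pol p f * T.mu p a = T.pol p g * T.mu p a := by
  rw [← sub_eq_zero, ← sub_mul, ← map_sub]
  exact T.pol_mul_mu_eq_zero h

theorem phi_dvd_phi (p : ℕ) (a : ℤ) {m n : ℕ} (h : m ≤ n) : phi p a m ∣ phi p a n :=
  Finset.prod_dvd_prod_of_subset _ _ _ (Finset.range_mono h)

theorem Y_mul_X_mul_eq_zero {a : ℤ} {f : (ZMod p)[X]} {n : ℕ} (h : phi p a p ∣ phi p a n * f)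
    {m : ℕ} (hnm : n ≤ m) (hm : m < p) : T.Y m * T.X m * (T.pol p f * T.mu p a) = 0 := by
  have h2 : phi p a p ∣ phi p a m * f := h.trans (mul_dvd_mul_right (phi_dvd_phi p a hnm) f)
  rw [T.Y_mul_X_eq_pow hm, smul_mul_assoc, (T.pol_comm_mu f a).eq, ← mul_assoc,
    ← T.pol_phi_mul_mu, mul_assoc, ← (T.pol_comm_mu f a).eq, ← mul_assoc, ← map_mul,
    T.pol_mul_mu_eq_zero h2, smul_zero]

/-- The coefficient `(a choose j)` vanishes for `j > a`, so only `Y^(m) X^(m)` with `m = p - j ≥ p -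
a` occur. -/
theorem corr_mul_eq_zero {a : ℕ} {B : A}
    (h : ∀ m, p - a ≤ m → m < p → T.Y m * T.X m * B = 0) : T.corr p a * B = 0 := by
  rw [corr, Finset.sum_mul]
  refine Finset.sum_eq_zero fun j hj => ?_
  rw [Finset.mem_range] at hj
  rcases lt_or_ge a (j + 1) with h1 | h1
  · rw [Nat.choose_eq_zero_of_lt h1]; simp
  · rw [smul_mul_assoc, h _ (by omega) (by omega), smul_zero]

theorem X_p_mul_Y_p {a : ℕ} (ha : a < p) {B : A} (hB : T.mu p a * B = B) :
    T.X p * T.Y p * B = T.Y p * T.X p * B + T.h (bpI 0 p) * B + T.corr p a * B := by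
  have h := T.X_frob_mul_Y_frob ha hB 1 1
  have hp0 : (0 : ℤ) < p := by exact_mod_cast hp.out.pos
  have e0 : ∀ f : ℕ → A, zext f 0 = f 0 := fun f => zext_natCast f 0
  have e1 : ∀ f : ℕ → A, zext f p = f p := fun f => zext_natCast f p
  have e2 : ∀ f : ℕ → A, zext f (-(p : ℤ)) = 0 := fun f => zext_neg f (by omega)
  have h0 : ∀ c : ℤ, bpI c 0 = 1 := fun c => Subtype.ext (by simp [bpI, bp])
  rw [mul_one, Finset.sum_range_succ, Finset.sum_range_one] at h
  rw [h]
  norm_num [e0, e1, e2, T.X_zero, T.Y_zero, h0, add_assoc]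
  exact add_comm _ _

variable {T} {S : DividedTriple k A} (hX : S.X = T.Y) (hY : S.Y = T.X)
  (hh : ∀ q, S.h q = T.h (affI (-1) 0 q))

-- The exchange changes the sign of `H`, so weight `a` becomes weight `-a`.
include hh in
theorem mu_swap (a b : ℤ) (hab : (p : ℤ) ∣ a + b) : S.mu p b = T.mu p a := by
  rw [mu, hh, mu]
  apply T.h_congr p
  intro n
  rw [ev_affI]
  have e : (-1 * n + 0 - b) + (n - a) = -(a + b) := by ring
  have h3 : (p : ℤ) ∣ (-1 * n + 0 - b) + (n - a) := e ▸ (dvd_neg.mpr hab)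
  by_cases hn : (p : ℤ) ∣ n - a
  · exact (ev_muI_of_dvd p ((dvd_add_left hn).mp h3)).trans (ev_muI_of_dvd p hn).symm
  · have hn' : ¬ (p : ℤ) ∣ -1 * n + 0 - b := fun h4 => hn ((dvd_add_right h4).mp h3)
    exact (ev_muI_of_not_dvd p hn').trans (ev_muI_of_not_dvd p hn).symm

-- The commutator of `X^(p)` and `Y^(p)` is computed in both triples and the results are added. What
-- remains besides the two corrections is `(H choose p) + (-H choose p)`, which on weight `a` is
-- `⌊n/p⌋ + ⌊-n/p⌋ = -1`, because `p` does not divide `n`.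
include hX hY hh in
theorem corr_add_corr_swap {a : ℕ} (ha0 : 0 < a) (ha : a < p) {B : A} (hB : T.mu p a * B = B) :
    T.corr p a * B + S.corr p (p - a) * B = B := by
  have h1 := T.X_p_mul_Y_p ha hB
  have hB' : S.mu p (p - a : ℕ) * B = B := by
    rwa [mu_swap hh (a : ℤ) _ ⟨1, by push_cast [ha.le]; ring⟩]
  have h2 := S.X_p_mul_Y_p (a := p - a) (by omega) hB'
  rw [hX, hY, hh] at h2
  have h3 := T.h_mul_congr hB (q := bpI 0 p + affI (-1) 0 (bpI 0 p)) (r := -1) (fun n hn => by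
    obtain ⟨N, hN⟩ := hn
    rw [map_add, ev_affI, ev_bpI, ev_bpI, map_neg, map_one]
    have e1 : n + 0 = p * N + (a : ℤ) := by linear_combination hN
    have e2 : -1 * n + 0 + 0 = p * (-N - 1) + ((p - a : ℕ) : ℤ) := by
      push_cast [ha.le]; linear_combination -hN
    have l1 := choose_lucas_zero p N ha 1
    have l2 := choose_lucas_zero p (-N - 1) (a := p - a) (by omega) 1
    rw [mul_one, Ring.choose_one_right] at l1 l2
    rw [e1, e2]
    refine (l1.add l2).trans ?_
    rw [show N + (-N - 1) = -1 by ring])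
  rw [map_add, add_mul, map_neg, map_one, neg_mul, one_mul] at h3
  rw [h1] at h2
  have h4 : T.h (bpI 0 p) * B + T.h (affI (-1) 0 (bpI 0 p)) * B + (T.corr p a * B +
      S.corr p (p - a) * B) = 0 := by
    have := sub_eq_zero.mpr h2
    rw [← neg_eq_zero, ← this]
    abel
  rw [h3] at h4
  exact (neg_add_eq_zero.mp h4).symm

-- On the idempotent, `XY = YX + H` is `YX + a`.
include hX hY in
theorem pol_swap (a : ℤ) (f : (ZMod p)[X]) : S.pol p f * T.mu p a =
    T.pol p (f.comp (Polynomial.X + Polynomial.C (a : ZMod p))) * T.mu p a := by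
  have hD : S.Y 1 * S.X 1 * T.mu p a =
      T.pol p (Polynomial.X + Polynomial.C (a : ZMod p)) * T.mu p a := by
    rw [hX, hY, T.X_one_mul_Y, map_add, pol_X, pol_C, map_intCast, add_mul, add_mul]
    congr 1
    rw [show (((1 : ℕ) : ℤ) - 1) = ((0 : ℕ) : ℤ) by simp, zext_natCast, T.Y_zero, one_mul,
      T.h_one_mul_mu, map_intCast]
    simp
  induction f using Polynomial.induction_on' with
  | add f g hf hg => rw [map_add, add_mul, hf, hg, Polynomial.add_comp, map_add, add_mul]
  | monomial n c =>
    induction n with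
    | zero => simp [pol_C]
    | succ n ih =>
      rw [← Polynomial.monomial_mul_X, map_mul, Polynomial.mul_comp, map_mul, pol_X,
        Polynomial.X_comp, mul_assoc, hD, mul_assoc, (T.pol_comm_mu _ _).eq, ← mul_assoc, ih,
        mul_assoc]

-- The correction element of the exchanged triple has parameter `p - a`, so it involves only `X^(m)
-- Y^(m)` with `m ≥ a`. The hypothesis kills these, and the two corrections add up to the identity.
include hX hY hh in
theorem corr_mul_eq_self {a : ℕ} (ha0 : 0 < a) (ha : a < p) {f : (ZMod p)[X]}
    (h : phi p a p ∣
      (phi p (-a) a).comp (Polynomial.X + Polynomial.C (a : ZMod p)) * f) :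
    T.corr p a * (T.pol p f * T.mu p a) = T.pol p f * T.mu p a := by
  have hB : T.mu p a * (T.pol p f * T.mu p a) = T.pol p f * T.mu p a := by
    rw [← mul_assoc, ← (T.pol_comm_mu _ _).eq, mul_assoc, T.mu_mul_mu]
  have h1 := corr_add_corr_swap hX hY hh ha0 ha hB
  have hz : S.corr p (p - a) * (T.pol p f * T.mu p a) = 0 := by
    apply S.corr_mul_eq_zero
    intro m hm hmp
    rw [Nat.sub_sub_self ha.le] at hm
    have hS : S.mu p (-a) = T.mu p a := mu_swap hh _ _ (by simp)
    obtain ⟨g, hg⟩ := phi_dvd_phi p (-a) hm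
    have e : S.Y 1 ^ m * S.X 1 ^ m * (T.pol p f * T.mu p a) =
        T.pol p (g.comp (Polynomial.X + Polynomial.C (a : ZMod p)) *
          ((phi p (-a) a).comp (Polynomial.X + Polynomial.C (a : ZMod p)) * f)) * T.mu p a := by
      rw [(T.pol_comm_mu _ _).eq, ← hS, ← mul_assoc, ← S.pol_phi_mul_mu, hS, hg]
      have := pol_swap hX hY a (phi p (-a) a * g)
      rw [Int.cast_natCast] at this
      rw [this, mul_assoc, ← (T.pol_comm_mu _ _).eq, ← mul_assoc, ← map_mul, Polynomial.mul_comp]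
      congr 2
      ring
    rw [S.Y_mul_X_eq_pow hmp, smul_mul_assoc, e, T.pol_mul_mu_eq_zero (h.mul_left _), smul_zero]
  rw [hz, add_zero] at h1
  exact h1

theorem corr_pol_mul_eq_zero (T : DividedTriple k A) {a : ℕ} {f : (ZMod p)[X]}
    (h : phi p a p ∣ phi p a (p - a) * f) : T.corr p a * (T.pol p f * T.mu p a) = 0 :=
  T.corr_mul_eq_zero fun _ hm hmp => T.Y_mul_X_mul_eq_zero h hm hmp

end DividedTriple

end Hyperalgebra
end

/-! ### Frobenius-type linear maps and their compatibility with divided powers. -/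

noncomputable section

namespace Hyperalgebra

set_option linter.unusedSectionVars false

/-- `r` is, modulo `p`, the composite of `q` with `n ↦ ⌊n / p⌋ + δ`. -/
def FrobRel (p : ℕ) (δ : ℕ) (q r : intValued) : Prop :=
  ∀ n : ℤ, ev n r ≡ ev (n / p + δ) q [ZMOD p]

theorem FrobRel.add {p δ : ℕ} {q r q' r' : intValued} (h : FrobRel p δ q r)
    (h' : FrobRel p δ q' r') : FrobRel p δ (q + q') (r + r') := fun n => by
  rw [map_add, map_add]; exact (h n).add (h' n)

theorem FrobRel.mul {p δ : ℕ} {q r q' r' : intValued} (h : FrobRel p δ q r)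
    (h' : FrobRel p δ q' r') : FrobRel p δ (q * q') (r * r') := fun n => by
  rw [map_mul, map_mul]; exact (h n).mul (h' n)

theorem FrobRel.zsmul {p δ : ℕ} {q r : intValued} (h : FrobRel p δ q r) (c : ℤ) :
    FrobRel p δ (c • q) (c • r) := fun n => by
  rw [map_zsmul, map_zsmul, smul_eq_mul, smul_eq_mul]; exact (h n).mul_left c

theorem FrobRel.affI {p δ : ℕ} [hp : Fact p.Prime] {q r : intValued} (h : FrobRel p δ q r)
    (d : ℤ) : FrobRel p δ (affI 1 d q) (affI 1 (p * d) r) := fun n => by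
  have hp0 : (p : ℤ) ≠ 0 := by exact_mod_cast hp.out.ne_zero
  rw [ev_affI, ev_affI]
  refine (h _).trans ?_
  rw [one_mul, one_mul, Int.add_mul_ediv_left _ _ hp0, add_right_comm]

/-- Lucas' congruence: modulo `p`, `(n choose pi)` is `(⌊n/p⌋ choose i)`. -/
theorem frobRel_bpI {p : ℕ} [hp : Fact p.Prime] (δ : ℕ) (C : ℤ) (i : ℕ) :
    FrobRel p δ (bpI C i) (bpI (p * (C + δ)) (p * i)) := fun n => by
  have hp0 : (0 : ℤ) < p := by exact_mod_cast hp.out.pos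
  obtain ⟨r, hr⟩ := Int.eq_ofNat_of_zero_le (Int.emod_nonneg n hp0.ne')
  have hlt := Int.emod_lt_of_pos n hp0
  have e := Int.mul_ediv_add_emod n p
  rw [hr] at hlt e
  have hr1 : r < p := by exact_mod_cast hlt
  rw [ev_bpI, ev_bpI]
  have e1 : n + p * (C + δ) = p * (n / p + δ + C) + r := by linear_combination -e
  rw [e1]
  exact choose_lucas_zero p _ hr1 i

namespace DividedTriple

variable {k A : Type*} [Field k] [Ring A] [Algebra k A] (T : DividedTriple k A)
  {p : ℕ} [hp : Fact p.Prime] [CharP k p]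

variable (p) in
/-- A linear map multiplying the exponents of the basis elements by `p`, with a shift of the
weights. -/
def IsFrob (δ : ℕ) (F : A →ₗ[k] A) : Prop := ∀ m n l : ℕ, F (T.Y m * T.h (bpI 0 n) * T.X l) =
  T.Y (p * m) * T.h (bpI (p * δ) (p * n)) * T.X (p * l)

variable {T} {δ : ℕ} {F : A →ₗ[k] A}

/-- Binomial polynomials span all integer-valued ones, so some partner `r` is found by linearity.
Any two partners of `q` agree in all values modulo `p`, so the choice is immaterial. -/
theorem IsFrob.apply (hF : T.IsFrob p δ F) {q r : intValued} (h : FrobRel p δ q r) (m l : ℕ) :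
    F (T.Y m * T.h q * T.X l) = T.Y (p * m) * T.h r * T.X (p * l) := by
  have key : ∀ f ∈ bpSpan, ∃ q r : intValued, q.1 = f ∧ FrobRel p δ q r ∧
      F (T.Y m * T.h q * T.X l) = T.Y (p * m) * T.h r * T.X (p * l) := by
    intro f hf
    induction hf using Submodule.span_induction with
    | mem x hx =>
      obtain ⟨n, rfl⟩ := hx
      refine ⟨bpI 0 n, bpI (p * δ) (p * n), rfl, ?_, hF m n l⟩
      simpa using frobRel_bpI (p := p) δ 0 n
    | zero => exact ⟨0, 0, rfl, fun n => by simp, by simp⟩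
    | add x y _ _ h1 h2 =>
      obtain ⟨q, r, rfl, h1, e1⟩ := h1
      obtain ⟨q', r', rfl, h2, e2⟩ := h2
      exact ⟨q + q', r + r', rfl, h1.add h2, by
        simp only [map_add, mul_add, add_mul, e1, e2]⟩
    | smul c x _ h =>
      obtain ⟨q, r, rfl, h1, e1⟩ := h
      refine ⟨c • q, c • r, rfl, h1.zsmul c, ?_⟩
      rw [map_zsmul, map_zsmul, mul_smul_comm, smul_mul_assoc, map_zsmul, e1, mul_smul_comm,
        smul_mul_assoc]
  obtain ⟨q', r', hq, h', e⟩ := key q.1 (mem_bpSpan_of_eval_nat fun n => by simpa using q.2 n)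
  obtain rfl : q' = q := Subtype.ext hq
  rw [e, T.h_congr p (fun n => (h' n).trans (h n).symm)]

theorem IsFrob.apply_zext (hF : T.IsFrob p δ F) {q r : intValued} (h : FrobRel p δ q r) (m : ℤ)
    (l : ℕ) : F (zext T.Y m * T.h q * T.X l) = zext T.Y (p * m) * T.h r * T.X (p * l) := by
  have hp0 : (0 : ℤ) < p := by exact_mod_cast hp.out.pos
  rcases lt_or_ge m 0 with hm | hm
  · rw [zext_neg _ hm, zext_neg _ (mul_neg_of_pos_of_neg hp0 hm)]; simp
  · obtain ⟨m, rfl⟩ := Int.eq_ofNat_of_zero_le hm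
    rw [zext_natCast, ← Nat.cast_mul, zext_natCast]
    exact hF.apply h m l

theorem IsFrob.Y_mul (hF : T.IsFrob p δ F) (b m n l : ℕ) :
    F (T.Y b * (T.Y m * T.h (bpI 0 n) * T.X l)) =
      T.Y (p * b) * F (T.Y m * T.h (bpI 0 n) * T.X l) := by
  rw [hF, ← mul_assoc, ← mul_assoc, T.Y_mul_Y, smul_mul_assoc, smul_mul_assoc, map_smul, hF,
    ← mul_assoc, ← mul_assoc, T.Y_mul_Y_frob, smul_mul_assoc, smul_mul_assoc]

theorem corr_comm_h (T : DividedTriple k A) (a : ℕ) (q : intValued) :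
    Commute (T.corr p a) (T.h q) :=
  Commute.sum_left _ _ _ fun _ _ => (T.YX_comm_h _ q).smul_left _

theorem corr_comm_X_frob (T : DividedTriple k A) (a b : ℕ) :
    Commute (T.corr p a) (T.X (p * b)) :=
  Commute.sum_left _ _ _ fun _ _ =>
    (T.YX_comm_X_frob (Nat.sub_lt hp.out.pos (Nat.succ_pos _)) b).smul_left _

/-- Both sides are expanded by the commutation formulas for `X^(b) Y^(c)` and `X^(pb) Y^(pc)` and
compared term by term. The weight shift hidden in `F` matches the shift `δ` that the eigenvalue of
`corr` creates; therefore the factor `B` on the right is needed. -/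
theorem IsFrob.X_mul (hF : T.IsFrob p δ F) (hδ : δ ≤ 1) {a : ℕ} (ha : a < p) {B : A}
    (hB : T.mu p a * B = B) (hcorr : T.corr p a * B = (δ : k) • B) (b c n l : ℕ) :
    F (T.X b * (T.Y c * T.h (bpI 0 n) * T.X l)) * B =
      T.X (p * b) * F (T.Y c * T.h (bpI 0 n) * T.X l) * B := by
  set q := bpI 0 n
  set r := bpI (p * δ) (p * n)
  have hqr : FrobRel p δ q r := by simpa using frobRel_bpI (p := p) δ 0 n
  -- Since `corr` and the idempotent commute with `h` and with `X^(pl)`, the vector `B'` has the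
  -- same weight and eigenvalue as `B`.
  set B' := T.h r * (T.X (p * l) * B) with hB'
  have h1 : T.mu p a * B' = B' := by
    rw [hB', ← mul_assoc, (T.mu_comm_h _ _).eq, mul_assoc, ← mul_assoc (T.mu p a),
      (T.mu_comm_X _ _).eq, mul_assoc, hB]
  have h2 : T.corr p a * B' = (δ : k) • B' := by
    rw [hB', ← mul_assoc, (T.corr_comm_h _ _).eq, mul_assoc, ← mul_assoc (T.corr p a),
      (T.corr_comm_X_frob _ _).eq, mul_assoc, hcorr, mul_smul_comm, mul_smul_comm]
  have h3 := T.X_frob_mul_Y_frob_of_corr ha h1 hδ h2 b c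
  have e1 : T.X (p * b) * F (T.Y c * T.h q * T.X l) * B = T.X (p * b) * T.Y (p * c) * B' := by
    rw [hF.apply hqr]; simp only [hB', mul_assoc]
  rw [e1, h3, ← mul_assoc, ← mul_assoc, T.X_mul_Y, Finset.sum_mul, Finset.sum_mul, map_sum,
    Finset.sum_mul]
  refine Finset.sum_congr rfl fun i hi => ?_
  have hib : i ≤ b := Nat.lt_succ_iff.mp (Finset.mem_range.mp hi)
  obtain ⟨b', rfl⟩ := Nat.exists_eq_add_of_le hib
  have eb : ((i + b' : ℕ) : ℤ) - i = b' := by push_cast; ring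
  rw [eb, ← Nat.cast_mul, zext_natCast, zext_natCast]
  have l1 : zext T.Y (c - i) * T.h (bpI (2 * i - (i + b' : ℕ) - c) i) * T.X b' * T.h q * T.X l =
      ((b' + l).choose b' : k) • (zext T.Y (c - i) *
        T.h (bpI (2 * i - (i + b' : ℕ) - c) i * affI 1 (-2 * b') q) * T.X (b' + l)) := by
    rw [mul_assoc _ (T.X b'), T.X_mul_h, ← mul_assoc, mul_assoc _ (T.X b'), T.X_mul_X,
      mul_smul_comm, map_mul, ← mul_assoc (zext T.Y _)]
  have l2 : T.h (bpI (p * (2 * i - (i + b' : ℕ) - c + δ)) (p * i)) * T.X (p * b') * B' =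
      ((b' + l).choose b' : k) • (T.h (bpI (p * (2 * i - (i + b' : ℕ) - c + δ)) (p * i) *
        affI 1 (p * (-2 * b')) r) * T.X (p * (b' + l)) * B) := by
    rw [hB', mul_assoc, ← mul_assoc (T.X (p * b')), T.X_mul_h, mul_assoc _ (T.X (p * b')),
      ← mul_assoc (T.X (p * b')), T.X_mul_X_frob, smul_mul_assoc, mul_smul_comm, mul_smul_comm,
      map_mul, show (-2 * (p * b' : ℕ) : ℤ) = p * (-2 * b') by push_cast; ring]
    simp only [mul_assoc]
  have l3 : zext T.Y (p * (c - i)) * T.h (bpI (p * (2 * i - (i + b' : ℕ) - c + δ)) (p * i)) *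
      T.X (p * b') * B' = zext T.Y (p * (c - i)) *
        (T.h (bpI (p * (2 * i - (i + b' : ℕ) - c + δ)) (p * i)) * T.X (p * b') * B') := by
    simp only [mul_assoc]
  rw [l1, map_smul, hF.apply_zext ((frobRel_bpI δ _ i).mul (hqr.affI _)), smul_mul_assoc,
    l3, l2, mul_smul_comm]
  simp only [mul_assoc]

theorem IsFrob.YX_comm (hF : T.IsFrob p δ F) (m n l : ℕ) :
    Commute (T.Y 1 * T.X 1) (F (T.Y m * T.h (bpI 0 n) * T.X l)) := by
  rw [hF]
  exact ((T.YX_one_comm_Y_frob m).mul_right (T.YX_comm_h 1 _)).mul_right (T.YX_one_comm_X_frob l)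

theorem Y_one_pow_mul_h (T : DividedTriple k A) (s : ℕ) (q : intValued) :
    T.Y 1 ^ s * T.h q = T.h (affI 1 (2 * s) q) * T.Y 1 ^ s := by
  rw [T.Y_one_pow, smul_mul_assoc, T.Y_mul_h, mul_smul_comm]

/-- The unshifted image commutes with `Y^t X^t` for `t = m - s`; the remaining `Y^s` raises the
argument of the binomial by `2s`. As `a + 2s = p + w` with `w < p`, adding `2s` to an integer
congruent to `a` raises its quotient by `p` by one, just as adding `p` does. So inserting `F` before
`X^s` amounts to multiplying by the shifted map `G`. -/
theorem pow_mul_frob_mul_pow {G : A →ₗ[k] A} (hF : T.IsFrob p 0 F) (hG : T.IsFrob p 1 G)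
    {a s n N w : ℕ} (hw : a + 2 * s = p + w) (ha : a < p) (hwp : w < p) (hs : s ≤ n)
    (c : ℕ → k) (m' n' l' : ℕ) :
    T.mu p a * ∑ m ∈ Finset.Icc n N, c m • (T.Y 1 ^ m * T.X 1 ^ (m - s) *
        F (T.Y m' * T.h (bpI 0 n') * T.X l') * T.X 1 ^ s) =
      G (T.Y m' * T.h (bpI 0 n') * T.X l') *
        (T.mu p a * ∑ m ∈ Finset.Icc n N, c m • (T.Y 1 ^ m * T.X 1 ^ m)) := by
  have hterm : ∀ m, s ≤ m → T.Y 1 ^ m * T.X 1 ^ (m - s) *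
      F (T.Y m' * T.h (bpI 0 n') * T.X l') * T.X 1 ^ s =
      T.Y (p * m') * T.h (bpI (2 * s) (p * n')) * T.X (p * l') * (T.Y 1 ^ m * T.X 1 ^ m) := by
    intro m hm
    obtain ⟨t, rfl⟩ := Nat.exists_eq_add_of_le hm
    set W := T.Y 1 ^ t * T.X 1 ^ t with hW
    have cX : ∀ j, Commute (T.Y 1 ^ j * T.X 1 ^ j) (T.X (p * l')) := fun j =>
      T.pow_comm_of_comm (T.YX_one_comm_X_frob l') (fun c => T.h_comm_X_frob c l') j
    have cY : Commute W (T.Y (p * m')) :=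
      T.pow_comm_of_comm (T.YX_one_comm_Y_frob m') (fun c => T.h_comm_Y_frob c m') t
    have ch : Commute W (T.h (bpI (p * (0 : ℕ)) (p * n'))) :=
      T.pow_comm_of_comm (T.YX_comm_h 1 _) (fun c => T.h_comm _ _) t
    have hX : Commute (T.X 1 ^ s) (T.X (p * l')) := (T.X_comm _ _).pow_left s
    have hY : Commute (T.Y 1 ^ s) (T.Y (p * m')) := (T.Y_comm _ _).pow_left s
    rw [hF, Nat.add_sub_cancel_left]
    calc _ = T.Y 1 ^ s * (W * (T.Y (p * m') * T.h (bpI (p * (0 : ℕ)) (p * n')) * T.X (p * l'))) *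
          T.X 1 ^ s := by rw [pow_add, hW]; simp only [mul_assoc]
      _ = (T.Y 1 ^ s * T.Y (p * m')) * T.h (bpI (p * (0 : ℕ)) (p * n')) * T.X (p * l') *
          W * T.X 1 ^ s := by
        rw [((cY.mul_right ch).mul_right (cX t)).eq]; simp only [mul_assoc]
      _ = T.Y (p * m') * (T.Y 1 ^ s * T.h (bpI (p * (0 : ℕ)) (p * n'))) * (T.X (p * l') * W) *
          T.X 1 ^ s := by rw [hY.eq]; simp only [mul_assoc]
      _ = T.Y (p * m') * T.h (bpI (2 * s) (p * n')) * (T.Y 1 ^ s * W *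
          (T.X (p * l') * T.X 1 ^ s)) := by
        rw [T.Y_one_pow_mul_h, affI_bpI, ← (cX t).eq]; simp [hW, mul_assoc]
      _ = T.Y (p * m') * T.h (bpI (2 * s) (p * n')) *
          ((T.Y 1 ^ (s + t) * T.X 1 ^ (s + t)) * T.X (p * l')) := by
        rw [← hX.eq, hW, pow_add, add_comm s t, pow_add (T.X 1)]; simp only [mul_assoc]
      _ = _ := by rw [(cX (s + t)).eq]; simp only [mul_assoc]
  have h1 : ∑ m ∈ Finset.Icc n N, c m • (T.Y 1 ^ m * T.X 1 ^ (m - s) *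
        F (T.Y m' * T.h (bpI 0 n') * T.X l') * T.X 1 ^ s) =
      T.Y (p * m') * T.h (bpI (2 * s) (p * n')) * T.X (p * l') *
        ∑ m ∈ Finset.Icc n N, c m • (T.Y 1 ^ m * T.X 1 ^ m) := by
    rw [Finset.mul_sum]
    refine Finset.sum_congr rfl fun m hm => ?_
    rw [hterm m (hs.trans (Finset.mem_Icc.mp hm).1), mul_smul_comm]
  -- Both arguments have quotient `M + 1` by `p`, with remainders `w` and `a`, which a lower index
  -- divisible by `p` does not see.
  have h2 : T.h (bpI (2 * s) (p * n')) * T.mu p a =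
      T.h (bpI (p * (1 : ℕ)) (p * n')) * T.mu p a := by
    apply T.h_mul_mu_congr
    rintro n ⟨M, hM⟩
    rw [ev_bpI, ev_bpI]
    have hw' : (a : ℤ) + 2 * s = p + w := by exact_mod_cast hw
    have e1 : n + 2 * s = p * (M + 1) + (w : ℤ) := by linear_combination hM + hw'
    have e2 : n + p * (1 : ℕ) = p * (M + 1) + (a : ℤ) := by push_cast; linear_combination hM
    rw [e1, e2]
    exact (choose_lucas_zero p _ hwp _).trans (choose_lucas_zero p _ ha _).symm
  rw [h1, hG]
  calc _ = (T.mu p a * T.Y (p * m')) * T.h (bpI (2 * s) (p * n')) * T.X (p * l') *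
        ∑ m ∈ Finset.Icc n N, c m • (T.Y 1 ^ m * T.X 1 ^ m) := by simp only [mul_assoc]
    _ = T.Y (p * m') * (T.mu p a * T.h (bpI (2 * s) (p * n'))) * T.X (p * l') *
        ∑ m ∈ Finset.Icc n N, c m • (T.Y 1 ^ m * T.X 1 ^ m) := by
      rw [(T.mu_comm_Y _ _).eq]; simp only [mul_assoc]
    _ = T.Y (p * m') * T.h (bpI (p * (1 : ℕ)) (p * n')) * (T.mu p a * T.X (p * l')) *
        ∑ m ∈ Finset.Icc n N, c m • (T.Y 1 ^ m * T.X 1 ^ m) := by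
      rw [(T.mu_comm_h _ _).eq, h2]; simp only [mul_assoc]
    _ = _ := by rw [(T.mu_comm_X _ _).eq]; simp only [mul_assoc]

end DividedTriple

end Hyperalgebra
end

/-! ### The polynomials attached to a pair, and factorizations of `ψ` for odd `p`. -/

noncomputable section

namespace Hyperalgebra

open Polynomial in
/-- The properties of the polynomials `f ε` with `B^(ε)(a, j) = f ε (Y X) μ_a` which matter. -/
structure PairPol (p : ℕ) [Fact p.Prime] (a : ℕ) (j : ℚ) (f : Fin 2 → (ZMod p)[X])
    (κ l : ZMod p) : Prop where
  lt : a < p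
  rel_zero : phi p a p ∣ (X - C κ) * f 0 - C l * f 1
  rel_one : phi p a p ∣ (X - C κ) * f 1
  -- This makes `corr` act by `0`.
  not_AC : ¬ IsAC p a j → ∀ ε, phi p a p ∣ phi p a (p - a) * f ε
  -- The equation for `w` turns the inserted `Fr'` into the shifted map, the divisibility makes
  -- `corr` act by `1`, and the last inequality keeps the exponents `m - s` from being truncated.
  AC : IsAC p a j → 0 < a ∧ (∃ w < p, a + 2 * sShift p a = p + w) ∧ ∀ ε,
    phi p a p ∣ (phi p (-a) a).comp (X + C (a : ZMod p)) * f ε ∧ sShift p a ≤ nIdx p ε a j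
  dvd : ∀ ε, phi p a (nIdx p ε a j) ∣ f ε
  natDegree_lt : ∀ ε, (f ε).natDegree < p
  nIdx_le : ∀ ε, nIdx p ε a j ≤ p

open Polynomial

theorem monic_phi (p : ℕ) [Fact p.Prime] (a : ℤ) (m : ℕ) : (phi p a m).Monic :=
  monic_prod_of_monic _ _ fun _ _ => monic_X_sub_C _

theorem natDegree_phi (p : ℕ) [Fact p.Prime] (a : ℤ) (m : ℕ) : (phi p a m).natDegree = m := by
  rw [phi, natDegree_prod_of_monic _ _ fun _ _ => monic_X_sub_C _]
  simp only [natDegree_X_sub_C, Finset.sum_const, Finset.card_range, smul_eq_mul, mul_one]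

/-- Expansion of a polynomial of degree less than `N` in terms of the polynomials `φ_{a,m}`. -/
theorem exists_eq_sum_phi (p : ℕ) [Fact p.Prime] (a : ℤ) {n N : ℕ} (hn : n ≤ N)
    {f : (ZMod p)[X]} (hf : f.degree < N) (hd : phi p a n ∣ f) :
    ∃ c : ℕ → ZMod p, f = ∑ m ∈ Finset.Ico n N, C (c m) * phi p a m := by
  induction N, hn using Nat.le_induction generalizing f with
  | base =>
    refine ⟨0, ?_⟩
    rw [Finset.Ico_self, Finset.sum_empty]
    refine eq_zero_of_dvd_of_degree_lt hd ?_
    rwa [degree_eq_natDegree (monic_phi p a n).ne_zero, natDegree_phi]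
  | succ N hN ih =>
    have hlow : (f - C (f.coeff N) * phi p a N).degree < N := by
      rw [degree_lt_iff_coeff_zero]
      intro m hm
      rw [coeff_sub, coeff_C_mul]
      rcases hm.lt_or_eq with h | rfl
      · rw [coeff_eq_zero_of_degree_lt (hf.trans_le (by exact_mod_cast h)),
          coeff_eq_zero_of_natDegree_lt (p := phi p a N) (by rwa [natDegree_phi])]
        simp
      · have := (monic_phi p a N).coeff_natDegree
        rw [natDegree_phi] at this
        rw [this, mul_one, sub_self]
    obtain ⟨c, hc⟩ := ih hlow
      (dvd_sub hd ((DividedTriple.phi_dvd_phi p a hN).mul_left _))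
    refine ⟨Function.update c N (f.coeff N), ?_⟩
    rw [Finset.sum_Ico_succ_top hN, Function.update_self]
    rw [sub_eq_iff_eq_add] at hc
    rw [hc]
    congr 1
    · refine Finset.sum_congr rfl fun m hm => ?_
      rw [Function.update_of_ne (Finset.mem_Ico.mp hm).2.ne]
    · rw [← hc]

section odd

variable {p : ℕ} [hp : Fact p.Prime]

theorem psi_eq_mul_psiEps_one (j : ZMod p) : psi p = (X - C (j ^ 2)) * psiEps p 1 j := by
  rw [psiEps, if_pos rfl, mul_divByMonic_eq_iff_isRoot.mpr]
  rw [IsRoot, psi, eval_prod]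
  exact Finset.prod_eq_zero (Finset.mem_univ j) (by simp)

theorem psi_eq_X_mul_psiEps_zero : psi p = X * psiEps p 0 0 := by
  rw [psiEps, if_neg (by decide), if_pos rfl, psi, ← Finset.mul_prod_erase _ _ (Finset.mem_univ 0)]
  simp only [ne_eq, OfNat.ofNat_ne_zero, not_false_eq_true, zero_pow, map_zero, sub_zero]
  congr 1
  refine Finset.prod_congr ?_ fun _ _ => rfl
  ext i; simp

/-- The common part of the factorizations of the polynomials `ψ_j^(ε)`. -/
def psiRest (p : ℕ) [Fact p.Prime] (j : ZMod p) : (ZMod p)[X] :=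
  ∏ i : ZMod p with i ≠ 0 ∧ i ≠ j ∧ i ≠ -j, (X - C (i ^ 2))

theorem ne_neg_self (hp2 : p ≠ 2) {j : ZMod p} (hj : j ≠ 0) : j ≠ -j := by
  intro h
  have h2 : (2 : ZMod p) ≠ 0 := by
    have := (ZMod.natCast_eq_zero_iff 2 p).not.mpr (fun h =>
      hp2 ((Nat.prime_dvd_prime_iff_eq hp.out Nat.prime_two).mp h))
    exact_mod_cast this
  apply hj
  have h3 : 2 * j = 0 := by linear_combination h
  exact (mul_eq_zero.mp h3).resolve_left h2

/-- For odd `p` the roots `j` and `-j` are distinct indices with the same square, so `x - j²` occurs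
twice. -/
theorem psi_eq_mul_psiRest (hp2 : p ≠ 2) {j : ZMod p} (hj : j ≠ 0) :
    psi p = X * (X - C (j ^ 2)) ^ 2 * psiRest p j := by
  have hjj := ne_neg_self hp2 hj
  have h1 : (Finset.univ : Finset (ZMod p)) =
      insert 0 (insert j (insert (-j) (Finset.univ.filter fun i => i ≠ 0 ∧ i ≠ j ∧ i ≠ -j))) := by
    ext i
    simp
    tauto
  rw [psi, h1, Finset.prod_insert, Finset.prod_insert, Finset.prod_insert, psiRest]
  · simp; ring
  · simp
  · simp [hjj]
  · simp [hj.symm, hj]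

theorem psiEps_zero_eq {j : ZMod p} (hj : j ≠ 0) :
    psiEps p 0 j = 2 * X * (X + C (j ^ 2)) * psiRest p j := by
  rw [psiEps, if_neg (by decide), if_neg hj, psiRest]

theorem psiEps_one_eq (hp2 : p ≠ 2) {j : ZMod p} (hj : j ≠ 0) :
    psiEps p 1 j = X * (X - C (j ^ 2)) * psiRest p j := by
  apply mul_left_cancel₀ (X_sub_C_ne_zero (j ^ 2))
  rw [← psi_eq_mul_psiEps_one, psi_eq_mul_psiRest hp2 hj]
  ring

theorem psiEps_one_zero : psiEps p 1 0 = psiEps p 0 0 := by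
  apply mul_left_cancel₀ (X_ne_zero (R := ZMod p))
  rw [← psi_eq_X_mul_psiEps_zero, psi_eq_mul_psiEps_one 0]
  simp

/-- For `j ≠ 0`, write `x + j² = 2j² + (x - j²)` in `ψ_j^(0)`; the second summand contributes `2ψ`.
For `j = 0` the product is `ψ` itself. -/
theorem mul_psiEps_zero (hp2 : p ≠ 2) (j : ZMod p) : ∃ u : ZMod p,
    (X - C (j ^ 2)) * psiEps p 0 j = C (4 * j ^ 2) * psiEps p 1 j + C u * psi p := by
  by_cases hj : j = 0
  · subst hj
    refine ⟨1, ?_⟩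
    rw [psi_eq_X_mul_psiEps_zero]
    simp
  · refine ⟨2, ?_⟩
    rw [psiEps_zero_eq hj, psiEps_one_eq hp2 hj, psi_eq_mul_psiRest hp2 hj]
    simp only [C_mul, C_pow, map_ofNat]
    ring

theorem psiEps_ne_zero (hp2 : p ≠ 2) (ε : Fin 2) (j : ZMod p) : psiEps p ε j ≠ 0 := by
  have hpsi : psi p ≠ 0 := (monic_prod_of_monic _ _ fun _ _ => monic_X_sub_C _).ne_zero
  obtain rfl | rfl : ε = 0 ∨ ε = 1 := by fin_cases ε <;> simp
  · by_cases hj : j = 0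
    · subst hj
      rw [psi_eq_X_mul_psiEps_zero] at hpsi
      exact right_ne_zero_of_mul hpsi
    · have h2 : (2 : (ZMod p)[X]) ≠ 0 := by
        have h3 := ne_neg_self hp2 (one_ne_zero (α := ZMod p))
        intro h
        apply h3
        have h4 := congrArg (eval 0) h
        simp only [eval_ofNat, eval_zero] at h4
        linear_combination h4
      rw [psi_eq_mul_psiRest hp2 hj] at hpsi
      rw [psiEps_zero_eq hj]
      exact mul_ne_zero (mul_ne_zero (mul_ne_zero h2 X_ne_zero) (X_add_C_ne_zero _))
        (right_ne_zero_of_mul hpsi)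
  · rw [psi_eq_mul_psiEps_one j] at hpsi
    exact right_ne_zero_of_mul hpsi

theorem natDegree_psi : (psi p).natDegree = p := by
  rw [psi, natDegree_prod_of_monic _ _ fun _ _ => monic_X_sub_C _]
  simp only [natDegree_X_sub_C, Finset.sum_const, Finset.card_univ, ZMod.card, smul_eq_mul, mul_one]

theorem natDegree_psiEps_lt (hp2 : p ≠ 2) (ε : Fin 2) (j : ZMod p) :
    (psiEps p ε j).natDegree < p := by
  have h1 : (psiEps p 1 j).natDegree < p := by
    have := congrArg natDegree (psi_eq_mul_psiEps_one j)
    rw [natDegree_psi, natDegree_mul (X_sub_C_ne_zero _) (psiEps_ne_zero hp2 1 j),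
      natDegree_X_sub_C] at this
    omega
  obtain rfl | rfl : ε = 0 ∨ ε = 1 := by fin_cases ε <;> simp
  · obtain ⟨u, hu⟩ := mul_psiEps_zero hp2 j
    have := congrArg natDegree hu
    rw [natDegree_mul (X_sub_C_ne_zero _) (psiEps_ne_zero hp2 0 j), natDegree_X_sub_C] at this
    have h2 := natDegree_add_le (C (4 * j ^ 2) * psiEps p 1 j) (C u * psi p)
    have h3 := natDegree_C_mul_le (4 * j ^ 2) (psiEps p 1 j)
    have h4 := natDegree_C_mul_le u (psi p)
    rw [natDegree_psi] at h4
    have : 1 + (psiEps p 0 j).natDegree ≤ p := by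
      rw [this]
      exact h2.trans (max_le (h3.trans h1.le) h4)
    omega
  · exact h1

theorem eval_psiEps_eq_zero (hp2 : p ≠ 2) (ε : Fin 2) {j y : ZMod p} (h : y ^ 2 ≠ j ^ 2) :
    (psiEps p ε j).eval (y ^ 2) = 0 := by
  have h0 : (psi p).eval (y ^ 2) = 0 := by
    rw [psi, eval_prod]
    exact Finset.prod_eq_zero (Finset.mem_univ y) (by simp)
  have h1 : (psiEps p 1 j).eval (y ^ 2) = 0 := by
    rw [psi_eq_mul_psiEps_one j, eval_mul] at h0
    refine (mul_eq_zero.mp h0).resolve_left ?_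
    simpa [sub_eq_zero] using h
  obtain rfl | rfl : ε = 0 ∨ ε = 1 := by fin_cases ε <;> simp
  · obtain ⟨u, hu⟩ := mul_psiEps_zero hp2 j
    have := congrArg (eval (y ^ 2)) hu
    rw [eval_mul, eval_add, eval_mul, eval_mul, h1, h0, mul_zero, mul_zero, add_zero] at this
    refine (mul_eq_zero.mp this).resolve_left ?_
    simpa [sub_eq_zero] using h
  · exact h1

/-- For `j ≠ 0` and `ε = 0` the double factor `(x - j²)²` of `ψ` has to be supplied by the product,
so both `j` and `-j` must be hit. For `j = 0` only one factor `x` is missing. -/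
theorem psi_dvd_prod_mul_psiEps (hp2 : p ≠ 2) (ε : Fin 2) {j : ZMod p} {m : ℕ} {g : ℕ → ZMod p}
    (h1 : ∃ i < m, g i = j) (h2 : ∃ i < m, g i = -j) :
    psi p ∣ (∏ i ∈ Finset.range m, (X - C (g i ^ 2))) * psiEps p ε j := by
  obtain ⟨i₁, hi₁, e₁⟩ := h1
  obtain ⟨i₂, hi₂, e₂⟩ := h2
  by_cases hj : j = 0
  · subst hj
    have hε : psiEps p ε 0 = psiEps p 0 0 := by
      obtain rfl | rfl : ε = 0 ∨ ε = 1 := by fin_cases ε <;> simp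
      · rfl
      · exact psiEps_one_zero
    rw [hε, psi_eq_X_mul_psiEps_zero]
    refine mul_dvd_mul_right ?_ _
    have := Finset.dvd_prod_of_mem (fun i => X - C (g i ^ 2)) (Finset.mem_range.mpr hi₁)
    simpa [e₁] using this
  · have hne : i₁ ≠ i₂ := by
      rintro rfl
      exact ne_neg_self hp2 hj (e₁.symm.trans e₂)
    have hsub : ({i₁, i₂} : Finset ℕ) ⊆ Finset.range m := by
      intro i hi
      rw [Finset.mem_insert, Finset.mem_singleton] at hi
      rw [Finset.mem_range]
      rcases hi with rfl | rfl <;> assumption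
    obtain ⟨R, hR⟩ := Finset.prod_dvd_prod_of_subset _ _ (fun i => X - C (g i ^ 2)) hsub
    rw [Finset.prod_pair hne, e₁, e₂, neg_sq] at hR
    rw [hR]
    obtain rfl | rfl : ε = 0 ∨ ε = 1 := by fin_cases ε <;> simp
    · rw [psiEps_zero_eq hj, psi_eq_mul_psiRest hp2 hj]
      exact ⟨R * 2 * (X + C (j ^ 2)), by ring⟩
    · rw [psi_eq_mul_psiEps_one j]
      exact ⟨(X - C (j ^ 2)) * R, by ring⟩

theorem prod_dvd_psiEps (hp2 : p ≠ 2) (ε : Fin 2) {j : ZMod p} {m : ℕ} {g : ℕ → ZMod p}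
    (h1 : ∀ i < m, g i ^ 2 ≠ j ^ 2) (h2 : ∀ i < m, ∀ i' < m, g i ^ 2 = g i' ^ 2 → i = i') :
    (∏ i ∈ Finset.range m, (X - C (g i ^ 2))) ∣ psiEps p ε j := by
  refine Finset.prod_dvd_of_coprime ?_ ?_
  · intro i hi i' hi' hne
    refine isCoprime_X_sub_C_of_isUnit_sub (sub_ne_zero.mpr fun h => hne ?_).isUnit
    exact h2 i (Finset.mem_range.mp hi) i' (Finset.mem_range.mp hi') h
  · intro i hi
    exact dvd_iff_isRoot.mpr (eval_psiEps_eq_zero hp2 ε (h1 i (Finset.mem_range.mp hi)))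

theorem two_ne_zero_of_odd (hp2 : p ≠ 2) : (2 : ZMod p) ≠ 0 := by
  intro h
  exact ne_neg_self hp2 (one_ne_zero (α := ZMod p)) (by linear_combination h)

/-- Completing the square: `i(i + a + 1) = (i + (a+1)/2)² - ((a+1)/2)²`. -/
theorem phi_eq_comp (hp2 : p ≠ 2) (a : ℤ) (m : ℕ) : phi p a m =
    (∏ i ∈ Finset.range m, (X - C (((i : ZMod p) + ((a : ZMod p) + 1) / 2) ^ 2))).comp
      (X + C ((((a : ZMod p) + 1) / 2) ^ 2)) := by
  have h2 := two_ne_zero_of_odd hp2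
  rw [prod_comp, phi]
  refine Finset.prod_congr rfl fun i _ => ?_
  rw [sub_comp, X_comp, C_comp, add_sub_assoc, ← C_sub, sub_eq_add_neg, ← C_neg]
  congr 2
  field_simp
  ring

theorem phi_neg_comp (hp2 : p ≠ 2) (a : ℤ) (m : ℕ) :
    (phi p (-a) m).comp (X + C (a : ZMod p)) =
    (∏ i ∈ Finset.range m, (X - C (((i : ZMod p) + (1 - (a : ZMod p)) / 2) ^ 2))).comp
      (X + C ((((a : ZMod p) + 1) / 2) ^ 2)) := by
  have h2 := two_ne_zero_of_odd hp2
  rw [prod_comp, phi, prod_comp]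
  refine Finset.prod_congr rfl fun i _ => ?_
  rw [sub_comp, X_comp, C_comp, sub_comp, X_comp, C_comp, add_sub_assoc, ← C_sub, add_sub_assoc,
    ← C_sub]
  congr 2
  push_cast
  field_simp
  ring

/-- Translation by `(a + 1)/2` permutes `𝔽_p`. -/
theorem psi_comp (hp2 : p ≠ 2) (a : ℤ) :
    (psi p).comp (X + C ((((a : ZMod p) + 1) / 2) ^ 2)) = phi p a p := by
  rw [phi_eq_comp hp2]
  congr 1
  rw [psi, ← Equiv.prod_comp (Equiv.addRight (((a : ZMod p) + 1) / 2))]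
  symm
  refine Finset.prod_bij (fun i _ => (i : ZMod p)) (fun _ _ => Finset.mem_univ _) ?_ ?_ ?_
  · intro i hi i' hi' h
    rw [Finset.mem_range] at hi hi'
    have := (ZMod.natCast_eq_natCast_iff' i i' p).mp h
    rwa [Nat.mod_eq_of_lt hi, Nat.mod_eq_of_lt hi'] at this
  · intro y _
    exact ⟨y.val, Finset.mem_range.mpr (ZMod.val_lt y), by simp⟩
  · intro i _
    rfl

end odd

end Hyperalgebra
end

/-! ### Verification of the divisibilities for odd `p`. -/

noncomputable section

namespace Hyperalgebra

open Polynomial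

theorem eq_zero_or_eq_of_dvd {p x : ℤ} (hp : 0 < p) (h : p ∣ x) (h1 : -p < x) (h2 : x < 2 * p) :
    x = 0 ∨ x = p := by
  obtain ⟨t, rfl⟩ := h
  have ht1 : -1 < t := by nlinarith
  have ht2 : t < 2 := by nlinarith
  obtain rfl | rfl : t = 0 ∨ t = 1 := by omega
  · left; ring
  · right; ring

theorem isAC_iff (p a n : ℕ) (hn : 2 * n + 1 ≤ p) : IsAC p a n ↔
    (Even a ∧ p + 1 ≤ 2 * n + a) ∨ (Odd a ∧ 2 * n + 1 ≤ a) := by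
  rw [IsAC, Int.even_coe_nat, Int.odd_coe_nat]
  have e1 : (((p : ℚ) - (a : ℤ) + 1) / 2 ≤ n) ↔ p + 1 ≤ 2 * n + a := by
    rw [div_le_iff₀ (by norm_num), ← Nat.cast_le (α := ℚ)]
    push_cast
    constructor <;> intro h <;> linarith
  have e2 : ((n : ℚ) ≤ ((p : ℚ) - 1) / 2) := by
    have : ((2 * n + 1 : ℕ) : ℚ) ≤ p := Nat.cast_le.mpr hn
    push_cast at this
    linarith
  have e3 : ((n : ℚ) ≤ (((a : ℤ) : ℚ) - 1) / 2) ↔ 2 * n + 1 ≤ a := by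
    rw [le_div_iff₀ (by norm_num), ← Nat.cast_le (α := ℚ)]
    push_cast
    constructor <;> intro h <;> linarith
  rw [e1, e3]
  simp [e2]

variable {p : ℕ} [hp : Fact p.Prime]

theorem add_half_eq (hp2 : p ≠ 2) {i b : ℤ} {n : ℤ} (h : (p : ℤ) ∣ 2 * i + b - 2 * n) :
    (i : ZMod p) + (b : ZMod p) / 2 = n := by
  have h2 := two_ne_zero_of_odd hp2
  have := (ZMod.intCast_zmod_eq_zero_iff_dvd _ p).mpr h
  push_cast at this
  field_simp
  linear_combination this

theorem add_half_sq_ne (hp2 : p ≠ 2) {i b n : ℤ} (h1 : ¬ (p : ℤ) ∣ 2 * i + b - 2 * n)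
    (h2 : ¬ (p : ℤ) ∣ 2 * i + b + 2 * n) :
    ((i : ZMod p) + (b : ZMod p) / 2) ^ 2 ≠ (n : ZMod p) ^ 2 := by
  have h20 := two_ne_zero_of_odd hp2
  intro h
  rcases sq_eq_sq_iff_eq_or_eq_neg.mp h with h | h
  · apply h1
    rw [← ZMod.intCast_zmod_eq_zero_iff_dvd]
    push_cast
    field_simp at h
    linear_combination h
  · apply h2
    rw [← ZMod.intCast_zmod_eq_zero_iff_dvd]
    push_cast
    field_simp at h
    linear_combination h

theorem exists_index (hp2 : p ≠ 2) {b n : ℤ} {i : ℤ} {m : ℕ} (h0 : 0 ≤ i) (him : i < m) (t : ℤ)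
    (h : 2 * i + b - 2 * n = p * t) : ∃ i < m, ((i : ℕ) : ZMod p) + (b : ZMod p) / 2 = n := by
  obtain ⟨i, rfl⟩ := Int.eq_ofNat_of_zero_le h0
  refine ⟨i, by exact_mod_cast him, ?_⟩
  have := add_half_eq hp2 (i := i) (b := b) (n := n) ⟨t, h⟩
  simpa using this

/-- The polynomials attached to a pair, for odd `p`. -/
def oddPol (p : ℕ) [Fact p.Prime] (a : ℤ) (j : ℚ) (ε : Fin 2) : (ZMod p)[X] :=
  (psiEps p ε (j : ZMod p)).comp (X + C ((((a : ZMod p) + 1) / 2) ^ 2))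

theorem natDegree_oddPol_lt (hp2 : p ≠ 2) (a : ℤ) (j : ℚ) (ε : Fin 2) :
    (oddPol p a j ε).natDegree < p := by
  rw [oddPol, natDegree_comp, natDegree_X_add_C, mul_one]
  exact natDegree_psiEps_lt hp2 ε _

theorem oddPol_ne_zero (hp2 : p ≠ 2) (a : ℤ) (j : ℚ) (ε : Fin 2) : oddPol p a j ε ≠ 0 := by
  intro h
  have := comp_eq_zero_iff.mp h
  rcases this with h | ⟨_, h⟩
  · exact psiEps_ne_zero hp2 _ _ h
  · have := congrArg natDegree h
    rw [natDegree_X_add_C, natDegree_C] at this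
    omega

theorem le_of_phi_dvd_oddPol (hp2 : p ≠ 2) (a : ℤ) (j : ℚ) (ε : Fin 2) {n : ℕ}
    (h : phi p a n ∣ oddPol p a j ε) : n ≤ p := by
  have := natDegree_le_of_dvd h (oddPol_ne_zero hp2 a j ε)
  rw [natDegree_phi] at this
  exact this.trans (natDegree_oddPol_lt hp2 a j ε).le

theorem nIdx_eq (hp2 : p ≠ 2) (a : ℤ) (j : ℚ) (ε : Fin 2) :
    nIdx p ε a j = sSup {n : ℕ | phi p a n ∣ oddPol p a j ε} := by
  rw [nIdx, if_neg hp2]; rfl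

theorem bddAbove_oddPol (hp2 : p ≠ 2) (a : ℤ) (j : ℚ) (ε : Fin 2) :
    BddAbove {n : ℕ | phi p a n ∣ oddPol p a j ε} :=
  ⟨p, fun _ hn => le_of_phi_dvd_oddPol hp2 a j ε hn⟩

theorem phi_nIdx_dvd_oddPol (hp2 : p ≠ 2) (a : ℤ) (j : ℚ) (ε : Fin 2) :
    phi p a (nIdx p ε a j) ∣ oddPol p a j ε := by
  rw [nIdx_eq hp2]
  exact Nat.sSup_mem ⟨0, by simp [phi]⟩ (bddAbove_oddPol hp2 a j ε)

/-- In the variable `x + ((a+1)/2)²` each divisibility asks whether `±n` is among the values `i +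
(a+1)/2` for `i < p - a`, or `i + (1-a)/2` for `i < a`. The inequalities in `IsAC` decide which of
these ranges contains the indices. -/
theorem pairPol_odd (hp2 : p ≠ 2) {a n : ℕ} (ha : a < p) (hn : 2 * n + 1 ≤ p) :
    PairPol p a n (oddPol p a n) ((n : ZMod p) ^ 2 - (((a : ZMod p) + 1) / 2) ^ 2)
      (4 * (n : ZMod p) ^ 2) := by
  obtain ⟨q, hq⟩ : Odd p := hp.out.odd_of_ne_two hp2
  have hp0 : (0 : ℤ) < p := by exact_mod_cast hp.out.pos
  have hfac : ∀ ε, (X - C ((n : ZMod p) ^ 2 - (((a : ZMod p) + 1) / 2) ^ 2)) * oddPol p a n ε =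
      ((X - C ((n : ZMod p) ^ 2)) * psiEps p ε (n : ZMod p)).comp
        (X + C ((((a : ZMod p) + 1) / 2) ^ 2)) := by
    intro ε
    rw [oddPol, mul_comp, sub_comp, X_comp, C_comp, C_sub, Rat.cast_natCast, Int.cast_natCast]
    ring
  have hdvd : ∀ f : (ZMod p)[X], psi p ∣ f →
      phi p a p ∣ f.comp (X + C ((((a : ZMod p) + 1) / 2) ^ 2)) := by
    rintro f ⟨g, rfl⟩
    have := psi_comp hp2 a
    rw [Int.cast_natCast] at this
    rw [mul_comp, this]
    exact dvd_mul_right _ _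
  constructor
  · exact ha
  · obtain ⟨u, hu⟩ := mul_psiEps_zero hp2 (n : ZMod p)
    rw [hfac, hu, add_comp, mul_comp, C_comp]
    have : oddPol p a n 1 = (psiEps p 1 (n : ZMod p)).comp
        (X + C ((((a : ZMod p) + 1) / 2) ^ 2)) := by
      rw [oddPol, Rat.cast_natCast, Int.cast_natCast]
    rw [this, add_sub_cancel_left]
    exact hdvd _ (dvd_mul_left _ _)
  · rw [hfac, ← psi_eq_mul_psiEps_one]
    exact hdvd _ dvd_rfl
  · intro hAC ε
    rw [isAC_iff p a n hn] at hAC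
    rw [phi_eq_comp hp2 a (p - a), oddPol, Rat.cast_natCast, Int.cast_natCast, ← mul_comp]
    refine hdvd _ (psi_dvd_prod_mul_psiEps hp2 ε ?_ ?_)
    -- The indices below solve `2i + (a + 1) ∓ 2n = p t`, with `p = 2q + 1`, `a = 2a'` or `2a' + 1`,
    -- and `t` of the right parity. The failure of `IsAC` places them in `[0, p - a)`.
    · rcases Nat.even_or_odd a with hpar | hpar
      · obtain ⟨a', ha'⟩ := hpar
        have hle : 2 * n + a ≤ p := by
          by_contra h; exact hAC (Or.inl ⟨⟨a', ha'⟩, by omega⟩)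
        simpa using exists_index hp2 (b := a + 1) (n := n) (i := q - a' + n) (m := p - a) (by omega) (by omega) (1)
          (by push_cast [hq, ha']; ring)
      · obtain ⟨a', ha'⟩ := hpar
        have hle : a < 2 * n + 1 := by
          by_contra h; exact hAC (Or.inr ⟨⟨a', ha'⟩, by omega⟩)
        simpa using exists_index hp2 (b := a + 1) (n := n) (i := n - a' - 1) (m := p - a) (by omega) (by omega) (0)
          (by push_cast [hq, ha']; ring)
    · rcases Nat.even_or_odd a with hpar | hpar
      · obtain ⟨a', ha'⟩ := hpar
        have hle : 2 * n + a ≤ p := by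
          by_contra h; exact hAC (Or.inl ⟨⟨a', ha'⟩, by omega⟩)
        simpa using exists_index hp2 (b := a + 1) (n := -n) (i := q - a' - n) (m := p - a) (by omega) (by omega) (1)
          (by push_cast [hq, ha']; ring)
      · obtain ⟨a', ha'⟩ := hpar
        have hle : a < 2 * n + 1 := by
          by_contra h; exact hAC (Or.inr ⟨⟨a', ha'⟩, by omega⟩)
        simpa using exists_index hp2 (b := a + 1) (n := -n) (i := p - n - a' - 1) (m := p - a) (by omega) (by omega) (2)
          (by push_cast [hq, ha']; ring)
  · intro hAC
    rw [isAC_iff p a n hn] at hAC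
    have ha0 : 0 < a := by
      rcases hAC with ⟨h1, h2⟩ | ⟨h1, h2⟩ <;> omega
    have hs : (∃ a', a = a' + a' ∧ sShift p a = q - a' + 1 ∧ p + 1 ≤ 2 * n + a ∧ a' ≤ q) ∨
        ∃ a', a = 2 * a' + 1 ∧ sShift p a = q - a' ∧ 2 * n + 1 ≤ a ∧ a' ≤ q := by
      rcases hAC with ⟨⟨a', ha'⟩, h⟩ | ⟨⟨a', ha'⟩, h⟩
      · refine Or.inl ⟨a', ha', ?_, h, by omega⟩
        rw [sShift, if_neg hp2, if_pos (by rw [Int.even_coe_nat]; exact ⟨a', ha'⟩)]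
        omega
      · refine Or.inr ⟨a', ha', ?_, h, by omega⟩
        rw [sShift, if_neg hp2, if_neg (by
          rw [Int.even_coe_nat]; exact Nat.not_even_iff_odd.mpr ⟨a', ha'⟩)]
        omega
    refine ⟨ha0, ?_, fun ε => ⟨?_, ?_⟩⟩
    -- `a + 2s` is `p + 1` for even `a` and `p` for odd `a`.
    · rcases hs with ⟨a', _, h, _, _⟩ | ⟨a', _, h, _, _⟩
      · exact ⟨1, by omega, by omega⟩
      · exact ⟨0, by omega, by omega⟩
    · have := phi_neg_comp hp2 a a
      rw [Int.cast_natCast] at this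
      rw [this, oddPol, Rat.cast_natCast, Int.cast_natCast, ← mul_comp]
      refine hdvd _ (psi_dvd_prod_mul_psiEps hp2 ε ?_ ?_)
      -- Now the equation is `2i + (1 - a) ∓ 2n = p t`, and `IsAC` places the solutions in `[0, a)`.
      · rcases Nat.even_or_odd a with hpar | hpar
        · obtain ⟨a', ha'⟩ := hpar
          have hle : p + 1 ≤ 2 * n + a := by
            exact hAC.elim And.right fun h => absurd h.1 (Nat.not_odd_iff_even.mpr ⟨a', ha'⟩)
          simpa using exists_index hp2 (b := 1 - a) (n := n) (i := n + a' - q - 1) (m := a) (by omega) (by omega) (-1)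
            (by push_cast [hq, ha']; ring)
        · obtain ⟨a', ha'⟩ := hpar
          have hle : 2 * n + 1 ≤ a := by
            exact hAC.elim (fun h => absurd h.1 (Nat.not_even_iff_odd.mpr ⟨a', ha'⟩)) And.right
          simpa using exists_index hp2 (b := 1 - a) (n := n) (i := n + a') (m := a) (by omega) (by omega) (0)
            (by push_cast [hq, ha']; ring)
      · rcases Nat.even_or_odd a with hpar | hpar
        · obtain ⟨a', ha'⟩ := hpar
          have hle : p + 1 ≤ 2 * n + a := by
            exact hAC.elim And.right fun h => absurd h.1 (Nat.not_odd_iff_even.mpr ⟨a', ha'⟩)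
          simpa using exists_index hp2 (b := 1 - a) (n := -n) (i := q + a' - n) (m := a) (by omega) (by omega) (1)
            (by push_cast [hq, ha']; ring)
        · obtain ⟨a', ha'⟩ := hpar
          have hle : 2 * n + 1 ≤ a := by
            exact hAC.elim (fun h => absurd h.1 (Nat.not_even_iff_odd.mpr ⟨a', ha'⟩)) And.right
          simpa using exists_index hp2 (b := 1 - a) (n := -n) (i := a' - n) (m := a) (by omega) (by omega) (0)
            (by push_cast [hq, ha']; ring)
    · rw [nIdx_eq hp2]
      -- It suffices that the first `s` factors of `phi` have distinct roots which avoid the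
      -- exceptional value `n²`.
      refine le_csSup (bddAbove_oddPol hp2 a n ε) ?_
      change phi p a (sShift p a) ∣ _
      rw [phi_eq_comp hp2 a, oddPol, Rat.cast_natCast]
      obtain ⟨g, hg⟩ : (∏ i ∈ Finset.range (sShift p a),
          (X - C (((i : ZMod p) + (((a : ℤ) : ZMod p) + 1) / 2) ^ 2))) ∣
          psiEps p ε (n : ZMod p) := by
        refine prod_dvd_psiEps hp2 ε (fun i hi => ?_) (fun i hi i' hi' h => ?_)
        -- By size, a multiple of `p` of the form `2i + a + 1 ∓ 2n` is `0` or `p`; parity and the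
        -- bounds on `i` and `n` exclude both.
        · have hne := add_half_sq_ne hp2 (i := i) (b := a + 1) (n := n) (fun hd => ?_) (fun hd => ?_)
          · simpa using hne
          · rcases hs with ⟨a', h1, h2, h3, h4⟩ | ⟨a', h1, h2, h3, h4⟩ <;>
            · rw [h2] at hi
              have := eq_zero_or_eq_of_dvd hp0 hd (by omega) (by omega)
              clear hd
              omega
          · rcases hs with ⟨a', h1, h2, h3, h4⟩ | ⟨a', h1, h2, h3, h4⟩ <;>
            · rw [h2] at hi
              have := eq_zero_or_eq_of_dvd hp0 hd (by omega) (by omega)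
              clear hd
              omega
        -- Equal squares leave `i = i'` or `p ∣ i + i' + a + 1`, and for `i ≠ i'` this sum is
        -- positive and less than `p`.
        · have hh : (i : ZMod p) = i' ∨ ((i + i' + a + 1 : ℕ) : ZMod p) = 0 := by
            have h2 := two_ne_zero_of_odd hp2
            rcases sq_eq_sq_iff_eq_or_eq_neg.mp h with h | h
            · exact Or.inl (add_right_cancel h)
            · right
              push_cast
              field_simp at h
              push_cast at h
              have h3 : 2 * ((i : ZMod p) + i' + a + 1) = 0 := by linear_combination h
              exact (mul_eq_zero.mp h3).resolve_left h2
          have hip : i < p ∧ i' < p ∧ (i ≠ i' → i + i' + a + 1 < p) := by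
            rcases hs with ⟨a', h1, h2, h3, h4⟩ | ⟨a', h1, h2, h3, h4⟩ <;>
            · rw [h2] at hi hi'
              omega
          rcases hh with hh | hh
          · have := (ZMod.natCast_eq_natCast_iff' i i' p).mp hh
            rwa [Nat.mod_eq_of_lt hip.1, Nat.mod_eq_of_lt hip.2.1] at this
          · by_contra hii
            have := Nat.le_of_dvd (by omega) ((ZMod.natCast_eq_zero_iff _ _).mp hh)
            have := hip.2.2 hii
            omega
      rw [hg, mul_comp]
      exact dvd_mul_right _ _
  · exact phi_nIdx_dvd_oddPol hp2 a n
  · exact natDegree_oddPol_lt hp2 a n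
  · exact fun ε => le_of_phi_dvd_oddPol hp2 a n ε (phi_nIdx_dvd_oddPol hp2 a n ε)

end Hyperalgebra
end

/-! ### The pairs for `p = 2`, and the passage from polynomials back to the algebra. -/

noncomputable section

namespace Hyperalgebra

open Polynomial

instance factPrimeTwo : Fact (Nat.Prime 2) := ⟨Nat.prime_two⟩

theorem phi_two_zero : phi 2 (0 : ℕ) 2 = X * X := by
  have h : (((1 : ℕ) : ZMod 2) * ((1 : ℕ) + ((0 : ℕ) : ℤ) + 1)) = 0 := by decide
  rw [phi, Finset.prod_range_succ, Finset.prod_range_one, h]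
  simp

theorem phi_two_one : phi 2 (1 : ℕ) 2 = X * (X + 1) := by
  have h : (((1 : ℕ) : ZMod 2) * ((1 : ℕ) + ((1 : ℕ) : ℤ) + 1)) = 1 := by decide
  rw [phi, Finset.prod_range_succ, Finset.prod_range_one, h]
  simp [CharTwo.sub_eq_add]

theorem phi_one (p : ℕ) (a : ℤ) : phi p a 1 = X := by
  rw [phi, Finset.prod_range_one]; simp

theorem pairPol_two_zero_half :
    PairPol 2 0 (1 / 2) (fun ε => if ε = 0 then 1 else X) 0 1 where
  lt := by norm_num
  rel_zero := by simp
  rel_one := by rw [phi_two_zero]; simp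
  not_AC _ ε := dvd_mul_right _ _
  AC h := by
    exfalso
    rcases h with ⟨_, h, _⟩ | ⟨h, _⟩
    · norm_num at h
    · simp at h
  dvd ε := by
    obtain rfl | rfl : ε = 0 ∨ ε = 1 := by fin_cases ε <;> simp
    · simp [nIdx, phi]
    · simp [nIdx, phi_one]
  natDegree_lt ε := by
    obtain rfl | rfl : ε = 0 ∨ ε = 1 := by fin_cases ε <;> simp
    · simp
    · simp
  nIdx_le ε := by
    obtain rfl | rfl : ε = 0 ∨ ε = 1 := by fin_cases ε <;> simp
    · simp [nIdx]
    · simp [nIdx]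

theorem pairPol_two_one_zero : PairPol 2 1 0 (fun _ => X) (-1) 0 where
  lt := by norm_num
  rel_zero := by
    rw [phi_two_one, mul_comm]; simp [CharTwo.sub_eq_add]
  rel_one := by
    rw [phi_two_one, mul_comm]; simp [CharTwo.sub_eq_add]
  not_AC h := by
    exfalso
    exact h (Or.inr ⟨by simp, by norm_num, by norm_num⟩)
  AC _ := by
    refine ⟨one_pos, ⟨1, by norm_num, by simp [sShift]⟩, fun ε => ⟨?_, by simp [sShift, nIdx]⟩⟩
    rw [phi_two_one, mul_comm, phi_one]
    simp
  dvd ε := by simp [nIdx, phi_one]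
  natDegree_lt ε := by simp
  nIdx_le ε := by simp [nIdx]

theorem pairPol_two_one_one : PairPol 2 1 1 (fun _ => X + 1) 0 0 where
  lt := by norm_num
  rel_zero := by
    rw [phi_two_one]; simp
  rel_one := by
    rw [phi_two_one]; simp
  not_AC h ε := by
    rw [phi_two_one, phi_one]
  AC h := by
    exfalso
    rcases h with ⟨h, _, _⟩ | ⟨_, _, h⟩
    · simp at h
    · norm_num at h
  dvd ε := by simp [nIdx, phi]
  natDegree_lt ε := by
    have := natDegree_X_add_C (1 : ZMod 2)
    rw [C_1] at this
    rw [this]; norm_num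
  nIdx_le ε := by simp [nIdx]

theorem natCast_ne_zero_of_odd {k : Type*} [Field k] {p : ℕ} [hp : Fact p.Prime] [CharP k p]
    (hp2 : p ≠ 2) : (2 : k) ≠ 0 := by
  have := two_ne_zero_of_odd (p := p) hp2
  intro h
  apply this
  apply (ZMod.castHom (dvd_refl p) k).injective
  rw [map_ofNat, h, map_zero]

/-- The rational number has denominator dividing `4`, which is invertible in `k`, so its cast can be
computed there. -/
theorem ratCast_coeff {k : Type*} [Field k] {p : ℕ} [hp : Fact p.Prime] [CharP k p]
    (hp2 : p ≠ 2) (a n : ℕ) :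
    (((n : ℚ) ^ 2 - ((((a : ℤ) : ℚ) + 1) / 2) ^ 2 : ℚ) : k) = ZMod.castHom (dvd_refl p) k
      ((n : ZMod p) ^ 2 - (((a : ZMod p) + 1) / 2) ^ 2) := by
  have h2 := natCast_ne_zero_of_odd (k := k) hp2
  have h4 : ((4 : ℤ) : k) ≠ 0 := by
    have : ((4 : ℤ) : k) = 2 * 2 := by norm_num
    rw [this]; exact mul_ne_zero h2 h2
  have e : ((n : ℚ) ^ 2 - ((((a : ℤ) : ℚ) + 1) / 2) ^ 2 : ℚ) =
      Rat.divInt (4 * (n : ℤ) ^ 2 - (a + 1) ^ 2) 4 := by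
    rw [Rat.divInt_eq_div]
    push_cast
    ring
  rw [e, Rat.cast_divInt_of_ne_zero _ h4]
  simp only [map_sub, map_pow, map_div₀, map_add, map_natCast, map_one, map_ofNat]
  push_cast
  have h4' : (4 : k) ≠ 0 := by exact_mod_cast h4
  field_simp
  ring

namespace DividedTriple

variable {k A : Type*} [Field k] [Ring A] [Algebra k A] (T : DividedTriple k A)
  {p : ℕ} [hp : Fact p.Prime] [CharP k p]

theorem YX_mul_pol {a : ℤ} {f g : (ZMod p)[X]} {κ l : ZMod p}
    (h : phi p a p ∣ (Polynomial.X - C κ) * f - C l * g) :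
    T.Y 1 * T.X 1 * (T.pol p f * T.mu p a) =
      ZMod.castHom (dvd_refl p) k κ • (T.pol p f * T.mu p a) +
        ZMod.castHom (dvd_refl p) k l • (T.pol p g * T.mu p a) := by
  have h1 := T.pol_mul_mu_congr h
  simp only [map_mul, map_sub, pol_X, pol_C, sub_mul, ← Algebra.smul_def, smul_mul_assoc] at h1
  rw [sub_eq_iff_eq_add'] at h1
  rw [← h1, mul_assoc (T.Y 1 * T.X 1)]

/-- The idempotent commutes with `YX`, so the copies of it inside the polynomial are absorbed by the
one on the right. -/
theorem aeval_mu_mul (a : ℤ) (c : k) (g : k[X]) :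
    aeval (T.mu p a * T.Y 1 * T.X 1 + algebraMap k A c) g * T.mu p a =
      aeval (T.Y 1 * T.X 1 + algebraMap k A c) g * T.mu p a := by
  have hc : Commute (T.mu p a) (T.Y 1 * T.X 1 + algebraMap k A c) :=
    (T.mu_comm_YX a 1).add_right (Algebra.commutes c _).symm
  have h0 : (T.mu p a * T.Y 1 * T.X 1 + algebraMap k A c) * T.mu p a =
      (T.Y 1 * T.X 1 + algebraMap k A c) * T.mu p a := by
    rw [add_mul, add_mul, mul_assoc (T.mu p a), mul_assoc (T.mu p a), ← (T.mu_comm_YX a 1).eq,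
      ← mul_assoc, T.mu_mul_mu]
  induction g using Polynomial.induction_on' with
  | add f g hf hg => rw [map_add, map_add, add_mul, add_mul, hf, hg]
  | monomial n r =>
    induction n with
    | zero => simp
    | succ n ih =>
      rw [← monomial_mul_X, map_mul, map_mul, aeval_X, aeval_X, mul_assoc, h0, ← hc.eq,
        ← mul_assoc, ih, mul_assoc, hc.eq, mul_assoc]

theorem aeval_psi_mul_mu (a : ℤ) (c : ZMod p) (f : (ZMod p)[X]) :
    aeval (T.mu p a * T.Y 1 * T.X 1 + algebraMap k A (ZMod.castHom (dvd_refl p) k c))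
        (f.map (ZMod.castHom (dvd_refl p) k)) * T.mu p a =
      T.pol p (f.comp (Polynomial.X + C c)) * T.mu p a := by
  rw [T.aeval_mu_mul, pol_apply, Polynomial.map_comp, aeval_comp]
  simp

/-- Expand `f` in the `φ_{a,m}` with `n ≤ m < p`, and replace `φ_{a,m}(YX)` by `Y^m X^m` next to the
idempotent. -/
theorem exists_expansion (a : ℤ) {f : (ZMod p)[X]} {n : ℕ} (hn : n ≤ p)
    (hd : phi p a n ∣ f) (hf : f.natDegree < p) : ∃ c : ℕ → ZMod p,
      T.pol p f * T.mu p a = T.mu p a * ∑ m ∈ Finset.Icc n (p - 1),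
        ZMod.castHom (dvd_refl p) k (c m) • (T.Y 1 ^ m * T.X 1 ^ m) := by
  obtain ⟨c, hc⟩ := exists_eq_sum_phi p a hn
    (degree_le_natDegree.trans_lt (Nat.cast_lt.mpr hf)) hd
  refine ⟨c, ?_⟩
  have hI : Finset.Icc n (p - 1) = Finset.Ico n p := by
    ext i
    have := hp.out.pos
    simp only [Finset.mem_Icc, Finset.mem_Ico]
    omega
  rw [hI, Finset.mul_sum]
  conv_lhs => rw [hc, map_sum, Finset.sum_mul]
  refine Finset.sum_congr rfl fun m _ => ?_
  rw [map_mul, mul_assoc, T.pol_phi_mul_mu, pol_C, ← Algebra.smul_def, mul_smul_comm,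
    T.pow_comm_of_comm (T.mu_comm_YX a 1).symm (fun c => T.h_comm _ _) m]

end DividedTriple

end Hyperalgebra
end

/-! ### Transfer to the hyperalgebra. -/

noncomputable section

namespace Hyperalgebra

set_option linter.unusedSectionVars false

open Polynomial

variable (k : Type*) [Field k] {p : ℕ} [hp : Fact p.Prime] [CharP k p]

theorem mu_eq (a : ℤ) : mu p k a = (tripleU k).mu p a := by
  rw [mu, Hd_eq_hh]; rfl

/-- Common interface for odd and even `p`: from here on only `PairPol` and the two scalars are used.
-/
theorem exists_pairPol {a : ℤ} {j : ℚ} (haj : (a, j) ∈ pairs p) :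
    ∃ (b : ℕ) (f : Fin 2 → (ZMod p)[X]) (κ l : ZMod p), a = b ∧ PairPol p b j f κ l ∧
      ZMod.castHom (dvd_refl p) k κ = ((j ^ 2 - ((a + 1) / 2) ^ 2 : ℚ) : k) ∧
      ZMod.castHom (dvd_refl p) k l = ((4 * j ^ 2 : ℚ) : k) ∧
      ∀ ε, B₁ p k ε a j = (tripleU k).pol p (f ε) * (tripleU k).mu p b := by
  by_cases hp2 : p = 2
  · subst hp2
    have h2 : (2 : k) = 0 := by exact_mod_cast CharP.cast_eq_zero k 2
    have e : (tripleU k).pol 2 X * (tripleU k).mu 2 (1 : ℕ) = mu 2 k 1 * Yd k 1 * Xd k 1 := by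
      rw [((tripleU k).pol_comm_mu _ _).eq, (tripleU k).pol_X, ← mu_eq, mul_assoc]; rfl
    have e0 : (tripleU k).pol 2 X * (tripleU k).mu 2 (0 : ℕ) = mu 2 k 0 * Yd k 1 * Xd k 1 := by
      rw [((tripleU k).pol_comm_mu _ _).eq, (tripleU k).pol_X, ← mu_eq, mul_assoc]; rfl
    rw [pairs, if_pos rfl] at haj
    simp only [Set.mem_insert_iff, Set.mem_singleton_iff, Prod.mk.injEq] at haj
    rcases haj with ⟨rfl, rfl⟩ | ⟨rfl, rfl⟩ | ⟨rfl, rfl⟩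
    · refine ⟨0, _, _, _, rfl, pairPol_two_zero_half, by norm_num, by norm_num, fun ε => ?_⟩
      rw [B₁, if_pos rfl, if_pos ⟨rfl, rfl⟩]
      split_ifs
      · rw [map_one, one_mul, ← mu_eq]; rfl
      · rw [e0]
    · refine ⟨1, _, _, _, rfl, pairPol_two_one_zero, by norm_num, by norm_num, fun ε => ?_⟩
      rw [B₁, if_pos rfl, if_neg (by norm_num), if_pos ⟨rfl, rfl⟩, e]
    · refine ⟨1, _, _, _, rfl, pairPol_two_one_one, by norm_num, ?_, fun ε => ?_⟩
      · have h4 : (4 : k) = 0 := by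
          rw [show (4 : k) = 2 * 2 by norm_num, h2, mul_zero]
        norm_num
        exact h4.symm
      · rw [B₁, if_pos rfl, if_neg (by norm_num), if_neg (by norm_num), if_pos ⟨rfl, rfl⟩, map_add,
          add_mul, e, map_one, one_mul, ← mu_eq]
        rfl
  · rw [pairs, if_neg hp2] at haj
    obtain ⟨⟨h0, hlt⟩, n, hn, hj⟩ := haj
    simp only at h0 hlt hj
    obtain ⟨b, rfl⟩ := Int.eq_ofNat_of_zero_le h0
    subst hj
    have hp1 := hp.out.two_le
    refine ⟨b, _, _, _, rfl, pairPol_odd hp2 (by exact_mod_cast hlt) (by omega),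
      (ratCast_coeff hp2 b n).symm, ?_, fun ε => ?_⟩
    · have : ((4 * (n : ℚ) ^ 2 : ℚ)) = ((4 * n ^ 2 : ℕ) : ℚ) := by push_cast; ring
      rw [this, Rat.cast_natCast]
      simp only [map_mul, map_ofNat, map_pow, map_natCast]
      push_cast
      rfl
    · have h := (tripleU k).aeval_psi_mul_mu (p := p) b (((((b : ℤ) : ZMod p) + 1) / 2) ^ 2)
        (psiEps p ε ((n : ℚ) : ZMod p))
      have e : ZMod.castHom (dvd_refl p) k (((((b : ℤ) : ZMod p) + 1) / 2) ^ 2) =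
          ((((b : ℤ) : k) + 1) / 2) ^ 2 := by
        simp only [map_pow, map_div₀, map_add, map_intCast, map_one, map_ofNat]
      rw [e, ← mu_eq] at h
      rw [B₁, if_neg hp2]
      exact h.trans (by rw [mu_eq]; rfl)

/-- The variant of `Fr'` with weights shifted by `p δ`. -/
def frShift (p : ℕ) (δ : ℕ) : U k →ₗ[k] U k :=
  (basisU k).constr k fun i =>
    (tripleU k).Y (p * i.1) * (tripleU k).h (bpI (p * δ) (p * i.2.1)) * (tripleU k).X (p * i.2.2)

theorem basisU_eq (m n l : ℕ) :
    basisU k (m, n, l) = (tripleU k).Y m * (tripleU k).h (bpI 0 n) * (tripleU k).X l := by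
  rw [basisU_apply, Hd_eq_hh]; rfl

theorem isFrob_frShift (δ : ℕ) : (tripleU k).IsFrob p δ (frShift k p δ) := by
  intro m n l
  rw [← basisU_eq, frShift, Module.Basis.constr_basis]

theorem frPrime_eq : frPrime p k = frShift k p 0 := by
  refine (basisU k).ext fun ⟨m, n, l⟩ => ?_
  rw [basisU_eq, isFrob_frShift]
  have := frPrime_apply p k m n l
  rw [Hd_eq_hh, Hd_eq_hh] at this
  refine this.trans ?_
  rw [mul_comm m, mul_comm n, mul_comm l, Nat.cast_zero, mul_zero]
  rfl

/-- A property of all elements of the hyperalgebra may be checked on the basis. -/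
theorem linear_ext {F G : U k →ₗ[k] U k} (h : ∀ m n l : ℕ,
    F ((tripleU k).Y m * (tripleU k).h (bpI 0 n) * (tripleU k).X l) =
      G ((tripleU k).Y m * (tripleU k).h (bpI 0 n) * (tripleU k).X l)) (z : U k) : F z = G z := by
  refine LinearMap.congr_fun ((basisU k).ext fun ⟨m, n, l⟩ => ?_) z
  rw [basisU_eq, h]

theorem Y_frob_mul_frShift (δ b : ℕ) (z : U k) :
    (tripleU k).Y (p * b) * frShift k p δ z = frShift k p δ ((tripleU k).Y b * z) :=
  linear_ext k (F := (LinearMap.mulLeft k ((tripleU k).Y (p * b))).comp (frShift k p δ))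
    (G := (frShift k p δ).comp (LinearMap.mulLeft k ((tripleU k).Y b)))
    (fun m n l => ((isFrob_frShift k δ).Y_mul b m n l).symm) z

theorem X_frob_mul_frShift {δ : ℕ} (hδ : δ ≤ 1) {a : ℕ} (ha : a < p) {B : U k}
    (hB : (tripleU k).mu p a * B = B) (hcorr : (tripleU k).corr p a * B = (δ : k) • B) (b : ℕ)
    (z : U k) : (tripleU k).X (p * b) * frShift k p δ z * B =
      frShift k p δ ((tripleU k).X b * z) * B :=
  linear_ext k
    (F := (LinearMap.mulRight k B).comp
      ((LinearMap.mulLeft k ((tripleU k).X (p * b))).comp (frShift k p δ)))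
    (G := (LinearMap.mulRight k B).comp
      ((frShift k p δ).comp (LinearMap.mulLeft k ((tripleU k).X b))))
    (fun m n l => ((isFrob_frShift k δ).X_mul hδ ha hB hcorr b m n l).symm) z

theorem YX_comm_frShift (δ : ℕ) (z : U k) :
    (tripleU k).Y 1 * (tripleU k).X 1 * frShift k p δ z =
      frShift k p δ z * ((tripleU k).Y 1 * (tripleU k).X 1) :=
  linear_ext k
    (F := (LinearMap.mulLeft k ((tripleU k).Y 1 * (tripleU k).X 1)).comp (frShift k p δ))
    (G := (LinearMap.mulRight k ((tripleU k).Y 1 * (tripleU k).X 1)).comp (frShift k p δ))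
    (fun m n l => ((isFrob_frShift k δ).YX_comm m n l).eq) z

theorem pow_mul_frPrime_mul_pow {a s n N w : ℕ} (hw : a + 2 * s = p + w) (ha : a < p)
    (hwp : w < p) (hs : s ≤ n) (c : ℕ → k) (z : U k) :
    (tripleU k).mu p a * ∑ m ∈ Finset.Icc n N, c m • ((tripleU k).Y 1 ^ m *
        (tripleU k).X 1 ^ (m - s) * frShift k p 0 z * (tripleU k).X 1 ^ s) =
      frShift k p 1 z * ((tripleU k).mu p a *
        ∑ m ∈ Finset.Icc n N, c m • ((tripleU k).Y 1 ^ m * (tripleU k).X 1 ^ m)) := by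
  have h := linear_ext k
    (F := (LinearMap.mulLeft k ((tripleU k).mu p a)).comp (∑ m ∈ Finset.Icc n N,
      c m • ((LinearMap.mulRight k ((tripleU k).X 1 ^ s)).comp
        ((LinearMap.mulLeft k ((tripleU k).Y 1 ^ m * (tripleU k).X 1 ^ (m - s))).comp
          (frShift k p 0)))))
    (G := (LinearMap.mulRight k ((tripleU k).mu p a *
        ∑ m ∈ Finset.Icc n N, c m • ((tripleU k).Y 1 ^ m * (tripleU k).X 1 ^ m))).comp
        (frShift k p 1)) (fun m' n' l' => by
      have := DividedTriple.pow_mul_frob_mul_pow (isFrob_frShift k 0) (isFrob_frShift k 1) (N := N)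
        hw ha hwp hs c m' n' l'
      simpa only [LinearMap.comp_apply, LinearMap.sum_apply, LinearMap.smul_apply,
        LinearMap.mulLeft_apply, LinearMap.mulRight_apply] using this) z
  simpa only [LinearMap.comp_apply, LinearMap.sum_apply, LinearMap.smul_apply,
        LinearMap.mulLeft_apply, LinearMap.mulRight_apply] using h

end Hyperalgebra
end

/-! ### The maps `Z` as multiplication by a Frobenius image, and the induction. -/

noncomputable section

namespace Hyperalgebra

open Polynomial

variable (k : Type*) [Field k] {p : ℕ} [hp : Fact p.Prime] [CharP k p]

-- For `IsAC` the inserted `Fr'(z)` moves to the left at the cost of the weight shift by `p`,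
-- leaving the expansion of `B₁`. Otherwise this is the definition.
open Classical in
theorem Z_eq {b : ℕ} {j : ℚ} {f : Fin 2 → (ZMod p)[X]} {κ l : ZMod p} (h : PairPol p b j f κ l)
    (hB : ∀ ε, B₁ p k ε b j = (tripleU k).pol p (f ε) * (tripleU k).mu p b) (ε : Fin 2) (z : U k) :
    Z p k ε z b j = frShift k p (if IsAC p b j then 1 else 0) z * B₁ p k ε b j := by
  by_cases hAC : IsAC p b j
  · rw [if_pos hAC, Z, if_pos hAC]
    obtain ⟨-, ⟨w, hwp, hw⟩, hs⟩ := h.AC hAC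
    have hex : ∃ c : ℕ → ZMod p, B₁ p k ε b j = mu p k b * ∑ m ∈ Finset.Icc (nIdx p ε b j) (p - 1),
        ZMod.castHom (dvd_refl p) k (c m) • (Yd k 1 ^ m * Xd k 1 ^ m) := by
      obtain ⟨c, hc⟩ := (tripleU k).exists_expansion b (h.nIdx_le ε) (h.dvd ε) (h.natDegree_lt ε)
      refine ⟨c, ?_⟩
      rw [hB, mu_eq]
      exact hc
    -- Existence of one expansion already makes the chosen coefficients satisfy it; uniqueness plays
    -- no role.
    have hc := Classical.epsilon_spec hex
    have h1 := pow_mul_frPrime_mul_pow k hw h.lt hwp (hs ε).2 (N := p - 1)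
      (fun m => ZMod.castHom (dvd_refl p) k (coeffB p k ε b j m)) z
    rw [← mu_eq, ← frPrime_eq] at h1
    exact h1.trans (congrArg (fun x => frShift k p 1 z * x) hc.symm)
  · rw [if_neg hAC, Z, if_neg hAC, frPrime_eq]

theorem mu_mul_B₁ {b : ℕ} {f : (ZMod p)[X]} :
    (tripleU k).mu p b * ((tripleU k).pol p f * (tripleU k).mu p b) =
      (tripleU k).pol p f * (tripleU k).mu p b := by
  rw [← mul_assoc, ← ((tripleU k).pol_comm_mu _ _).eq, mul_assoc, (tripleU k).mu_mul_mu]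

open Classical in
theorem corr_mul_B₁ {b : ℕ} {j : ℚ} {f : Fin 2 → (ZMod p)[X]} {κ l : ZMod p}
    (h : PairPol p b j f κ l) (ε : Fin 2) :
    (tripleU k).corr p b * ((tripleU k).pol p (f ε) * (tripleU k).mu p b) =
      ((if IsAC p b j then 1 else 0 : ℕ) : k) • ((tripleU k).pol p (f ε) * (tripleU k).mu p b) := by
  by_cases hAC : IsAC p b j
  · rw [if_pos hAC, Nat.cast_one, one_smul]
    obtain ⟨h0, -, hd⟩ := h.AC hAC
    exact DividedTriple.corr_mul_eq_self (T := tripleU k) (S := swapU k) rfl rfl (fun _ => rfl) h0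
      h.lt (hd ε).1
  · rw [if_neg hAC, Nat.cast_zero, zero_smul]
    exact (tripleU k).corr_pol_mul_eq_zero (h.not_AC hAC ε)

theorem YX_mul_B₁_zero {a : ℤ} {j : ℚ} (haj : (a, j) ∈ pairs p) :
    Yd k 1 * Xd k 1 * B₁ p k 0 a j = ((j ^ 2 - ((a + 1) / 2) ^ 2 : ℚ) : k) • B₁ p k 0 a j +
      ((4 * j ^ 2 : ℚ) : k) • B₁ p k 1 a j := by
  obtain ⟨b, f, κ, l, rfl, h, hκ, hl, hB⟩ := exists_pairPol k haj
  rw [hB, hB, ← hκ, ← hl]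
  exact (tripleU k).YX_mul_pol h.rel_zero

theorem YX_mul_B₁_one {a : ℤ} {j : ℚ} (haj : (a, j) ∈ pairs p) :
    Yd k 1 * Xd k 1 * B₁ p k 1 a j = ((j ^ 2 - ((a + 1) / 2) ^ 2 : ℚ) : k) • B₁ p k 1 a j := by
  obtain ⟨b, f, κ, l, rfl, h, hκ, hl, hB⟩ := exists_pairPol k haj
  rw [hB, ← hκ]
  have := (tripleU k).YX_mul_pol (a := b) (f := f 1) (g := 0) (κ := κ) (l := 0)
    (by simpa using h.rel_one)
  rw [map_zero, zero_smul, add_zero] at this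
  exact this

/-- `YX` passes through the Frobenius factor and acts on `B₁`. The shift depends only on the pair
and not on `ε`, so both resulting terms carry the same factor. -/
theorem YX_mul_Z_zero {a : ℤ} {j : ℚ} (haj : (a, j) ∈ pairs p) (z : U k) :
    Yd k 1 * Xd k 1 * Z p k 0 z a j = ((j ^ 2 - ((a + 1) / 2) ^ 2 : ℚ) : k) • Z p k 0 z a j +
      ((4 * j ^ 2 : ℚ) : k) • Z p k 1 z a j := by
  have h1 := YX_mul_B₁_zero k haj
  obtain ⟨b, f, κ, l, rfl, h, hκ, hl, hB⟩ := exists_pairPol k haj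
  have h2 := YX_comm_frShift k (p := p)
  simp only [Z_eq k h hB]
  rw [← mul_assoc]
  refine (congrArg (· * B₁ p k 0 b j) (h2 _ z)).trans ?_
  rw [mul_assoc]
  refine (congrArg (frShift k p _ z * ·) h1).trans ?_
  simp only [mul_add, mul_smul_comm]

theorem YX_mul_Z_one {a : ℤ} {j : ℚ} (haj : (a, j) ∈ pairs p) (z : U k) :
    Yd k 1 * Xd k 1 * Z p k 1 z a j = ((j ^ 2 - ((a + 1) / 2) ^ 2 : ℚ) : k) • Z p k 1 z a j := by
  have h1 := YX_mul_B₁_one k haj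
  obtain ⟨b, f, κ, l, rfl, h, hκ, hl, hB⟩ := exists_pairPol k haj
  have h2 := YX_comm_frShift k (p := p)
  simp only [Z_eq k h hB]
  rw [← mul_assoc]
  refine (congrArg (· * B₁ p k 1 b j) (h2 _ z)).trans ?_
  rw [mul_assoc]
  refine (congrArg (frShift k p _ z * ·) h1).trans ?_
  simp only [mul_smul_comm]

-- `X^(pq)` and then `Y^(pq)` are pulled into the Frobenius map; for the former, the shift equals
-- the eigenvalue of `corr` on `B₁`.
open Classical in
theorem YX_frob_mul_Z {a : ℤ} {j : ℚ} (haj : (a, j) ∈ pairs p) (ε : Fin 2) (q : ℕ) (z : U k) :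
    Yd k (p * q) * Xd k (p * q) * Z p k ε z a j = Z p k ε (Yd k q * Xd k q * z) a j := by
  obtain ⟨b, f, κ, l, rfl, h, hκ, hl, hB⟩ := exists_pairPol k haj
  rw [Z_eq k h hB, Z_eq k h hB, hB, mul_assoc (Yd k (p * q))]
  set δ := (if IsAC p b j then 1 else 0 : ℕ) with hδ
  have hδ1 : δ ≤ 1 := by rw [hδ]; split_ifs <;> omega
  have h1 := X_frob_mul_frShift k hδ1 h.lt (mu_mul_B₁ k) (corr_mul_B₁ k h ε) q z
  have h2 := Y_frob_mul_frShift k (p := p) δ q (Xd k q * z)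
  rw [mul_assoc] at h1
  refine (congrArg (Yd k (p * q) * ·) h1).trans ?_
  rw [← mul_assoc, mul_assoc (Yd k q)]
  exact congrArg (· * _) h2

theorem Z_add {a : ℤ} {j : ℚ} (haj : (a, j) ∈ pairs p) (ε : Fin 2) (z w : U k) :
    Z p k ε (z + w) a j = Z p k ε z a j + Z p k ε w a j := by
  obtain ⟨b, f, κ, l, rfl, h, hκ, hl, hB⟩ := exists_pairPol k haj
  rw [Z_eq k h hB, Z_eq k h hB, Z_eq k h hB, map_add, add_mul]

theorem Z_smul {a : ℤ} {j : ℚ} (haj : (a, j) ∈ pairs p) (ε : Fin 2) (c : k) (z : U k) :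
    Z p k ε (c • z) a j = c • Z p k ε z a j := by
  obtain ⟨b, f, κ, l, rfl, h, hκ, hl, hB⟩ := exists_pairPol k haj
  rw [Z_eq k h hB, Z_eq k h hB, map_smul, smul_mul_assoc]

/-- Induction on `r`: position `0` is the action of `YX` on `Z`, and a later position is passed to
the tail through `Z`, which is linear in its argument. -/
theorem YX_frob_mul_B (r : ℕ) (ε : Fin r → Fin 2) (a : Fin r → ℤ) (j : Fin r → ℚ)
    (haj : ∀ i, (a i, j i) ∈ pairs p) (s : Fin r) :
    (ε s = 0 → Yd k (p ^ (s : ℕ)) * Xd k (p ^ (s : ℕ)) * B p k r ε a j =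
        (((j s) ^ 2 - (((a s : ℚ) + 1) / 2) ^ 2 : ℚ) : k) • B p k r ε a j +
          ((4 * (j s) ^ 2 : ℚ) : k) • B p k r (ε + Pi.single s 1) a j) ∧
    (ε s = 1 → Yd k (p ^ (s : ℕ)) * Xd k (p ^ (s : ℕ)) * B p k r ε a j =
        (((j s) ^ 2 - (((a s : ℚ) + 1) / 2) ^ 2 : ℚ) : k) • B p k r ε a j) := by
  induction r with
  | zero => exact s.elim0
  | succ r ih =>
    cases r with
    | zero =>
      obtain rfl : s = 0 := Subsingleton.elim (α := Fin 1) s 0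
      simp only [B, Fin.val_zero, pow_zero, Pi.add_apply, Pi.single_eq_same]
      refine ⟨fun h => ?_, fun h => ?_⟩
      · rw [h, show (0 + 1 : Fin 2) = 1 from rfl]; exact YX_mul_B₁_zero k (haj 0)
      · rw [h]; exact YX_mul_B₁_one k (haj 0)
    | succ r =>
      cases s using Fin.cases with
      | zero =>
        have e : ∀ i : Fin (r + 1), (ε + Pi.single 0 1 : Fin (r + 2) → Fin 2) i.succ = ε i.succ := by
          intro i
          rw [Pi.add_apply, Pi.single_eq_of_ne (Fin.succ_ne_zero i), add_zero]
        have e0 : (ε + Pi.single 0 1 : Fin (r + 2) → Fin 2) 0 = ε 0 + 1 := by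
          rw [Pi.add_apply, Pi.single_eq_same]
        simp only [B, Fin.val_zero, pow_zero, e, e0]
        refine ⟨fun h => ?_, fun h => ?_⟩
        · rw [h, show (0 + 1 : Fin 2) = 1 from rfl]; exact YX_mul_Z_zero k (haj 0) _
        · rw [h]; exact YX_mul_Z_one k (haj 0) _
      | succ s =>
        have e : (fun i : Fin (r + 1) => (ε + Pi.single s.succ 1 : Fin (r + 2) → Fin 2) i.succ) =
            (fun i => ε i.succ) + Pi.single s 1 := by
          funext i
          rw [Pi.add_apply, Pi.add_apply]
          congr 1
          by_cases h : i = s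
          · subst h; rw [Pi.single_eq_same, Pi.single_eq_same]
          · rw [Pi.single_eq_of_ne h, Pi.single_eq_of_ne (fun h' => h (Fin.succ_injective _ h'))]
        have e0 : (ε + Pi.single s.succ 1 : Fin (r + 2) → Fin 2) 0 = ε 0 := by
          rw [Pi.add_apply, Pi.single_eq_of_ne (Fin.succ_ne_zero s).symm, add_zero]
        obtain ⟨ih0, ih1⟩ := ih (fun i => ε i.succ) (fun i => a i.succ) (fun i => j i.succ)
          (fun i => haj i.succ) s
        -- Writing `p^(s+1)` as `p * p^s` brings the exponent to the form that is pulled into `Z`.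
        simp only [B, Fin.val_succ, pow_succ' p (s : ℕ), e, e0]
        refine ⟨fun h => ?_, fun h => ?_⟩
        · rw [YX_frob_mul_Z k (haj 0), ih0 h, Z_add k (haj 0), Z_smul k (haj 0), Z_smul k (haj 0)]
        · rw [YX_frob_mul_Z k (haj 0), ih1 h, Z_smul k (haj 0)]

end Hyperalgebra
end

theorem proposition3p7 (p : ℕ) [Fact p.Prime] (k : Type*) [Field k] [IsAlgClosed k] [CharP k p]
    (r : ℕ) (ε : Fin r → Fin 2) (a : Fin r → ℤ) (j : Fin r → ℚ)
    (haj : ∀ i, (a i, j i) ∈ Hyperalgebra.pairs p) (s : Fin r) :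
    (ε s = 0 →
      Hyperalgebra.Yd k (p ^ (s : ℕ)) * Hyperalgebra.Xd k (p ^ (s : ℕ)) *
          Hyperalgebra.B p k r ε a j =
        (((j s) ^ 2 - (((a s : ℚ) + 1) / 2) ^ 2 : ℚ) : k) • Hyperalgebra.B p k r ε a j +
          ((4 * (j s) ^ 2 : ℚ) : k) • Hyperalgebra.B p k r (ε + Pi.single s 1) a j) ∧
    (ε s = 1 →
      Hyperalgebra.Yd k (p ^ (s : ℕ)) * Hyperalgebra.Xd k (p ^ (s : ℕ)) *
          Hyperalgebra.B p k r ε a j =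
        (((j s) ^ 2 - (((a s : ℚ) + 1) / 2) ^ 2 : ℚ) : k) • Hyperalgebra.B p k r ε a j) :=
  Hyperalgebra.YX_frob_mul_B k r ε a j haj s
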